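/- Let $L_0\in\mathbb R$ and let $N$ be the 4-dimensional neutral space form of constant sectional curvature $L_0$: $N=E^4_2$ if $L_0=0$, $N=\{x\in E^5_2 : \langle x,x\rangle =1/L_0\}$ if $L_0>0$, $N=\{x\in E^5_3 : \langle x,x\rangle =1/L_0\}$ if $L_0<0$. Let $h$ be its metric and $\nabla$ its Levi-Civita connection, and fix one of the two orientations of $N$. All maps and functions are $C^\infty$. A Lorentz surface is a surface with an atlas of local coordinates $(u,v)$ (paracomplex coordinates $\check w=u+jv$) whose coordinate changes preserve the conformal class of $du^2-dv^2$ and the orientation. For a time-like conformal immersion $F$ of a Lorentz surface into $N$ with zero mean curvature vector and a local paracomplex coordinate $\check w=u+jv$, write the induced metric as $g=e^{2\lambda}(du^2-dv^2)$, and put $T_1=dF(\partial_u)$, $T_2=dF(\partial_v)$. Let $N_1,N_2$ be normal vector fields of $F$ with $h(N_1,N_1)=-h(N_2,N_2)=e^{2\lambda}$, $h(N_1,N_2)=0$, such that $(T_1,N_1,T_2,N_2)$ is positively oriented in $N$. With $\sigma$ the second fundamental form, define $\alpha_k,\beta_k,\mu_k$ $(k=1,2)$ by $$\sigma(\partial_u,\partial_u)=\alpha_1N_1+\beta_1N_2,\qquad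 \sigma(\partial_u,\partial_v)=\alpha_2N_1+\beta_2N_2,\qquad \mu_k=-e^{-2\lambda}h(\nabla_{T_k}N_1,N_2),$$ and put $X_\pm=\alpha_1\pm\beta_2$, $Y_\pm=\alpha_2\pm\beta_1$. Put $s=(u+v)/\sqrt2$, $t=(u-v)/\sqrt2$. Say that functions $\lambda,\alpha_k,\beta_k,\mu_k$ on an open set $U$ of the $(u,v)$-plane are *of explicit type* if there are signs $\varepsilon,\varepsilon',\varepsilon''\in\{1,-1\}$, functions $f_1,f_2$ on $U$ solving the semilinear hyperbolic system $$(f_1)_{st}=L_0e^{-f_1-f_2},\qquad (f_2)_{st}=-\frac{\varepsilon}{2}e^{f_1+2f_2},$$ and functions $P_+,Q_+,\tilde P_-$ on $U$ with $f_1=P_+-Q_++2\tilde P_-$ and $f_2=Q_+-\tilde P_-$, such that $$\lambda=-\tfrac12(P_++\tilde P_-),$$ $$\mu_1=-\tfrac12(P_+)_u+\tfrac1{\sqrt2}(Q_+)_s-\tfrac12(\tilde P_-)_v,\qquad \mu_2=-\tfrac12(P_+)_v+\tfrac1{\sqrt2}(Q_+)_s-\tfrac12(\tilde P_-)_u,$$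 $$\alpha_1=\tfrac12(X_++X_-),\quad \alpha_2=\tfrac12(Y_++Y_-),\quad \beta_1=\tfrac12(Y_+-Y_-),\quad \beta_2=\tfrac12(X_+-X_-),$$ where $$X_+=\tfrac{\varepsilon'}2(e^{P_+}+\varepsilon e^{Q_+}),\qquad Y_+=\tfrac{\varepsilon'}2(e^{P_+}-\varepsilon e^{Q_+}),\qquad X_-=Y_-=\tfrac{\varepsilon''}2e^{\tilde P_-}.$$ **Theorem.** Let $M$ be a Lorentz surface and $F:M\to N$ a time-like conformal immersion with zero mean curvature vector. Then the following are equivalent: (a) $X_+^2\neq Y_+^2$ and $X_-=Y_-\neq0$ at every point, with respect to every local paracomplex coordinate $\check w$ and every $N_1,N_2$ as above; (b) every point of $M$ has a neighbourhood with a paracomplex coordinate $\check w$ and with $N_1,N_2$ as above for which the functions $\lambda,\alpha_k,\beta_k,\mu_k$ of $F$ are of explicit type. In addition, let $\lambda,\alpha_k,\beta_k,\mu_k$ be functions of explicit type on an open set $U$ of the $(u,v)$-plane. Then every point of $U$ has an open neighbourhood $V\subseteq U$ on which there is a time-like surface $f:V\to N$ with zero mean curvature vector, with paracomplex coordinate $u+jv$,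 and with $N_1,N_2$ as above, whose functions are $\lambda,\alpha_k,\beta_k,\mu_k$; it satisfies $X_+^2\neq Y_+^2$ and $X_-=Y_-\neq0$. It is unique up to an isometry of $N$: if two such surfaces $f,f'$ on a connected open set $V\subseteq U$ (each with respect to one of the orientations of $N$) have these same functions, then $f'=\Phi\circ f$ for an isometry $\Phi$ of $N$. -/

import Mathlib

open Set
open scoped ContDiff Manifold

noncomputable section

namespace NeutralSurface

/-! ### Coordinates `(u, v)` -/

/-- `∂/∂u`. -/
def du {E : Type*} [NormedAddCommGroup E] [NormedSpace ℝ E] (f : ℝ × ℝ → E) (x : ℝ × ℝ) : E :=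
  fderiv ℝ f x (1, 0)

/-- `∂/∂v`. -/
def dv {E : Type*} [NormedAddCommGroup E] [NormedSpace ℝ E] (f : ℝ × ℝ → E) (x : ℝ × ℝ) : E :=
  fderiv ℝ f x (0, 1)

/-- `∂/∂s` for the null coordinates `s = (u + v)/√2`, `t = (u - v)/√2`. -/
def ds (f : ℝ × ℝ → ℝ) (x : ℝ × ℝ) : ℝ := (du f x + dv f x) / √2

/-- `∂/∂t` for the null coordinates `s = (u + v)/√2`, `t = (u - v)/√2`. -/
def dt (f : ℝ × ℝ → ℝ) (x : ℝ × ℝ) : ℝ := (du f x - dv f x) / √2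

/-! ### Lorentz surfaces

A Lorentz surface is a surface with local paracomplex coordinates `u + jv`: the coordinate changes
`(u, v) ↦ (p, q)` are smooth, satisfy the para-Cauchy-Riemann equations `p_u = q_v`, `p_v = q_u`,
and satisfy `p_u ^ 2 - p_v ^ 2 > 0`, so that they preserve the conformal class of `du² - dv²`
and the orientation. -/

/-- The condition on a smooth map `(u, v) ↦ (p, q)` of open subsets of the plane to be
paraholomorphic and to pull back `dp² - dq²` to a positive multiple of `du² - dv²`. -/
def IsParaholomorphicOn (g : ℝ × ℝ → ℝ × ℝ) (V : Set (ℝ × ℝ)) : Prop :=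
  ContDiffOn ℝ ∞ g V ∧ ∀ x ∈ V,
    (du g x).1 = (dv g x).2 ∧ (dv g x).1 = (du g x).2 ∧ 0 < (du g x).1 ^ 2 - (dv g x).1 ^ 2

/-- Paraholomorphic maps as a pregroupoid. -/
def lorentzPregroupoid : Pregroupoid (ℝ × ℝ) where
  property := IsParaholomorphicOn
  comp := by
    intro f g U V hf hg hU hV hUV
    refine ⟨hg.1.comp (hf.1.mono inter_subset_left) (fun x hx => hx.2), ?_⟩
    rintro x ⟨hxU, hxV⟩
    have hdf : DifferentiableAt ℝ f x :=
      (hf.1.contDiffAt (hU.mem_nhds hxU)).differentiableAt (by simp)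
    have hdg : DifferentiableAt ℝ g (f x) :=
      (hg.1.contDiffAt (hV.mem_nhds hxV)).differentiableAt (by simp)
    obtain ⟨f1, f2, f3⟩ := hf.2 x hxU
    obtain ⟨g1, g2, g3⟩ := hg.2 (f x) hxV
    have key : ∀ w : ℝ × ℝ, fderiv ℝ (g ∘ f) x w
        = (fderiv ℝ f x w).1 • du g (f x) + (fderiv ℝ f x w).2 • dv g (f x) := by
      intro w
      rw [fderiv_comp x hdg hdf, ContinuousLinearMap.comp_apply]
      unfold du dv
      rw [← map_smul, ← map_smul, ← map_add]
      congr 1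
      ext <;> simp
    have k1 : du (g ∘ f) x = (du f x).1 • du g (f x) + (du f x).2 • dv g (f x) := key _
    have k2 : dv (g ∘ f) x = (dv f x).1 • du g (f x) + (dv f x).2 • dv g (f x) := key _
    rw [k1, k2]
    simp only [Prod.fst_add, Prod.snd_add, Prod.smul_fst, Prod.smul_snd, smul_eq_mul]
    refine ⟨?_, ?_, ?_⟩
    · rw [g1, g2, f1, f2]; ring
    · rw [g1, g2, f1, f2]; ring
    · have := mul_pos f3 g3
      rw [← f1, ← f2]
      nlinarith [this]
  id_mem := by
    refine ⟨contDiffOn_id, fun x _ => ?_⟩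
    simp [du, dv]
  locality := by
    intro f U _ h
    refine ⟨fun x hx => ?_, fun x hx => ?_⟩
    · obtain ⟨V, hV, hxV, h1⟩ := h x hx
      exact (contDiffWithinAt_inter (hV.mem_nhds hxV)).1 (h1.1 x ⟨hx, hxV⟩)
    · obtain ⟨V, _, hxV, h1⟩ := h x hx
      exact h1.2 x ⟨hx, hxV⟩
  congr := by
    intro f g U hU hfg hf
    refine ⟨hf.1.congr hfg, fun x hx => ?_⟩
    have : fderiv ℝ g x = fderiv ℝ f x :=
      Filter.EventuallyEq.fderiv_eq (Filter.eventually_of_mem (hU.mem_nhds hx) hfg)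
    simpa only [du, dv, this] using hf.2 x hx

/-- The groupoid of changes of paracomplex coordinates. A Lorentz surface is a charted space over
`ℝ × ℝ` with this structure groupoid; its local paracomplex coordinates are the charts in
`lorentzGroupoid.maximalAtlas M`. -/
def lorentzGroupoid : StructureGroupoid (ℝ × ℝ) := lorentzPregroupoid.groupoid

/-! ### The neutral space form of constant curvature `L₀`

All three models are placed in `ℝ⁵`. If `L₀ > 0` (`L₀ < 0`), the form below is that of `E⁵₂`
(of `E⁵₃`) and `N = {⟨x, x⟩ = 1/L₀}`. If `L₀ = 0`, then `N = {x₄ = 0}`, on which the form is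
that of `E⁴₂`. -/

/-- The scalar product `⟨x, y⟩` of the ambient space. -/
def form (L₀ : ℝ) (x y : Fin 5 → ℝ) : ℝ :=
  x 0 * y 0 + x 1 * y 1 - x 2 * y 2 - x 3 * y 3 + Real.sign L₀ * (x 4 * y 4)

/-- The 4-dimensional neutral space form `N` with constant sectional curvature `L₀`. -/
def spaceForm (L₀ : ℝ) : Set (Fin 5 → ℝ) :=
  {x | if L₀ = 0 then x 4 = 0 else form L₀ x x = 1 / L₀}

/-- `w` is tangent to `N` at the point `x` of `N`. The neutral metric `h` of `N` is the restriction
of `form L₀` to tangent vectors. -/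
def IsTangent (L₀ : ℝ) (x w : Fin 5 → ℝ) : Prop :=
  if L₀ = 0 then w 4 = 0 else form L₀ w x = 0

/-- The standard orientation of `N`: a frame `(a, b, c, d)` of the tangent space of `N` at `x` is
positive if this number is positive. -/
def orientationForm (L₀ : ℝ) (x a b c d : Fin 5 → ℝ) : ℝ :=
  Matrix.det (Matrix.of ![a, b, c, d, if L₀ = 0 then Pi.single 4 1 else x])

/-- `Φ` restricts to an isometry of `N`, that is, to a diffeomorphism of `N` onto itself that
preserves the metric. -/
def IsIsometry (L₀ : ℝ) (Φ : (Fin 5 → ℝ) → (Fin 5 → ℝ)) : Prop :=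
  ContDiff ℝ ∞ Φ ∧ MapsTo Φ (spaceForm L₀) (spaceForm L₀) ∧
  (∃ Ψ : (Fin 5 → ℝ) → (Fin 5 → ℝ), ContDiff ℝ ∞ Ψ ∧ MapsTo Ψ (spaceForm L₀) (spaceForm L₀) ∧
    LeftInvOn Ψ Φ (spaceForm L₀) ∧ RightInvOn Ψ Φ (spaceForm L₀)) ∧
  ∀ x ∈ spaceForm L₀, ∀ a b, IsTangent L₀ x a → IsTangent L₀ x b →
    form L₀ (fderiv ℝ Φ x a) (fderiv ℝ Φ x b) = form L₀ a b

/-! ### Surfaces in `N` in a paracomplex coordinate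

Here `f` is a surface in `N`, written in a coordinate `u + jv`; `T₁ = du f`, `T₂ = dv f`. -/

/-- Levi-Civita derivative `∇_{∂/∂u} W` in `N` of a vector field `W` along `f`: the component of the
derivative that is tangent to `N` (recall `⟨f, f⟩ = 1/L₀` if `L₀ ≠ 0`). -/
def nablaU (L₀ : ℝ) (f W : ℝ × ℝ → Fin 5 → ℝ) (x : ℝ × ℝ) : Fin 5 → ℝ :=
  du W x - (L₀ * form L₀ (du W x) (f x)) • f x

/-- Levi-Civita derivative `∇_{∂/∂v} W` in `N` of a vector field `W` along `f`. -/
def nablaV (L₀ : ℝ) (f W : ℝ × ℝ → Fin 5 → ℝ) (x : ℝ × ℝ) : Fin 5 → ℝ :=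
  dv W x - (L₀ * form L₀ (dv W x) (f x)) • f x

/-- The component of `w` orthogonal to the surface; `T₁`, `T₂` are orthogonal to each other. -/
def normalPart (L₀ : ℝ) (f : ℝ × ℝ → Fin 5 → ℝ) (x : ℝ × ℝ) (w : Fin 5 → ℝ) : Fin 5 → ℝ :=
  w - (form L₀ w (du f x) / form L₀ (du f x) (du f x)) • du f x
    - (form L₀ w (dv f x) / form L₀ (dv f x) (dv f x)) • dv f x

/-- Second fundamental form `σ(∂/∂u, ∂/∂u)`. -/
def sigmaUU (L₀ : ℝ) (f : ℝ × ℝ → Fin 5 → ℝ) (x : ℝ × ℝ) : Fin 5 → ℝ :=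
  normalPart L₀ f x (nablaU L₀ f (du f) x)

/-- Second fundamental form `σ(∂/∂u, ∂/∂v)`. -/
def sigmaUV (L₀ : ℝ) (f : ℝ × ℝ → Fin 5 → ℝ) (x : ℝ × ℝ) : Fin 5 → ℝ :=
  normalPart L₀ f x (nablaU L₀ f (dv f) x)

/-- Second fundamental form `σ(∂/∂v, ∂/∂v)`. -/
def sigmaVV (L₀ : ℝ) (f : ℝ × ℝ → Fin 5 → ℝ) (x : ℝ × ℝ) : Fin 5 → ℝ :=
  normalPart L₀ f x (nablaV L₀ f (dv f) x)

/-- The mean curvature vector: half the trace of `σ` with respect to the induced metric. -/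
def meanCurvature (L₀ : ℝ) (f : ℝ × ℝ → Fin 5 → ℝ) (x : ℝ × ℝ) : Fin 5 → ℝ :=
  (1 / 2 : ℝ) • ((form L₀ (du f x) (du f x))⁻¹ • sigmaUU L₀ f x
    + (form L₀ (dv f x) (dv f x))⁻¹ • sigmaVV L₀ f x)

/-- `f` is a time-like conformal immersion of the open set `V` of the `(u, v)`-plane into `N` with
zero mean curvature vector; the induced metric is a positive multiple of `du² - dv²`. -/
structure IsZMCOn (L₀ : ℝ) (V : Set (ℝ × ℝ)) (f : ℝ × ℝ → Fin 5 → ℝ) : Prop where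
  smooth : ContDiffOn ℝ ∞ f V
  mem : ∀ x ∈ V, f x ∈ spaceForm L₀
  pos : ∀ x ∈ V, 0 < form L₀ (du f x) (du f x)
  neg : ∀ x ∈ V, form L₀ (dv f x) (dv f x) = -form L₀ (du f x) (du f x)
  orth : ∀ x ∈ V, form L₀ (du f x) (dv f x) = 0
  zero_mean : ∀ x ∈ V, meanCurvature L₀ f x = 0

/-- `F` is a time-like conformal immersion of the Lorentz surface `M` into `N` with zero mean
curvature vector. -/
def IsZMCImmersion (L₀ : ℝ) {M : Type*} [TopologicalSpace M] [ChartedSpace (ℝ × ℝ) M]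
    (F : M → Fin 5 → ℝ) : Prop :=
  ∀ e ∈ lorentzGroupoid.maximalAtlas M, IsZMCOn L₀ e.target (F ∘ e.symm)

/-- `N₁`, `N₂` are normal vector fields of the surface with `h(N₁, N₁) = -h(N₂, N₂) = e^{2λ}` and
`h(N₁, N₂) = 0`, where `e^{2λ} = h(T₁, T₁)`, such that `(T₁, N₁, T₂, N₂)` gives the orientation of
`N`, which is the standard one (`o = 1`) or the opposite one (`o = -1`). -/
structure IsNormalFrame (L₀ : ℝ) (o : ℤˣ) (V : Set (ℝ × ℝ)) (f N₁ N₂ : ℝ × ℝ → Fin 5 → ℝ) :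
    Prop where
  smooth₁ : ContDiffOn ℝ ∞ N₁ V
  smooth₂ : ContDiffOn ℝ ∞ N₂ V
  tangent₁ : ∀ x ∈ V, IsTangent L₀ (f x) (N₁ x)
  tangent₂ : ∀ x ∈ V, IsTangent L₀ (f x) (N₂ x)
  normal₁ : ∀ x ∈ V, form L₀ (N₁ x) (du f x) = 0 ∧ form L₀ (N₁ x) (dv f x) = 0
  normal₂ : ∀ x ∈ V, form L₀ (N₂ x) (du f x) = 0 ∧ form L₀ (N₂ x) (dv f x) = 0
  norm₁ : ∀ x ∈ V, form L₀ (N₁ x) (N₁ x) = form L₀ (du f x) (du f x)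
  norm₂ : ∀ x ∈ V, form L₀ (N₂ x) (N₂ x) = -form L₀ (du f x) (du f x)
  orth : ∀ x ∈ V, form L₀ (N₁ x) (N₂ x) = 0
  oriented : ∀ x ∈ V,
    0 < ((o : ℤ) : ℝ) * orientationForm L₀ (f x) (du f x) (N₁ x) (dv f x) (N₂ x)

/-! ### The functions `λ`, `αₖ`, `βₖ`, `μₖ` -/

/-- Seven functions `λ`, `α₁`, `α₂`, `β₁`, `β₂`, `μ₁`, `μ₂` of `(u, v)`. -/
@[ext]
structure Data where
  lam : ℝ × ℝ → ℝ
  α₁ : ℝ × ℝ → ℝ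
  α₂ : ℝ × ℝ → ℝ
  β₁ : ℝ × ℝ → ℝ
  β₂ : ℝ × ℝ → ℝ
  μ₁ : ℝ × ℝ → ℝ
  μ₂ : ℝ × ℝ → ℝ

/-- The functions of a surface `f` with normal frame `(N₁, N₂)`: the induced metric is
`e^{2λ}(du² - dv²)`, and `αₖ`, `βₖ`, `μₖ` are the coefficients in
`σ(∂/∂u, ∂/∂u) = α₁ N₁ + β₁ N₂`, `σ(∂/∂u, ∂/∂v) = α₂ N₁ + β₂ N₂`,
`∇_{∂/∂u} N₁ = … + μ₁ N₂`, `∇_{∂/∂v} N₁ = … + μ₂ N₂`. -/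
def dataOf (L₀ : ℝ) (f N₁ N₂ : ℝ × ℝ → Fin 5 → ℝ) : Data where
  lam x := Real.log (form L₀ (du f x) (du f x)) / 2
  α₁ x := form L₀ (sigmaUU L₀ f x) (N₁ x) / form L₀ (N₁ x) (N₁ x)
  α₂ x := form L₀ (sigmaUV L₀ f x) (N₁ x) / form L₀ (N₁ x) (N₁ x)
  β₁ x := form L₀ (sigmaUU L₀ f x) (N₂ x) / form L₀ (N₂ x) (N₂ x)
  β₂ x := form L₀ (sigmaUV L₀ f x) (N₂ x) / form L₀ (N₂ x) (N₂ x)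
  μ₁ x := form L₀ (nablaU L₀ f N₁ x) (N₂ x) / form L₀ (N₂ x) (N₂ x)
  μ₂ x := form L₀ (nablaV L₀ f N₁ x) (N₂ x) / form L₀ (N₂ x) (N₂ x)

namespace Data

/-- Equality of the seven functions on `V`. -/
def AgreeOn (V : Set (ℝ × ℝ)) (D D' : Data) : Prop :=
  ∀ x ∈ V, D.lam x = D'.lam x ∧ D.α₁ x = D'.α₁ x ∧ D.α₂ x = D'.α₂ x ∧ D.β₁ x = D'.β₁ x ∧
    D.β₂ x = D'.β₂ x ∧ D.μ₁ x = D'.μ₁ x ∧ D.μ₂ x = D'.μ₂ x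

/-- `X₊ = α₁ + β₂`. -/
def Xp (D : Data) (x : ℝ × ℝ) : ℝ := D.α₁ x + D.β₂ x

/-- `X₋ = α₁ - β₂`. -/
def Xm (D : Data) (x : ℝ × ℝ) : ℝ := D.α₁ x - D.β₂ x

/-- `Y₊ = α₂ + β₁`. -/
def Yp (D : Data) (x : ℝ × ℝ) : ℝ := D.α₂ x + D.β₁ x

/-- `Y₋ = α₂ - β₁`. -/
def Ym (D : Data) (x : ℝ × ℝ) : ℝ := D.α₂ x - D.β₁ x

/-- `X₊² ≠ Y₊²` and `X₋ = Y₋ ≠ 0` at each point of `V`. -/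
def IsNullTypeOn (D : Data) (V : Set (ℝ × ℝ)) : Prop :=
  ∀ x ∈ V, D.Xp x ^ 2 ≠ D.Yp x ^ 2 ∧ D.Xm x = D.Ym x ∧ D.Xm x ≠ 0

end Data

/-- The explicit functions made of `P = P₊`, `Q = Q₊`, `R = P̃₋` and the signs `ε`, `ε'`, `ε''`.
The functions `αₖ`, `βₖ` are those with
`X₊ = (ε'/2)(e^P + ε e^Q)`, `Y₊ = (ε'/2)(e^P - ε e^Q)`, `X₋ = Y₋ = (ε''/2) e^R`. -/
def explicitData (ε ε' ε'' : ℤˣ) (P Q R : ℝ × ℝ → ℝ) : Data :=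
  let Xp : ℝ × ℝ → ℝ := fun x =>
    ((ε' : ℤ) : ℝ) / 2 * (Real.exp (P x) + ((ε : ℤ) : ℝ) * Real.exp (Q x))
  let Yp : ℝ × ℝ → ℝ := fun x =>
    ((ε' : ℤ) : ℝ) / 2 * (Real.exp (P x) - ((ε : ℤ) : ℝ) * Real.exp (Q x))
  let Xm : ℝ × ℝ → ℝ := fun x => ((ε'' : ℤ) : ℝ) / 2 * Real.exp (R x)
  let Ym : ℝ × ℝ → ℝ := Xm
  { lam := fun x => -(1 / 2) * (P x + R x)
    α₁ := fun x => (Xp x + Xm x) / 2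
    α₂ := fun x => (Yp x + Ym x) / 2
    β₁ := fun x => (Yp x - Ym x) / 2
    β₂ := fun x => (Xp x - Xm x) / 2
    μ₁ := fun x => -(1 / 2) * du P x + 1 / √2 * ds Q x - 1 / 2 * dv R x
    μ₂ := fun x => -(1 / 2) * dv P x + 1 / √2 * ds Q x - 1 / 2 * du R x }

/-- On the open set `V`, the functions `D` are given by the explicit formulas: there are signs
`ε`, `ε'`, `ε''`, a solution `(f₁, f₂)` of the semilinear hyperbolic system
`(f₁)_{st} = L₀ e^{-f₁-f₂}`, `(f₂)_{st} = -(ε/2) e^{f₁+2f₂}`, and functions `P`, `Q`, `R` with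
`f₁ = P - Q + 2R`, `f₂ = Q - R`, such that `D` is `explicitData ε ε' ε'' P Q R`. -/
def IsExplicitOn (L₀ : ℝ) (V : Set (ℝ × ℝ)) (D : Data) : Prop :=
  ∃ (ε ε' ε'' : ℤˣ) (f₁ f₂ P Q R : ℝ × ℝ → ℝ),
    ContDiffOn ℝ ∞ f₁ V ∧ ContDiffOn ℝ ∞ f₂ V ∧
    (∀ x ∈ V, ds (dt f₁) x = L₀ * Real.exp (-f₁ x - f₂ x)) ∧
    (∀ x ∈ V, ds (dt f₂) x = -(((ε : ℤ) : ℝ) / 2) * Real.exp (f₁ x + 2 * f₂ x)) ∧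
    ContDiffOn ℝ ∞ P V ∧ ContDiffOn ℝ ∞ Q V ∧ ContDiffOn ℝ ∞ R V ∧
    (∀ x ∈ V, f₁ x = P x - Q x + 2 * R x) ∧
    (∀ x ∈ V, f₂ x = Q x - R x) ∧
    D.AgreeOn V (explicitData ε ε' ε'' P Q R)

/-- `F` satisfies `X₊² ≠ Y₊²` and `X₋ = Y₋ ≠ 0` everywhere, with respect to all local paracomplex
coordinates and all normal frames compatible with the orientation `o` of `N`. -/
def IsNullType (L₀ : ℝ) (o : ℤˣ) {M : Type*} [TopologicalSpace M] [ChartedSpace (ℝ × ℝ) M]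
    (F : M → Fin 5 → ℝ) : Prop :=
  ∀ e ∈ lorentzGroupoid.maximalAtlas M, ∀ N₁ N₂ : ℝ × ℝ → Fin 5 → ℝ,
    IsNormalFrame L₀ o e.target (F ∘ e.symm) N₁ N₂ →
    (dataOf L₀ (F ∘ e.symm) N₁ N₂).IsNullTypeOn e.target

/-- Around each point of `M` there are a local paracomplex coordinate and a normal frame compatible
with the orientation `o` of `N` for which `λ`, `αₖ`, `βₖ`, `μₖ` are given by the explicit
formulas. -/
def IsLocallyExplicit (L₀ : ℝ) (o : ℤˣ) {M : Type*} [TopologicalSpace M]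
    [ChartedSpace (ℝ × ℝ) M] (F : M → Fin 5 → ℝ) : Prop :=
  ∀ p : M, ∃ e ∈ lorentzGroupoid.maximalAtlas M, p ∈ e.source ∧
    ∃ N₁ N₂ : ℝ × ℝ → Fin 5 → ℝ, IsNormalFrame L₀ o e.target (F ∘ e.symm) N₁ N₂ ∧
      IsExplicitOn L₀ e.target (dataOf L₀ (F ∘ e.symm) N₁ N₂)

/-- `f` is a time-like surface in `N`, defined on the open set `V` of the `(u, v)`-plane, with zero
mean curvature vector, and `(N₁, N₂)` is a normal frame of it compatible with the orientation `o`
such that its functions `λ`, `αₖ`, `βₖ`, `μₖ` are `D`. -/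
def Realizes (L₀ : ℝ) (o : ℤˣ) (V : Set (ℝ × ℝ)) (D : Data)
    (f N₁ N₂ : ℝ × ℝ → Fin 5 → ℝ) : Prop :=
  IsZMCOn L₀ V f ∧ IsNormalFrame L₀ o V f N₁ N₂ ∧ (dataOf L₀ f N₁ N₂).AgreeOn V D

end NeutralSurface

end

/-!
A surface is studied through its null frame `W = (T₁ + T₂, T₁ - T₂, N₁ + N₂, N₁ - N₂, ξ)`, where
`ξ` is the normal vector of the space form in `ℝ⁵`. In the null directions `∂± = ∂/∂u ± ∂/∂v` the
Gauss and Weingarten equations become `∂₊W = M₊W`, `∂₋W = M₋W` (`IsZMCOn.isNullFrame`), with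
matrices whose entries are made of `λ`, `μ₁ ± μ₂` and the four combinations
`A = X₊ + Y₊`, `B = X₋ + Y₋`, `C = X₊ - Y₊`, `D = X₋ - Y₋`. The condition of the theorem is
`A, C, B ≠ 0`, `D = 0`. If `D = 0`, then the integrability condition of the linear system amounts to
five scalar equations (`Data.GCR`): the Codazzi equations give the logarithmic derivatives
`∂₋A`, `∂₋B`, `∂₊C` in terms of `λ` and `μₖ`, and the Gauss and Ricci equations give `∂₋∂₊λ` and the
curvature of the normal connection in terms of `AC` and `L₀ e^{2λ}`.

*Explicit data.* With `|A| = e^P`, `|B| = e^R`, `|C| = e^Q` and `e^{2λ}|AB| = 1`, the Codazzi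
equations are the formulas for `μ₁`, `μ₂`, and the Gauss and Ricci equations are the semilinear
hyperbolic system for `f₁ = P - Q + 2R`, `f₂ = Q - R` (`explicitData_gcr`,
`Data.GCR.isExplicitOn`).

*Existence.* The linear system is flat, so it has local solutions with any initial frame, by the
Frobenius theorem (`exists_solution_of_flat`), which is proved by solving linear ordinary
differential equations along rays. The scalar products of a solution are determined by their initial
values, and hence the last row of `W` is a surface with the given data (`Data.GCR.exists_realizes`).

*Uniqueness.* For two null frames `W`, `W'` with the same data, with Gram matrix `G`, the matrix
`Wᵀ G⁻¹ W'` is constant (`dual_const`). It yields a linear isometry that takes `W` to `W'`, and so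
takes one surface to the other, up to a translation if `L₀ = 0` (`Realizes.exists_isometry`).

*Equivalence.* Under a change of the coordinate and of the normal frame, each of `A`, `B`, `C`, `D`
is multiplied by a nonzero factor (`IsZMCOn.change`); it is essential here that the orientation
prevents the two null normal directions from being exchanged. As explicit data satisfy `D = 0` and
`A, B, C ≠ 0`, (b) implies (a). Conversely, the Codazzi equations show that `q = e^{2λ}AB`
satisfies `∂₋q = 0`; under a coordinate change with factors `k`, `l` in the null directions, `q`
is divided by `k⁴`, so a coordinate change with `k = |q|^{1/4}`, `l = 1` normalises `e^{2λ}|AB|` to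
`1` (`exists_coordinate_change`).
-/

open Set
open scoped ContDiff Manifold

noncomputable section

namespace NeutralSurface

/-! ### The Frobenius theorem for linear total differential equations -/

section Frobenius

variable {E F : Type*} [NormedAddCommGroup E] [NormedSpace ℝ E] [NormedAddCommGroup F]
  [NormedSpace ℝ F]

/-- A `C²` map is, near a point, bounded and Lipschitz, and its first order Taylor remainder is
quadratic. -/
theorem exists_taylor_bounds {G : Type*} [NormedAddCommGroup G] [NormedSpace ℝ G] {Ω : E → G}
    {p : E} (h : ContDiffAt ℝ 2 Ω p) :
    ∃ M r : ℝ, 0 ≤ M ∧ 0 < r ∧ ∀ x ∈ Metric.ball p r, ‖Ω x‖ ≤ M ∧ DifferentiableAt ℝ Ω x ∧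
      ∀ z ∈ Metric.ball p r, ‖Ω z - Ω x‖ ≤ M * ‖z - x‖ ∧
        ‖Ω z - Ω x - fderiv ℝ Ω x (z - x)‖ ≤ M * ‖z - x‖ ^ 2 := by
  obtain ⟨K₁, t₁, ht₁, h₁⟩ := (h.of_le one_le_two).exists_lipschitzOnWith
  obtain ⟨K₂, t₂, ht₂, h₂⟩ :=
    (h.fderiv_right (m := 1) (by norm_num)).exists_lipschitzOnWith
  have hd : ∀ᶠ x in nhds p, DifferentiableAt ℝ Ω x := by
    filter_upwards [h.eventually (by simp)] with x hx using hx.differentiableAt (by simp)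
  have hb : ∀ᶠ x in nhds p, ‖Ω x‖ < ‖Ω p‖ + 1 :=
    h.continuousAt.norm.eventually_lt continuousAt_const (by simp)
  obtain ⟨r, hr, hball⟩ := Metric.mem_nhds_iff.1
    (Filter.inter_mem (Filter.inter_mem ht₁ ht₂) (Filter.inter_mem hd hb))
  refine ⟨max (max K₁ K₂) (‖Ω p‖ + 1), r, by positivity, hr, fun x hx => ?_⟩
  obtain ⟨⟨hx1, hx2⟩, hx3, hx4⟩ := hball hx
  refine ⟨(le_of_lt hx4).trans (le_max_right _ _), hx3, fun z hz => ⟨?_, ?_⟩⟩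
  · refine (h₁.norm_sub_le (hball hz).1.1 hx1).trans ?_
    gcongr
    exact (le_max_left _ _).trans (le_max_left _ _)
  · have key := (convex_segment x z).norm_image_sub_le_of_norm_hasFDerivWithin_le'
      (f := Ω) (f' := fderiv ℝ Ω) (φ := fderiv ℝ Ω x) (C := K₂ * ‖z - x‖) (x := x) (y := z)
      (fun y hy => ?_) (fun y hy => ?_) (left_mem_segment _ _ _) (right_mem_segment _ _ _)
    · refine key.trans ?_
      rw [mul_assoc, ← sq]
      gcongr
      exact (le_max_right _ _).trans (le_max_left _ _)
    · have : y ∈ Metric.ball p r := (convex_ball p r).segment_subset hx hz hy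
      exact (hball this).2.1.hasFDerivAt.hasFDerivWithinAt
    · have hy' : y ∈ Metric.ball p r := (convex_ball p r).segment_subset hx hz hy
      refine (h₂.norm_sub_le (hball hy').1.2 hx2).trans ?_
      gcongr
      exact norm_sub_le_of_mem_segment hy

/-- The line through `p` in direction `a` transports solutions of the linear equation
`y' = Ω(p + τ a)(a) y` from time `0` to time `1`, if `Ω(p + τ a)(a)` is small. -/
theorem exists_radial_solution [CompleteSpace F] {Ω : E → E →L[ℝ] F →L[ℝ] F} {p a : E}
    (hc : ∀ τ ∈ Icc (0 : ℝ) 1, ContinuousAt Ω (p + τ • a))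
    (hb : ∀ τ ∈ Icc (0 : ℝ) 1, ‖Ω (p + τ • a) a‖ ≤ 1 / 2) (w₀ : F) :
    ∃ y : ℝ → F, y 0 = w₀ ∧ ∀ τ ∈ Icc (0 : ℝ) 1,
      HasDerivWithinAt y (Ω (p + τ • a) a (y τ)) (Icc 0 1) τ := by
  have hPL : IsPicardLindelof (fun τ y => Ω (p + τ • a) a y)
      (⟨0, by simp⟩ : Icc (0 : ℝ) 1) w₀ (‖w₀‖₊ + 1) 0 (‖w₀‖₊ + 1) (1 / 2) := by
    refine ⟨fun τ hτ => ?_, fun y _ => ?_, fun τ hτ y hy => ?_, by simp⟩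
    · refine ((Ω (p + τ • a) a).lipschitz.weaken ?_).lipschitzOnWith
      exact_mod_cast hb τ hτ
    · intro τ hτ
      have : ContinuousAt (fun τ : ℝ => Ω (p + τ • a)) τ :=
        ContinuousAt.comp (f := fun τ : ℝ => p + τ • a) (hc τ hτ) (by fun_prop)
      exact ((this.clm_apply continuousAt_const).clm_apply continuousAt_const).continuousWithinAt
    · have h1 : ‖y‖ ≤ ‖w₀‖ + (‖w₀‖ + 1) := by
        have : ‖y - w₀‖ ≤ ‖w₀‖ + 1 := by simpa [dist_eq_norm] using hy
        calc ‖y‖ = ‖w₀ + (y - w₀)‖ := by congr 1; abel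
          _ ≤ _ := (norm_add_le _ _).trans (by gcongr)
      have h2 := (Ω (p + τ • a) a).le_of_opNorm_le (hb τ hτ) y
      simp only [NNReal.coe_add, coe_nnnorm, NNReal.coe_one]
      linarith
  exact hPL.exists_eq_forall_mem_Icc_hasDerivWithinAt₀

/-- **Frobenius theorem** for the linear total differential equation `dw = Ω w`: if the connection
form `Ω` is flat, there are local solutions with any initial value. The solution at `x` is obtained
by solving a linear ordinary differential equation along the segment from `p` to `x`. -/
theorem exists_solution_of_flat [CompleteSpace F] {Ω : E → E →L[ℝ] F →L[ℝ] F} {U : Set E}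
    (hU : IsOpen U) (hΩ : ContDiffOn ℝ 2 Ω U)
    (flat : ∀ x ∈ U, ∀ a b, fderiv ℝ Ω x a b + (Ω x b).comp (Ω x a)
      = fderiv ℝ Ω x b a + (Ω x a).comp (Ω x b)) {p : E} (hp : p ∈ U) :
    ∃ δ : ℝ, 0 < δ ∧ Metric.ball p δ ⊆ U ∧ ∀ w₀ : F, ∃ w : E → F, w p = w₀ ∧
      ∀ x ∈ Metric.ball p δ, HasFDerivAt w ((Ω x).flip (w x)) x := by
  obtain ⟨M, r, hM, hr, hbd⟩ := exists_taylor_bounds (hΩ.contDiffAt (hU.mem_nhds hp))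
  obtain ⟨r', hr', hrU⟩ := Metric.isOpen_iff.1 hU p hp
  set δ : ℝ := min (min r r') (min 1 (1 / (2 * (M + 1)))) with hδ
  have hδ0 : 0 < δ := by positivity
  have hδr : δ ≤ r := (min_le_left _ _).trans (min_le_left _ _)
  have hδr' : δ ≤ r' := (min_le_left _ _).trans (min_le_right _ _)
  have hδ1 : δ ≤ 1 := (min_le_right _ _).trans (min_le_left _ _)
  have hδM : M * δ ≤ 1 / 2 := by
    have h1 : δ ≤ 1 / (2 * (M + 1)) := (min_le_right _ _).trans (min_le_right _ _)
    have h2 : M * δ ≤ (M + 1) * (1 / (2 * (M + 1))) := by gcongr; linarith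
    have h3 : (M + 1) * (1 / (2 * (M + 1))) = 1 / 2 := by field_simp
    linarith
  refine ⟨δ, hδ0, (Metric.ball_subset_ball hδr').trans hrU, fun w₀ => ?_⟩
  have hline : ∀ x ∈ Metric.ball p δ, ∀ τ ∈ Icc (0 : ℝ) 1, p + τ • (x - p) ∈ Metric.ball p δ := by
    intro x hx τ hτ
    have hx' : ‖x - p‖ < δ := by simpa [dist_eq_norm] using hx
    simp only [Metric.mem_ball, dist_eq_norm, add_sub_cancel_left, norm_smul, Real.norm_eq_abs,
      abs_of_nonneg hτ.1]
    calc τ * ‖x - p‖ ≤ 1 * ‖x - p‖ := by gcongr; exact hτ.2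
      _ < δ := by rwa [one_mul]
  have hliner : ∀ x ∈ Metric.ball p δ, ∀ τ ∈ Icc (0 : ℝ) 1, p + τ • (x - p) ∈ Metric.ball p r :=
    fun x hx τ hτ => Metric.ball_subset_ball hδr (hline x hx τ hτ)
  have hsol : ∀ x : E, ∃ y : ℝ → F, x ∈ Metric.ball p δ → y 0 = w₀ ∧ ∀ τ ∈ Icc (0 : ℝ) 1,
      HasDerivWithinAt y (Ω (p + τ • (x - p)) (x - p) (y τ)) (Icc 0 1) τ := by
    intro x
    by_cases hx : x ∈ Metric.ball p δ
    · have hx' : ‖x - p‖ < δ := by simpa [dist_eq_norm] using hx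
      have hsmall : ∀ τ ∈ Icc (0 : ℝ) 1, ‖Ω (p + τ • (x - p)) (x - p)‖ ≤ 1 / 2 := fun τ hτ =>
        ((Ω _).le_of_opNorm_le (hbd _ (hliner x hx τ hτ)).1 _).trans
          ((mul_le_mul_of_nonneg_left hx'.le hM).trans hδM)
      obtain ⟨y, hy⟩ := exists_radial_solution
        (fun τ hτ => (hbd _ (hliner x hx τ hτ)).2.1.continuousAt) hsmall w₀
      exact ⟨y, fun _ => hy⟩
    · exact ⟨0, fun h => absurd h hx⟩
  choose y hy using hsol
  refine ⟨fun x => y x 1, ?_, fun x hx => ?_⟩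
  · have hpp := hy p (Metric.mem_ball_self hδ0)
    have hconst := constant_of_has_deriv_right_zero (f := y p) (a := 0) (b := 1)
      (fun τ hτ => (hpp.2 τ hτ).continuousWithinAt) (fun τ hτ => by
        have := hpp.2 τ ⟨hτ.1, hτ.2.le⟩
        simp only [sub_self, map_zero, zero_apply] at this
        exact (this.mono_of_mem_nhdsWithin (Icc_mem_nhdsGE_of_mem hτ)))
    exact (hconst 1 (by simp)).trans hpp.1
  -- bound the deviation from the linear prediction along the segment by Grönwall's inequality
  have hx' : ‖x - p‖ < δ := by simpa [dist_eq_norm] using hx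
  obtain ⟨Y, hY⟩ : ∃ Y, ∀ τ ∈ Icc (0 : ℝ) 1, ‖y x τ‖ ≤ Y :=
    isCompact_Icc.exists_bound_of_continuousOn fun τ hτ => ((hy x hx).2 τ hτ).continuousWithinAt
  have hY0 : 0 ≤ Y := (norm_nonneg _).trans (hY 0 (by simp))
  have key : ∀ z ∈ Metric.ball p δ, ‖y z 1 - y x 1 - Ω x (z - x) (y x 1)‖
      ≤ (2 * M + 2 * M * M) * Y * (Real.exp 1 - 1) * ‖z - x‖ ^ 2 := by
    intro z hz
    have hz' : ‖z - p‖ < δ := by simpa [dist_eq_norm] using hz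
    set h := z - x with hh
    set a := x - p with ha
    have hza : z - p = a + h := by rw [hh, ha]; abel
    have hΔ : ∀ τ ∈ Icc (0 : ℝ) 1, HasDerivWithinAt
        (fun τ => y z τ - y x τ - τ • Ω (p + τ • a) h (y x τ))
        (Ω (p + τ • (z - p)) (z - p) (y z τ) - Ω (p + τ • a) a (y x τ)
          - (τ • (fderiv ℝ Ω (p + τ • a) a h (y x τ) + Ω (p + τ • a) h (Ω (p + τ • a) a (y x τ)))
            + Ω (p + τ • a) h (y x τ))) (Icc 0 1) τ := by
      intro τ hτ
      have hc : HasDerivWithinAt (fun τ : ℝ => Ω (p + τ • a)) (fderiv ℝ Ω (p + τ • a) a)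
          (Icc 0 1) τ := by
        have h1 : HasDerivAt (fun τ : ℝ => p + τ • a) a τ := by
          simpa using ((hasDerivAt_id τ).smul_const a).const_add p
        exact ((hbd _ (hliner x hx τ hτ)).2.1.hasFDerivAt.comp_hasDerivAt τ h1).hasDerivWithinAt
      have h2 := (hc.clm_apply (hasDerivWithinAt_const τ (Icc 0 1) h)).clm_apply ((hy x hx).2 τ hτ)
      have h3 := (hasDerivWithinAt_id τ (Icc (0:ℝ) 1)).smul h2
      refine ((((hy z hz).2 τ hτ).sub ((hy x hx).2 τ hτ)).sub h3).congr_deriv ?_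
      simp only [← ha, map_zero, add_zero, id_eq, one_smul]
    have hg := norm_le_gronwallBound_of_norm_deriv_right_le
      (f := fun τ => y z τ - y x τ - τ • Ω (p + τ • a) h (y x τ)) (a := 0) (b := 1)
      (δ := 0) (K := 1) (ε := (2 * M + 2 * M * M) * Y * ‖h‖ ^ 2)
      (fun τ hτ => (hΔ τ hτ).continuousWithinAt)
      (fun τ hτ => (hΔ τ ⟨hτ.1, hτ.2.le⟩).mono_of_mem_nhdsWithin (Icc_mem_nhdsGE_of_mem hτ))
      (by simp [(hy x hx).1, (hy z hz).1]) (fun τ hτ => ?_) 1 (by simp)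
    · rw [gronwallBound_of_K_ne_0 one_ne_zero] at hg
      have e1 : p + a = x := by rw [ha]; abel
      simp only [one_smul, e1] at hg
      refine hg.trans (le_of_eq ?_)
      simp only [sub_zero, one_mul, zero_mul, div_one]
      ring
    · have hτ' : τ ∈ Icc (0 : ℝ) 1 := ⟨hτ.1, hτ.2.le⟩
      set g := p + τ • a with hgdef
      set g' := p + τ • (z - p) with hg'
      set Y₀ := y x τ with hY₀
      have hgU : g ∈ U := hrU (Metric.ball_subset_ball hδr' (hline x hx τ hτ'))
      have hgg : g' - g = τ • h := by rw [hg', hgdef, hza]; module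
      have fl := congrArg (fun T : F →L[ℝ] F => T Y₀) (flat g hgU a h)
      simp only [add_apply, ContinuousLinearMap.comp_apply] at fl
      have hbg := hbd g (hliner x hx τ hτ')
      have hbg' := hbd g' (hliner z hz τ hτ')
      obtain ⟨b1, b2⟩ := hbg.2.2 g' (hliner z hz τ hτ')
      have hτh : ‖g' - g‖ ≤ ‖h‖ := by
        rw [hgg, norm_smul, Real.norm_of_nonneg hτ.1]
        exact mul_le_of_le_one_left (norm_nonneg _) hτ'.2
      have split : Ω g' (z - p) (y z τ) - Ω g a Y₀
          - (τ • (fderiv ℝ Ω g a h Y₀ + Ω g h (Ω g a Y₀)) + Ω g h Y₀)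
          = Ω g' (z - p) (y z τ - Y₀ - τ • Ω g h Y₀)
            + ((Ω g' - Ω g - fderiv ℝ Ω g (g' - g)) a Y₀ + (Ω g' - Ω g) h Y₀)
            + τ • ((Ω g' - Ω g) a (Ω g h Y₀) + Ω g' h (Ω g h Y₀)) := by
        rw [fl, hgg, hza]
        simp only [map_add, map_sub, map_smul, add_apply,
          sub_apply, smul_apply]
        module
      rw [split]
      have n1 : ‖Ω g' (z - p) (y z τ - Y₀ - τ • Ω g h Y₀)‖ ≤ 1 * ‖y z τ - Y₀ - τ • Ω g h Y₀‖ := by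
        refine (Ω g' (z - p)).le_of_opNorm_le ?_ _
        refine ((Ω g').le_of_opNorm_le hbg'.1 _).trans ?_
        exact (mul_le_mul_of_nonneg_left hz'.le hM).trans (hδM.trans (by norm_num))
      have ha1 : ‖a‖ ≤ 1 := hx'.le.trans hδ1
      have bnd : ∀ (T : E →L[ℝ] F →L[ℝ] F) (c v : ℝ) (e : E) (ζ : F), ‖T‖ ≤ c → ‖e‖ ≤ v → 0 ≤ c →
          ‖T e ζ‖ ≤ c * v * ‖ζ‖ := by
        intro T c v e ζ hT he hc
        refine (T e).le_of_opNorm_le ?_ ζ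
        exact (T.le_of_opNorm_le hT e).trans (by gcongr)
      have hYτ : ‖Y₀‖ ≤ Y := hY τ hτ'
      have c1 : ‖Ω g' - Ω g‖ ≤ M * ‖h‖ := b1.trans (by gcongr)
      have c2 : ‖Ω g' - Ω g - fderiv ℝ Ω g (g' - g)‖ ≤ M * ‖h‖ ^ 2 := b2.trans (by gcongr)
      have n2 := bnd _ _ 1 a Y₀ c2 ha1 (by positivity)
      have n3 := bnd _ _ ‖h‖ h Y₀ c1 le_rfl (by positivity)
      have n4 : ‖Ω g h Y₀‖ ≤ M * ‖h‖ * Y :=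
        (bnd _ _ ‖h‖ h Y₀ hbg.1 le_rfl hM).trans (by gcongr)
      have n5 := bnd _ _ 1 a (Ω g h Y₀) c1 ha1 (by positivity)
      have n6 := bnd _ _ ‖h‖ h (Ω g h Y₀) hbg'.1 le_rfl hM
      have n7 : ‖τ • ((Ω g' - Ω g) a (Ω g h Y₀) + Ω g' h (Ω g h Y₀))‖
          ≤ ‖(Ω g' - Ω g) a (Ω g h Y₀)‖ + ‖Ω g' h (Ω g h Y₀)‖ := by
        rw [norm_smul, Real.norm_of_nonneg hτ.1]
        exact (mul_le_of_le_one_left (norm_nonneg _) hτ'.2).trans (norm_add_le _ _)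
      refine (norm_add₃_le).trans ?_
      have n8 : ‖(Ω g' - Ω g - fderiv ℝ Ω g (g' - g)) a Y₀ + (Ω g' - Ω g) h Y₀‖
          ≤ M * ‖h‖ ^ 2 * Y + M * ‖h‖ * ‖h‖ * Y := by
        refine (norm_add_le _ _).trans (add_le_add (n2.trans ?_) (n3.trans ?_))
        · rw [mul_one]; gcongr
        · gcongr
      have n9 : ‖(Ω g' - Ω g) a (Ω g h Y₀)‖ + ‖Ω g' h (Ω g h Y₀)‖
          ≤ M * ‖h‖ * 1 * (M * ‖h‖ * Y) + M * ‖h‖ * (M * ‖h‖ * Y) := by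
        refine add_le_add (n5.trans ?_) (n6.trans ?_) <;> gcongr
      calc _ ≤ 1 * ‖y z τ - Y₀ - τ • Ω g h Y₀‖ + (M * ‖h‖ ^ 2 * Y + M * ‖h‖ * ‖h‖ * Y)
            + (M * ‖h‖ * 1 * (M * ‖h‖ * Y) + M * ‖h‖ * (M * ‖h‖ * Y)) :=
            add_le_add (add_le_add n1 n8) (n7.trans n9)
        _ = _ := by ring
  refine HasFDerivAt.of_isLittleO ?_
  refine Asymptotics.IsBigO.trans_isLittleO (g := fun z => ‖z - x‖ ^ 2) ?_ ?_
  · refine Asymptotics.IsBigO.of_bound ((2 * M + 2 * M * M) * Y * (Real.exp 1 - 1)) ?_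
    filter_upwards [Metric.isOpen_ball.mem_nhds hx] with z hz
    simpa using key z hz
  · have h1 : (fun z : E => ‖z - x‖ ^ 2) =o[nhds x] fun z => ‖z - x‖ ^ 1 := by
      have := (Asymptotics.isLittleO_pow_pow (𝕜 := ℝ) one_lt_two).comp_tendsto
        (k := fun z : E => ‖z - x‖) (l' := nhds x) ?_
      · exact this
      · have : ContinuousAt (fun z : E => ‖z - x‖) x := by fun_prop
        simpa [ContinuousAt] using this
    simpa using! h1

/-- Solutions of a smooth total differential equation `dw = Ω w` are smooth. -/
theorem contDiffOn_of_solution {Ω : E → E →L[ℝ] F →L[ℝ] F} {V : Set E} (hV : IsOpen V)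
    (hΩ : ContDiffOn ℝ ∞ Ω V) {w : E → F}
    (hw : ∀ x ∈ V, HasFDerivAt w ((Ω x).flip (w x)) x) : ContDiffOn ℝ ∞ w V := by
  have hflip : IsBoundedLinearMap ℝ (fun T : E →L[ℝ] F →L[ℝ] F => T.flip) :=
    IsLinearMap.with_bound ⟨fun _ _ => rfl, fun _ _ => rfl⟩ 1 fun T => by
      rw [ContinuousLinearMap.opNorm_flip, one_mul]
  rw [contDiffOn_infty]
  intro n
  induction n with
  | zero =>
    exact contDiffOn_zero.2 fun x hx => (hw x hx).continuousAt.continuousWithinAt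
  | succ n ih =>
    have : ((n + 1 : ℕ) : WithTop ℕ∞) = (n : WithTop ℕ∞) + 1 := by push_cast; rfl
    rw [this, contDiffOn_succ_iff_fderiv_of_isOpen hV]
    refine ⟨fun x hx => (hw x hx).differentiableAt.differentiableWithinAt, by simp, ?_⟩
    have h1 : ContDiffOn ℝ n (fun x => (Ω x).flip (w x)) V := by
      have h0 : ContDiff ℝ n (fun T : E →L[ℝ] F →L[ℝ] F => T.flip) := by
        apply IsBoundedLinearMap.contDiff
        exact hflip
      have h2 : ContDiffOn ℝ n (fun x => (Ω x).flip) V :=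
        h0.comp_contDiffOn (contDiffOn_infty.1 hΩ n)
      exact h2.clm_apply ih
    exact h1.congr fun x hx => (hw x hx).fderiv

end Frobenius

/-! ### Directional derivatives of smooth maps -/

section Calculus

variable {E : Type*} [NormedAddCommGroup E] [NormedSpace ℝ E]

/-- Derivative of `f` in the constant direction `w` of the `(u, v)`-plane. -/
def dd (w : ℝ × ℝ) (f : ℝ × ℝ → E) (x : ℝ × ℝ) : E := fderiv ℝ f x w

/-- The null direction `∂/∂u + ∂/∂v`. -/
abbrev wp : ℝ × ℝ := (1, 1)

/-- The null direction `∂/∂u - ∂/∂v`. -/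
abbrev wm : ℝ × ℝ := (1, -1)

theorem dd_wp (f : ℝ × ℝ → E) (x : ℝ × ℝ) : dd wp f x = du f x + dv f x := by
  simp only [dd, du, dv, ← map_add]; simp

theorem dd_wm (f : ℝ × ℝ → E) (x : ℝ × ℝ) : dd wm f x = du f x - dv f x := by
  simp only [dd, du, dv, ← map_sub]; simp

theorem du_eq_dd (f : ℝ × ℝ → E) : du f = dd (1, 0) f := rfl

theorem dv_eq_dd (f : ℝ × ℝ → E) : dv f = dd (0, 1) f := rfl

theorem fderiv_apply_eq_dd (f : ℝ × ℝ → E) (x h : ℝ × ℝ) :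
    fderiv ℝ f x h = ((h.1 + h.2) / 2) • dd wp f x + ((h.1 - h.2) / 2) • dd wm f x := by
  simp only [dd, ← map_smul, ← map_add]
  congr 1
  ext <;> simp <;> ring

theorem dd_congr {f g : ℝ × ℝ → E} {V : Set (ℝ × ℝ)} (hV : IsOpen V) (h : EqOn f g V)
    {x : ℝ × ℝ} (hx : x ∈ V) (w : ℝ × ℝ) : dd w f x = dd w g x := by
  unfold dd
  rw [Filter.EventuallyEq.fderiv_eq (Filter.eventually_of_mem (hV.mem_nhds hx) h)]

theorem dd_const (c : E) (x w : ℝ × ℝ) : dd w (fun _ => c) x = 0 := by simp [dd]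

theorem dd_add {f g : ℝ × ℝ → E} {x : ℝ × ℝ} (hf : DifferentiableAt ℝ f x)
    (hg : DifferentiableAt ℝ g x) (w : ℝ × ℝ) :
    dd w (fun y => f y + g y) x = dd w f x + dd w g x := by
  simp [dd, fderiv_fun_add hf hg]

theorem dd_sub {f g : ℝ × ℝ → E} {x : ℝ × ℝ} (hf : DifferentiableAt ℝ f x)
    (hg : DifferentiableAt ℝ g x) (w : ℝ × ℝ) :
    dd w (fun y => f y - g y) x = dd w f x - dd w g x := by
  simp [dd, fderiv_fun_sub hf hg]

theorem dd_neg {f : ℝ × ℝ → E} {x : ℝ × ℝ} (w : ℝ × ℝ) :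
    dd w (fun y => -f y) x = -dd w f x := by
  simp [dd, fderiv_fun_neg]

theorem dd_smul {a : ℝ × ℝ → ℝ} {f : ℝ × ℝ → E} {x : ℝ × ℝ} (ha : DifferentiableAt ℝ a x)
    (hf : DifferentiableAt ℝ f x) (w : ℝ × ℝ) :
    dd w (fun y => a y • f y) x = dd w a x • f x + a x • dd w f x := by
  simp [dd, fderiv_fun_smul ha hf, add_comm]

theorem dd_const_smul (c : ℝ) {f : ℝ × ℝ → E} {x : ℝ × ℝ}
    (hf : DifferentiableAt ℝ f x) (w : ℝ × ℝ) :
    dd w (fun y => c • f y) x = c • dd w f x := by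
  simp [dd, fderiv_fun_const_smul hf]

theorem dd_mul {a b : ℝ × ℝ → ℝ} {x : ℝ × ℝ} (ha : DifferentiableAt ℝ a x)
    (hb : DifferentiableAt ℝ b x) (w : ℝ × ℝ) :
    dd w (fun y => a y * b y) x = dd w a x * b x + a x * dd w b x := by
  simpa using! dd_smul ha hb w

theorem dd_const_mul (c : ℝ) {f : ℝ × ℝ → ℝ} {x : ℝ × ℝ}
    (hf : DifferentiableAt ℝ f x) (w : ℝ × ℝ) :
    dd w (fun y => c * f y) x = c * dd w f x := by
  simpa using! dd_const_smul c hf w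

theorem dd_exp {a : ℝ × ℝ → ℝ} {x : ℝ × ℝ} (ha : DifferentiableAt ℝ a x) (w : ℝ × ℝ) :
    dd w (fun y => Real.exp (a y)) x = Real.exp (a x) * dd w a x := by
  simp [dd, fderiv_exp ha]

theorem dd_log {a : ℝ × ℝ → ℝ} {x : ℝ × ℝ} (ha : DifferentiableAt ℝ a x) (h : a x ≠ 0)
    (w : ℝ × ℝ) : dd w (fun y => Real.log (a y)) x = dd w a x / a x := by
  simp [dd, fderiv.log ha h, div_eq_inv_mul]

theorem dd_pi {n : ℕ} {f : ℝ × ℝ → Fin n → ℝ} {x : ℝ × ℝ} (hf : DifferentiableAt ℝ f x)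
    (w : ℝ × ℝ) (i : Fin n) : dd w f x i = dd w (fun y => f y i) x := by
  have := hasFDerivAt_pi'.1 hf.hasFDerivAt i
  simp [dd, this.fderiv]

theorem contDiffOn_dd {f : ℝ × ℝ → E} {V : Set (ℝ × ℝ)} (hV : IsOpen V)
    (hf : ContDiffOn ℝ ∞ f V) (w : ℝ × ℝ) : ContDiffOn ℝ ∞ (dd w f) V :=
  (hf.fderiv_of_isOpen hV (by simp)).clm_apply contDiffOn_const

theorem differentiableAt_of_contDiffOn {f : ℝ × ℝ → E} {V : Set (ℝ × ℝ)} (hV : IsOpen V)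
    (hf : ContDiffOn ℝ ∞ f V) {x : ℝ × ℝ} (hx : x ∈ V) : DifferentiableAt ℝ f x :=
  (hf.contDiffAt (hV.mem_nhds hx)).differentiableAt (by simp)

theorem dd_comm {f : ℝ × ℝ → E} {V : Set (ℝ × ℝ)} (hV : IsOpen V)
    (hf : ContDiffOn ℝ ∞ f V) {x : ℝ × ℝ} (hx : x ∈ V) (w w' : ℝ × ℝ) :
    dd w (dd w' f) x = dd w' (dd w f) x := by
  have hd := differentiableAt_of_contDiffOn hV (hf.fderiv_of_isOpen hV (m := ∞) (by simp)) hx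
  have key : ∀ a b : ℝ × ℝ, dd a (dd b f) x = fderiv ℝ (fderiv ℝ f) x a b := by
    intro a b
    have := (hd.hasFDerivAt.clm_apply (hasFDerivAt_const b x)).fderiv
    unfold dd
    rw [this]
    simp
  rw [key, key]
  exact ((hf.contDiffAt (hV.mem_nhds hx)).isSymmSndFDerivAt
    (by simp [minSmoothness_of_isRCLikeNormedField]; exact WithTop.coe_le_coe.2 le_top)) w w'

/-- Symmetric second derivatives, in terms of the null directions. -/
theorem ds_dt_eq {f : ℝ × ℝ → ℝ} {V : Set (ℝ × ℝ)} (hV : IsOpen V)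
    (hf : ContDiffOn ℝ ∞ f V) {x : ℝ × ℝ} (hx : x ∈ V) :
    ds (dt f) x = dd wp (dd wm f) x / 2 := by
  have h1 : dt f = fun y => (1 / √2) * dd wm f y := by
    ext y; rw [dd_wm, dt]; ring
  have h2 := differentiableAt_of_contDiffOn hV (contDiffOn_dd hV hf wm) hx
  rw [ds, ← dd_wp, h1, dd_const_mul _ h2]
  have : √2 * √2 = (2 : ℝ) := Real.mul_self_sqrt (by norm_num)
  field_simp
  rw [sq, this]; ring

end Calculus

/-! ### Scalar products and null frames -/

/-- The scalar product of signature `(2, 2)` on the first four coordinates, with weight `c` on the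
last one. -/
def bil (c : ℝ) (x y : Fin 5 → ℝ) : ℝ :=
  x 0 * y 0 + x 1 * y 1 - x 2 * y 2 - x 3 * y 3 + c * (x 4 * y 4)

section Bil

variable (c : ℝ) (x y z : Fin 5 → ℝ) (a : ℝ)

theorem bil_comm : bil c x y = bil c y x := by simp only [bil]; ring

theorem bil_add_left : bil c (x + y) z = bil c x z + bil c y z := by
  simp only [bil, Pi.add_apply]; ring

theorem bil_add_right : bil c z (x + y) = bil c z x + bil c z y := by
  simp only [bil, Pi.add_apply]; ring

theorem bil_sub_left : bil c (x - y) z = bil c x z - bil c y z := by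
  simp only [bil, Pi.sub_apply]; ring

theorem bil_sub_right : bil c z (x - y) = bil c z x - bil c z y := by
  simp only [bil, Pi.sub_apply]; ring

theorem bil_smul_left : bil c (a • x) z = a * bil c x z := by
  simp only [bil, Pi.smul_apply, smul_eq_mul]; ring

theorem bil_smul_right : bil c z (a • x) = a * bil c z x := by
  simp only [bil, Pi.smul_apply, smul_eq_mul]; ring

theorem bil_zero_left : bil c 0 z = 0 := by simp [bil]

end Bil

theorem form_eq_bil_sign (L₀ : ℝ) (x y : Fin 5 → ℝ) : form L₀ x y = bil (Real.sign L₀) x y := rfl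

theorem dd_bil (c : ℝ) {a b : ℝ × ℝ → Fin 5 → ℝ} {x : ℝ × ℝ} (ha : DifferentiableAt ℝ a x)
    (hb : DifferentiableAt ℝ b x) (w : ℝ × ℝ) :
    dd w (fun y => bil c (a y) (b y)) x = bil c (dd w a x) (b x) + bil c (a x) (dd w b x) := by
  have ha' := fun i => (hasFDerivAt_pi'.1 ha.hasFDerivAt i)
  have hb' := fun i => (hasFDerivAt_pi'.1 hb.hasFDerivAt i)
  have h := fun i => (ha' i).mul (hb' i)
  have := ((((h 0).add (h 1)).sub (h 2)).sub (h 3)).add ((h 4).const_mul c)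
  have e : fderiv ℝ (fun y => bil c (a y) (b y)) x = _ := this.fderiv
  simp only [dd, e]
  simp [bil]
  ring

theorem contDiffOn_bil (c : ℝ) {a b : ℝ × ℝ → Fin 5 → ℝ} {V : Set (ℝ × ℝ)}
    (ha : ContDiffOn ℝ ∞ a V) (hb : ContDiffOn ℝ ∞ b V) :
    ContDiffOn ℝ ∞ (fun y => bil c (a y) (b y)) V := by
  have ha' := contDiffOn_pi.1 ha
  have hb' := contDiffOn_pi.1 hb
  have h := fun i => (ha' i).mul (hb' i)
  exact ((((h 0).add (h 1)).sub (h 2)).sub (h 3)).add (contDiffOn_const.mul (h 4))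

/-- The scalar products of a null frame `(p, q, n, k, ξ)`: `⟨p, q⟩ = ⟨n, k⟩ = e`, `⟨ξ, ξ⟩ = κ`, and
all others vanish. -/
def nullGram (e κ : ℝ) : Matrix (Fin 5) (Fin 5) ℝ :=
  !![0, e, 0, 0, 0; e, 0, 0, 0, 0; 0, 0, 0, e, 0; 0, 0, e, 0, 0; 0, 0, 0, 0, κ]

/-- The matrix of `bil c`. -/
def bilMatrix (c : ℝ) : Matrix (Fin 5) (Fin 5) ℝ := Matrix.diagonal ![1, 1, -1, -1, c]

theorem mul_bilMatrix_mul_transpose (c : ℝ) (W W' : Fin 5 → Fin 5 → ℝ) (i j : Fin 5) :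
    (Matrix.of W * bilMatrix c * (Matrix.of W').transpose) i j = bil c (W i) (W' j) := by
  rw [Matrix.mul_apply]
  simp only [bilMatrix, Matrix.mul_diagonal, Matrix.transpose_apply,
    Fin.sum_univ_five, bil, Matrix.of_apply, Matrix.cons_val]
  ring

theorem nullGram_mul_inv {e κ : ℝ} (he : e ≠ 0) (hκ : κ ≠ 0) :
    nullGram e κ * nullGram e⁻¹ κ⁻¹ = 1 := by
  ext i j
  fin_cases i <;> fin_cases j <;>
    simp [nullGram, Matrix.mul_apply, Fin.sum_univ_five, he, hκ]

theorem bilMatrix_mul_self {c : ℝ} (hc : c * c = 1) : bilMatrix c * bilMatrix c = 1 := by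
  rw [bilMatrix, Matrix.diagonal_mul_diagonal, ← Matrix.diagonal_one]
  congr 1
  ext i
  fin_cases i <;> simp [hc]

theorem gram_iff_matrix (c e κ : ℝ) (W : Fin 5 → Fin 5 → ℝ) :
    (∀ i j, bil c (W i) (W j) = nullGram e κ i j) ↔
      Matrix.of W * bilMatrix c * (Matrix.of W).transpose = nullGram e κ := by
  rw [← Matrix.ext_iff]
  simp only [mul_bilMatrix_mul_transpose]

/-- The rows of `W` have the scalar products of a null frame iff the columns of `W` satisfy the
dual relations. -/
theorem gram_iff_dual {c e κ : ℝ} (hc : c * c = 1) (he : e ≠ 0) (hκ : κ ≠ 0)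
    (W : Matrix (Fin 5) (Fin 5) ℝ) :
    W * bilMatrix c * W.transpose = nullGram e κ ↔
      W.transpose * nullGram e⁻¹ κ⁻¹ * W = bilMatrix c := by
  have hG := nullGram_mul_inv he hκ
  have hG' := mul_eq_one_comm.1 hG
  have hJ := bilMatrix_mul_self hc
  constructor
  · intro h
    have h1 : W * (bilMatrix c * W.transpose * nullGram e⁻¹ κ⁻¹) = 1 := by
      rw [← hG, ← h]; simp only [Matrix.mul_assoc]
    have h2 := mul_eq_one_comm.1 h1
    calc W.transpose * nullGram e⁻¹ κ⁻¹ * W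
        = bilMatrix c * (bilMatrix c * W.transpose * nullGram e⁻¹ κ⁻¹ * W) := by
          simp only [← Matrix.mul_assoc, hJ, Matrix.one_mul]
      _ = bilMatrix c := by rw [h2, Matrix.mul_one]
  · intro h
    have h1 : (bilMatrix c * W.transpose * nullGram e⁻¹ κ⁻¹) * W = 1 := by
      rw [← hJ, ← h]; simp only [Matrix.mul_assoc]
    have h2 := mul_eq_one_comm.1 h1
    calc W * bilMatrix c * W.transpose
        = (W * (bilMatrix c * W.transpose * nullGram e⁻¹ κ⁻¹)) * nullGram e κ := by
          simp only [Matrix.mul_assoc, hG', Matrix.mul_one]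
      _ = nullGram e κ := by rw [h2, Matrix.one_mul]

/-- A vector is determined by its scalar products with a null frame. -/
theorem gram_ext {c e κ : ℝ} (he : e ≠ 0) (hκ : κ ≠ 0) {W : Fin 5 → Fin 5 → ℝ}
    (hW : ∀ i j, bil c (W i) (W j) = nullGram e κ i j)
    {y z : Fin 5 → ℝ} (h : ∀ i, bil c y (W i) = bil c z (W i)) : y = z := by
  rw [gram_iff_matrix] at hW
  have h1 : Matrix.of W * (bilMatrix c * (Matrix.of W).transpose * nullGram e⁻¹ κ⁻¹) = 1 := by
    rw [← nullGram_mul_inv he hκ, ← hW]; simp only [Matrix.mul_assoc]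
  have h2 := mul_eq_one_comm.1 h1
  have h3 : Matrix.of (fun _ : Fin 5 => y) * bilMatrix c * (Matrix.of W).transpose
      = Matrix.of (fun _ : Fin 5 => z) * bilMatrix c * (Matrix.of W).transpose := by
    ext i j
    rw [mul_bilMatrix_mul_transpose, mul_bilMatrix_mul_transpose, h]
  have h4 : ∀ T : Matrix (Fin 5) (Fin 5) ℝ,
      T * bilMatrix c * (Matrix.of W).transpose * (nullGram e⁻¹ κ⁻¹ * Matrix.of W) = T := by
    intro T
    calc T * bilMatrix c * (Matrix.of W).transpose * (nullGram e⁻¹ κ⁻¹ * Matrix.of W)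
        = T * (bilMatrix c * (Matrix.of W).transpose * nullGram e⁻¹ κ⁻¹ * Matrix.of W) := by
          simp only [Matrix.mul_assoc]
      _ = T := by rw [h2, Matrix.mul_one]
  have h5 : Matrix.of (fun _ : Fin 5 => y) = Matrix.of (fun _ : Fin 5 => z) := by
    rw [← h4 (Matrix.of fun _ => y), h3, h4]
  exact congrFun h5 0

/-! ### The structure equations of a null frame -/

/-- The weight of the last coordinate in the nondegenerate scalar product of `ℝ⁵` that restricts to
the metric of the space form. For `L₀ = 0`, the last coordinate axis is made a space-like unit
normal of the hyperplane `{x₄ = 0}`. -/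
def tau (L₀ : ℝ) : ℝ := if L₀ = 0 then 1 else Real.sign L₀

/-- A normal vector of the space form at its point `y`. -/
def xi (L₀ : ℝ) (y : Fin 5 → ℝ) : Fin 5 → ℝ := if L₀ = 0 then Pi.single 4 1 else y

/-- The square `⟨ξ, ξ⟩` of the normal vector `ξ = xi L₀ y`. -/
def kap (L₀ : ℝ) : ℝ := if L₀ = 0 then 1 else 1 / L₀

theorem tau_mul_self (L₀ : ℝ) : tau L₀ * tau L₀ = 1 := by
  unfold tau
  split_ifs with h
  · simp
  · rcases lt_or_gt_of_ne h with h | h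
    · simp [Real.sign_of_neg h]
    · simp [Real.sign_of_pos h]

theorem kap_ne_zero (L₀ : ℝ) : kap L₀ ≠ 0 := by
  unfold kap
  split_ifs with h
  · simp
  · simpa using h

theorem kap_mul_sq (L₀ : ℝ) : kap L₀ * L₀ * L₀ = L₀ := by
  unfold kap
  split_ifs with h
  · simp [h]
  · field_simp

theorem kap_mul_tau_pos (L₀ : ℝ) : 0 < kap L₀ * tau L₀ := by
  unfold kap tau
  split_ifs with h
  · simp
  · rcases lt_or_gt_of_ne h with h | h
    · simp [Real.sign_of_neg h, h]
    · simp [Real.sign_of_pos h, h]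

/-- On vectors tangent to the space form, `form L₀` is the nondegenerate product `bil (tau L₀)`. -/
theorem form_eq_bil {L₀ : ℝ} {x y : Fin 5 → ℝ} (h : L₀ = 0 → x 4 = 0 ∨ y 4 = 0) :
    form L₀ x y = bil (tau L₀) x y := by
  by_cases h0 : L₀ = 0
  · rcases h h0 with h | h <;> simp [form, bil, h]
  · simp [form, bil, tau, h0]

/-- Tangency in terms of the normal vector `xi`. -/
theorem isTangent_iff {L₀ : ℝ} {x w : Fin 5 → ℝ} :
    IsTangent L₀ x w ↔ bil (tau L₀) w (xi L₀ x) = 0 := by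
  unfold IsTangent tau xi
  split_ifs with h
  · simp [bil]
  · rfl

theorem IsTangent.apply_four {L₀ : ℝ} {x w : Fin 5 → ℝ} (h : IsTangent L₀ x w) (h0 : L₀ = 0) :
    w 4 = 0 := by
  simpa [IsTangent, h0] using h

theorem bil_xi_self {L₀ : ℝ} {x : Fin 5 → ℝ} (h : x ∈ spaceForm L₀) :
    bil (tau L₀) (xi L₀ x) (xi L₀ x) = kap L₀ := by
  unfold xi kap tau
  split_ifs with h0
  · simp [bil]
  · have h' : if L₀ = 0 then x 4 = 0 else form L₀ x x = 1 / L₀ := h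
    rwa [if_neg h0] at h'

namespace Data

variable (D : Data) (x : ℝ × ℝ)

/-- `X₊ + Y₊`. -/
def cA : ℝ := D.Xp x + D.Yp x

/-- `X₋ + Y₋`. -/
def cB : ℝ := D.Xm x + D.Ym x

/-- `X₊ - Y₊`. -/
def cC : ℝ := D.Xp x - D.Yp x

/-- `X₋ - Y₋`. -/
def cD : ℝ := D.Xm x - D.Ym x

/-- The normal connection in the direction `∂/∂u + ∂/∂v`. -/
def mp : ℝ := D.μ₁ x + D.μ₂ x

/-- The normal connection in the direction `∂/∂u - ∂/∂v`. -/
def mm : ℝ := D.μ₁ x - D.μ₂ x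

/-- The conformal factor `e^{2λ}`. -/
def ee : ℝ := Real.exp (2 * D.lam x)

/-- Coefficients of the derivatives of the null frame
`(T₁ + T₂, T₁ - T₂, N₁ + N₂, N₁ - N₂, ξ)` in the direction `∂/∂u + ∂/∂v`, if the derivatives of
`ξ` are `c` times those of the surface. -/
def mPlus (L₀ c : ℝ) : Matrix (Fin 5) (Fin 5) ℝ :=
  !![2 * dd wp D.lam x, 0, D.cA x, D.cB x, 0;
    0, 0, 0, 0, -2 * L₀ * D.ee x;
    0, -D.cB x, dd wp D.lam x + D.mp x, 0, 0;
    0, -D.cA x, 0, dd wp D.lam x - D.mp x, 0;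
    c, 0, 0, 0, 0]

/-- Coefficients of the derivatives of the null frame
`(T₁ + T₂, T₁ - T₂, N₁ + N₂, N₁ - N₂, ξ)` in the direction `∂/∂u - ∂/∂v`, if the derivatives of
`ξ` are `c` times those of the surface. -/
def mMinus (L₀ c : ℝ) : Matrix (Fin 5) (Fin 5) ℝ :=
  !![0, 0, 0, 0, -2 * L₀ * D.ee x;
    0, 2 * dd wm D.lam x, D.cD x, D.cC x, 0;
    -D.cC x, 0, dd wm D.lam x + D.mm x, 0, 0;
    -D.cD x, 0, 0, dd wm D.lam x - D.mm x, 0;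
    0, c, 0, 0, 0]

/-- The seven functions are smooth on `V`. -/
structure IsSmoothOn (D : Data) (V : Set (ℝ × ℝ)) : Prop where
  lam : ContDiffOn ℝ ∞ D.lam V
  α₁ : ContDiffOn ℝ ∞ D.α₁ V
  α₂ : ContDiffOn ℝ ∞ D.α₂ V
  β₁ : ContDiffOn ℝ ∞ D.β₁ V
  β₂ : ContDiffOn ℝ ∞ D.β₂ V
  μ₁ : ContDiffOn ℝ ∞ D.μ₁ V
  μ₂ : ContDiffOn ℝ ∞ D.μ₂ V

namespace IsSmoothOn

variable {D : Data} {V : Set (ℝ × ℝ)} (h : D.IsSmoothOn V)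
include h

theorem cA : ContDiffOn ℝ ∞ D.cA V := (h.α₁.add h.β₂).add (h.α₂.add h.β₁)
theorem cB : ContDiffOn ℝ ∞ D.cB V := (h.α₁.sub h.β₂).add (h.α₂.sub h.β₁)
theorem cC : ContDiffOn ℝ ∞ D.cC V := (h.α₁.add h.β₂).sub (h.α₂.add h.β₁)
theorem cD : ContDiffOn ℝ ∞ D.cD V := (h.α₁.sub h.β₂).sub (h.α₂.sub h.β₁)
theorem mp : ContDiffOn ℝ ∞ D.mp V := h.μ₁.add h.μ₂
theorem mm : ContDiffOn ℝ ∞ D.mm V := h.μ₁.sub h.μ₂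
theorem ee : ContDiffOn ℝ ∞ D.ee V := (contDiffOn_const.mul h.lam).exp

end IsSmoothOn

theorem ee_pos : 0 < D.ee x := Real.exp_pos _

theorem dd_ee {D : Data} {x : ℝ × ℝ} (h : DifferentiableAt ℝ D.lam x) (w : ℝ × ℝ) :
    dd w D.ee x = 2 * D.ee x * dd w D.lam x := by
  have := dd_exp (h.const_mul 2) w
  rw [dd_const_mul 2 h] at this
  exact this.trans (by rw [ee]; ring)

end Data

/-- `W = (T₁ + T₂, T₁ - T₂, N₁ + N₂, N₁ - N₂, ξ)` has the scalar products of a null frame and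
satisfies the Gauss and Weingarten equations with the coefficients `D`. The factor `kap L₀ * L₀`
is `1`, or `0` if `L₀ = 0`, since `ξ` is the position vector or constant, respectively. -/
structure IsNullFrame (L₀ : ℝ) (V : Set (ℝ × ℝ)) (D : Data)
    (W : Fin 5 → ℝ × ℝ → Fin 5 → ℝ) : Prop where
  smooth : ∀ i, ContDiffOn ℝ ∞ (W i) V
  gram : ∀ x ∈ V, ∀ i j, bil (tau L₀) (W i x) (W j x) = nullGram (2 * D.ee x) (kap L₀) i j
  plus : ∀ x ∈ V, ∀ i, dd wp (W i) x = ∑ j, D.mPlus x L₀ (kap L₀ * L₀) i j • W j x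
  minus : ∀ x ∈ V, ∀ i, dd wm (W i) x = ∑ j, D.mMinus x L₀ (kap L₀ * L₀) i j • W j x

theorem dd_nullGram {e : ℝ × ℝ → ℝ} {x : ℝ × ℝ} (κ : ℝ) (w : ℝ × ℝ) (i j : Fin 5) :
    dd w (fun y => nullGram (e y) κ i j) x = nullGram (dd w e x) 0 i j := by
  fin_cases i <;> fin_cases j <;> simp [nullGram, dd_const]

/-- The Gauss and Weingarten equations follow from those of their components that are not forced by
the constancy of the scalar products. -/
theorem IsNullFrame.of_coeffs {L₀ : ℝ} {V : Set (ℝ × ℝ)} (hV : IsOpen V) {D : Data}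
    {W : Fin 5 → ℝ × ℝ → Fin 5 → ℝ} (hD : ContDiffOn ℝ ∞ D.lam V)
    (smooth : ∀ i, ContDiffOn ℝ ∞ (W i) V)
    (gram : ∀ x ∈ V, ∀ i j, bil (tau L₀) (W i x) (W j x) = nullGram (2 * D.ee x) (kap L₀) i j)
    (comm : ∀ x ∈ V, dd wp (W 1) x = dd wm (W 0) x)
    (xp : ∀ x ∈ V, dd wp (W 4) x = (kap L₀ * L₀) • W 0 x)
    (xm : ∀ x ∈ V, dd wm (W 4) x = (kap L₀ * L₀) • W 1 x)
    (hp : ∀ x ∈ V, bil (tau L₀) (dd wp (W 0) x) (W 2 x) = 2 * D.ee x * D.cB x ∧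
      bil (tau L₀) (dd wp (W 0) x) (W 3 x) = 2 * D.ee x * D.cA x ∧
      bil (tau L₀) (dd wp (W 1) x) (W 2 x) = 0 ∧ bil (tau L₀) (dd wp (W 1) x) (W 3 x) = 0 ∧
      bil (tau L₀) (dd wp (W 2) x) (W 3 x) = 2 * D.ee x * (dd wp D.lam x + D.mp x))
    (hm : ∀ x ∈ V, bil (tau L₀) (dd wm (W 1) x) (W 2 x) = 2 * D.ee x * D.cC x ∧
      bil (tau L₀) (dd wm (W 1) x) (W 3 x) = 2 * D.ee x * D.cD x ∧
      bil (tau L₀) (dd wm (W 2) x) (W 3 x) = 2 * D.ee x * (dd wm D.lam x + D.mm x)) :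
    IsNullFrame L₀ V D W := by
  have hder : ∀ x ∈ V, ∀ w i j, bil (tau L₀) (dd w (W i) x) (W j x)
      + bil (tau L₀) (dd w (W j) x) (W i x) = nullGram (4 * D.ee x * dd w D.lam x) 0 i j := by
    intro x hx w i j
    have hd := fun i => differentiableAt_of_contDiffOn hV (smooth i) hx
    have hl := differentiableAt_of_contDiffOn hV hD hx
    have h1 := dd_bil (tau L₀) (hd i) (hd j) w
    rw [dd_congr hV (fun y hy => gram y hy i j) hx w, dd_nullGram, bil_comm _ (W i x)] at h1
    rw [← h1]
    have he : DifferentiableAt ℝ D.ee x := (hl.const_mul 2).exp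
    rw [dd_const_mul 2 he, Data.dd_ee hl]
    ring_nf
  have he : ∀ x, 2 * D.ee x ≠ 0 := fun x => by have := D.ee_pos x; positivity
  refine ⟨smooth, gram, fun x hx i => ?_, fun x hx i => ?_⟩
  · refine gram_ext (he x) (kap_ne_zero L₀) (W := fun j => W j x) (gram x hx) fun j => ?_
    obtain ⟨p1, p2, p3, p4, p5⟩ := hp x hx
    have g := gram x hx
    have d := hder x hx wp
    have dm := hder x hx wm
    have c := comm x hx
    simp only [Fin.sum_univ_five, bil_add_left, bil_smul_left, g]
    have x1 := xp x hx
    have d00 := d 0 0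
    have dm00 := dm 0 0
    have d01 := d 0 1
    have d11 := d 1 1
    have d02 := d 0 2
    have d03 := d 0 3
    have d12 := d 1 2
    have d13 := d 1 3
    have d23 := d 2 3
    have d22 := d 2 2
    have d33 := d 3 3
    have d04 := d 0 4
    have d14 := d 1 4
    have d24 := d 2 4
    have d34 := d 3 4
    rw [← c] at dm00
    simp only [x1, bil_smul_left, g] at d04 d14 d24 d34
    simp only [nullGram, Matrix.of_apply, Matrix.cons_val] at *
    fin_cases i <;> fin_cases j <;>
      simp only [Data.mPlus, Matrix.of_apply, Matrix.cons_val, Fin.zero_eta, Fin.mk_one,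
        Fin.reduceFinMk, x1, bil_smul_left, g] <;> linarith
  · refine gram_ext (he x) (kap_ne_zero L₀) (W := fun j => W j x) (gram x hx) fun j => ?_
    obtain ⟨p1, p2, p3⟩ := hm x hx
    have g := gram x hx
    have d := hder x hx wm
    have dm := hder x hx wp
    have c := comm x hx
    simp only [Fin.sum_univ_five, bil_add_left, bil_smul_left, g]
    have x1 := xm x hx
    have d00 := d 0 0
    have dm11 := dm 1 1
    have dp02 := (hp x hx).2.2
    rw [c] at dp02
    obtain ⟨p4, p5, -⟩ := dp02
    have d01 := d 0 1
    have d11 := d 1 1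
    have d02 := d 0 2
    have d03 := d 0 3
    have d12 := d 1 2
    have d13 := d 1 3
    have d23 := d 2 3
    have d22 := d 2 2
    have d33 := d 3 3
    have d04 := d 0 4
    have d14 := d 1 4
    have d24 := d 2 4
    have d34 := d 3 4
    rw [c] at dm11
    simp only [x1, bil_smul_left, g] at d04 d14 d24 d34
    simp only [nullGram, Matrix.of_apply, Matrix.cons_val] at *
    fin_cases i <;> fin_cases j <;>
      simp only [Data.mMinus, Matrix.of_apply, Matrix.cons_val, Fin.zero_eta, Fin.mk_one,
        Fin.reduceFinMk, x1, bil_smul_left, g] <;> linarith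

/-! ### The structure equations of a surface with zero mean curvature vector -/

theorem mem_spaceForm_zero {L₀ : ℝ} {x : Fin 5 → ℝ} (h : x ∈ spaceForm L₀) (h0 : L₀ = 0) :
    x 4 = 0 := by
  have h' : if L₀ = 0 then x 4 = 0 else form L₀ x x = 1 / L₀ := h
  rwa [if_pos h0] at h'

theorem mem_spaceForm_ne {L₀ : ℝ} {x : Fin 5 → ℝ} (h : x ∈ spaceForm L₀) (h0 : L₀ ≠ 0) :
    form L₀ x x = 1 / L₀ := by
  have h' : if L₀ = 0 then x 4 = 0 else form L₀ x x = 1 / L₀ := h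
  rwa [if_neg h0] at h'

theorem IsTangent.mul_form {L₀ : ℝ} {x w : Fin 5 → ℝ} (h : IsTangent L₀ x w) :
    L₀ * form L₀ w x = 0 := by
  by_cases h0 : L₀ = 0
  · simp [h0]
  · have h' : if L₀ = 0 then w 4 = 0 else form L₀ w x = 0 := h
    rw [if_neg h0] at h'
    rw [h', mul_zero]

theorem dd_apply_four {V : Set (ℝ × ℝ)} (hV : IsOpen V) {W : ℝ × ℝ → Fin 5 → ℝ}
    (hW : ContDiffOn ℝ ∞ W V) (h : ∀ x ∈ V, W x 4 = 0) {x : ℝ × ℝ} (hx : x ∈ V) (w : ℝ × ℝ) :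
    dd w W x 4 = 0 := by
  rw [dd_pi (differentiableAt_of_contDiffOn hV hW hx),
    dd_congr (g := fun _ => 0) hV (fun y hy => h y hy) hx, dd_const]

theorem isTangent_dd {L₀ : ℝ} {V : Set (ℝ × ℝ)} (hV : IsOpen V) {f : ℝ × ℝ → Fin 5 → ℝ}
    (hf : ContDiffOn ℝ ∞ f V) (hmem : ∀ x ∈ V, f x ∈ spaceForm L₀) {x : ℝ × ℝ} (hx : x ∈ V)
    (w : ℝ × ℝ) : IsTangent L₀ (f x) (dd w f x) := by
  unfold IsTangent
  split_ifs with h0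
  · exact dd_apply_four hV hf (fun y hy => mem_spaceForm_zero (hmem y hy) h0) hx w
  · have hd := differentiableAt_of_contDiffOn hV hf hx
    have h1 := dd_bil (Real.sign L₀) hd hd w
    have hc : EqOn (fun y => bil (Real.sign L₀) (f y) (f y)) (fun _ => 1 / L₀) V :=
      fun y hy => mem_spaceForm_ne (hmem y hy) h0
    rw [dd_congr hV hc hx, dd_const, bil_comm _ (f x)] at h1
    rw [form_eq_bil_sign]
    linarith

theorem form_normalPart_sub {L₀ : ℝ} {f : ℝ × ℝ → Fin 5 → ℝ} {x : ℝ × ℝ} {w N : Fin 5 → ℝ}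
    (hN : IsTangent L₀ (f x) N) (h₁ : form L₀ N (du f x) = 0) (h₂ : form L₀ N (dv f x) = 0) :
    form L₀ (normalPart L₀ f x (w - (L₀ * form L₀ w (f x)) • f x)) N = form L₀ w N := by
  have h := hN.mul_form
  simp only [normalPart, form_eq_bil_sign, bil_sub_left, bil_smul_left] at *
  rw [bil_comm _ (du f x) N, bil_comm _ (dv f x) N, h₁, h₂, bil_comm _ (f x) N]
  linear_combination (-bil L₀.sign w (f x)) * h

/-- The null frame of a surface `f` with normal frame `(N₁, N₂)`. -/
def nullFrame (L₀ : ℝ) (f N₁ N₂ : ℝ × ℝ → Fin 5 → ℝ) : Fin 5 → ℝ × ℝ → Fin 5 → ℝ :=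
  ![dd wp f, dd wm f, fun x => N₁ x + N₂ x, fun x => N₁ x - N₂ x, fun x => xi L₀ (f x)]

section Surface

variable {L₀ : ℝ} {o : ℤˣ} {V : Set (ℝ × ℝ)} {f N₁ N₂ : ℝ × ℝ → Fin 5 → ℝ}

theorem contDiffOn_xi (hf : ContDiffOn ℝ ∞ f V) : ContDiffOn ℝ ∞ (fun x => xi L₀ (f x)) V := by
  unfold xi
  split_ifs
  · exact contDiffOn_const
  · exact hf

theorem IsZMCOn.ee_eq (hf : IsZMCOn L₀ V f) {x : ℝ × ℝ} (hx : x ∈ V) :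
    (dataOf L₀ f N₁ N₂).ee x = form L₀ (du f x) (du f x) := by
  simp only [Data.ee, dataOf]
  rw [mul_div_cancel₀ _ two_ne_zero, Real.exp_log (hf.pos x hx)]

theorem IsZMCOn.tangent (hV : IsOpen V) (hf : IsZMCOn L₀ V f) {x : ℝ × ℝ} (hx : x ∈ V)
    (w : ℝ × ℝ) : IsTangent L₀ (f x) (dd w f x) :=
  isTangent_dd hV hf.smooth hf.mem hx w

/-- The scalar products of the second derivatives of the surface with the normal frame. -/
theorem IsZMCOn.second_coeffs (hf : IsZMCOn L₀ V f)
    (hN : IsNormalFrame L₀ o V f N₁ N₂) {x : ℝ × ℝ} (hx : x ∈ V) :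
    form L₀ (du (du f) x) (N₁ x)
        = (dataOf L₀ f N₁ N₂).ee x * (dataOf L₀ f N₁ N₂).α₁ x ∧
    form L₀ (du (dv f) x) (N₁ x)
        = (dataOf L₀ f N₁ N₂).ee x * (dataOf L₀ f N₁ N₂).α₂ x ∧
    form L₀ (dv (dv f) x) (N₁ x)
        = (dataOf L₀ f N₁ N₂).ee x * (dataOf L₀ f N₁ N₂).α₁ x ∧
    form L₀ (du (du f) x) (N₂ x)
        = -((dataOf L₀ f N₁ N₂).ee x * (dataOf L₀ f N₁ N₂).β₁ x) ∧
    form L₀ (du (dv f) x) (N₂ x)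
        = -((dataOf L₀ f N₁ N₂).ee x * (dataOf L₀ f N₁ N₂).β₂ x) ∧
    form L₀ (dv (dv f) x) (N₂ x)
        = -((dataOf L₀ f N₁ N₂).ee x * (dataOf L₀ f N₁ N₂).β₁ x) := by
  have hE := hf.pos x hx
  have hEq := hf.ee_eq (N₁ := N₁) (N₂ := N₂) hx
  have n1 := fun w => form_normalPart_sub (w := w) (hN.tangent₁ x hx) (hN.normal₁ x hx).1
    (hN.normal₁ x hx).2
  have n2 := fun w => form_normalPart_sub (w := w) (hN.tangent₂ x hx) (hN.normal₂ x hx).1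
    (hN.normal₂ x hx).2
  have hH : sigmaUU L₀ f x = sigmaVV L₀ f x := by
    have h := hf.zero_mean x hx
    rw [meanCurvature, hf.neg x hx, smul_eq_zero_iff_right (by norm_num), inv_neg, neg_smul,
      ← sub_eq_add_neg, ← smul_sub, smul_eq_zero_iff_right (inv_ne_zero hE.ne'), sub_eq_zero] at h
    exact h
  have v1 : form L₀ (dv (dv f) x) (N₁ x) = form L₀ (du (du f) x) (N₁ x) := by
    rw [← n1, ← n1 (du (du f) x)]
    exact congrArg (fun y => form L₀ y (N₁ x)) hH.symm
  have v2 : form L₀ (dv (dv f) x) (N₂ x) = form L₀ (du (du f) x) (N₂ x) := by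
    rw [← n2, ← n2 (du (du f) x)]
    exact congrArg (fun y => form L₀ y (N₂ x)) hH.symm
  rw [v1, v2, hEq]
  simp only [dataOf, sigmaUU, sigmaUV, nablaU, n1, n2, hN.norm₁ x hx, hN.norm₂ x hx]
  have := hE.ne'
  refine ⟨?_, ?_, ?_, ?_, ?_, ?_⟩ <;> field_simp

/-- The functions of a smooth surface are smooth. -/
theorem IsZMCOn.isSmoothOn (hV : IsOpen V) (hf : IsZMCOn L₀ V f)
    (hN : IsNormalFrame L₀ o V f N₁ N₂) : (dataOf L₀ f N₁ N₂).IsSmoothOn V := by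
  have s1 : ContDiffOn ℝ ∞ (du f) V := contDiffOn_dd hV hf.smooth _
  have s2 : ContDiffOn ℝ ∞ (dv f) V := contDiffOn_dd hV hf.smooth _
  have s11 : ContDiffOn ℝ ∞ (du (du f)) V := contDiffOn_dd hV s1 _
  have s12 : ContDiffOn ℝ ∞ (du (dv f)) V := contDiffOn_dd hV s2 _
  have sE : ContDiffOn ℝ ∞ (fun x => form L₀ (du f x) (du f x)) V := contDiffOn_bil _ s1 s1
  have hE : ∀ x ∈ V, form L₀ (du f x) (du f x) ≠ 0 := fun x hx => (hf.pos x hx).ne'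
  have n1 := fun x hx w => form_normalPart_sub (w := w) (hN.tangent₁ x hx) (hN.normal₁ x hx).1
    (hN.normal₁ x hx).2
  have n2 := fun x hx w => form_normalPart_sub (w := w) (hN.tangent₂ x hx) (hN.normal₂ x hx).1
    (hN.normal₂ x hx).2
  have d1 : ContDiffOn ℝ ∞ (fun x => form L₀ (N₁ x) (N₁ x)) V := contDiffOn_bil _ hN.1 hN.1
  have d2 : ContDiffOn ℝ ∞ (fun x => form L₀ (N₂ x) (N₂ x)) V := contDiffOn_bil _ hN.2 hN.2
  have e1 : ∀ x ∈ V, form L₀ (N₁ x) (N₁ x) ≠ 0 := fun x hx => by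
    rw [hN.norm₁ x hx]; exact hE x hx
  have e2 : ∀ x ∈ V, form L₀ (N₂ x) (N₂ x) ≠ 0 := fun x hx => by
    rw [hN.norm₂ x hx]; exact neg_ne_zero.2 (hE x hx)
  have hnab : ∀ w, ContDiffOn ℝ ∞
      (fun x => dd w N₁ x - (L₀ * form L₀ (dd w N₁ x) (f x)) • f x) V := fun w =>
    (contDiffOn_dd hV hN.1 w).sub ((contDiffOn_const.mul
      (contDiffOn_bil _ (contDiffOn_dd hV hN.1 w) hf.smooth)).smul hf.smooth)
  have r : ∀ (Z N : ℝ × ℝ → Fin 5 → ℝ), ContDiffOn ℝ ∞ Z V → ContDiffOn ℝ ∞ N V →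
      (∀ x ∈ V, ∀ w, form L₀ (normalPart L₀ f x (w - (L₀ * form L₀ w (f x)) • f x)) (N x)
        = form L₀ w (N x)) → (∀ x ∈ V, form L₀ (N x) (N x) ≠ 0) →
      ContDiffOn ℝ ∞ (fun x => form L₀ (normalPart L₀ f x
        (Z x - (L₀ * form L₀ (Z x) (f x)) • f x)) (N x) / form L₀ (N x) (N x)) V := by
    intro Z N hZ hN' h h'
    have h1 : ContDiffOn ℝ ∞ (fun x => form L₀ (Z x) (N x)) V := contDiffOn_bil _ hZ hN'
    exact (h1.congr fun x hx => h x hx _).div (contDiffOn_bil _ hN' hN') h'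
  exact ⟨(sE.log hE).div_const 2, r _ _ s11 hN.1 n1 e1, r _ _ s12 hN.1 n1 e1,
    r _ _ s11 hN.2 n2 e2, r _ _ s12 hN.2 n2 e2,
    (contDiffOn_bil _ (hnab _) hN.2).div d2 e2, (contDiffOn_bil _ (hnab _) hN.2).div d2 e2⟩

/-- The scalar products of the null frame of a surface. -/
theorem IsZMCOn.gram (hV : IsOpen V) (hf : IsZMCOn L₀ V f)
    (hN : IsNormalFrame L₀ o V f N₁ N₂) {x : ℝ × ℝ} (hx : x ∈ V) (i j : Fin 5) :
    bil (tau L₀) (nullFrame L₀ f N₁ N₂ i x) (nullFrame L₀ f N₁ N₂ j x)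
      = nullGram (2 * (dataOf L₀ f N₁ N₂).ee x) (kap L₀) i j := by
  have hEq := hf.ee_eq (N₁ := N₁) (N₂ := N₂) hx
  have t1 : IsTangent L₀ (f x) (du f x) := hf.tangent hV hx _
  have t2 : IsTangent L₀ (f x) (dv f x) := hf.tangent hV hx _
  have t3 := hN.tangent₁ x hx
  have t4 := hN.tangent₂ x hx
  have conv : ∀ {a b}, IsTangent L₀ (f x) a → form L₀ a b = bil (tau L₀) a b := fun ha =>
    form_eq_bil fun h0 => Or.inl (ha.apply_four h0)
  have g1 := hf.neg x hx
  have g2 := hf.orth x hx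
  have g3 := hN.normal₁ x hx
  have g4 := hN.normal₂ x hx
  have g5 := hN.norm₁ x hx
  have g6 := hN.norm₂ x hx
  have g7 := hN.orth x hx
  rw [conv t1] at hEq g1 g2 g5 g6
  rw [conv t2] at g1
  rw [conv t3, conv t3] at g3
  rw [conv t3] at g5 g7
  rw [conv t4, conv t4] at g4
  rw [conv t4] at g6
  rw [isTangent_iff] at t1 t2 t3 t4
  have g8 := bil_xi_self (hf.mem x hx)
  obtain ⟨g31, g32⟩ := g3
  obtain ⟨g41, g42⟩ := g4
  simp only [nullFrame, nullGram]
  set E := (dataOf L₀ f N₁ N₂).ee x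
  have c := bil_comm (tau L₀)
  fin_cases i <;> fin_cases j <;>
    simp only [Matrix.of_apply, Matrix.cons_val, Fin.zero_eta, Fin.mk_one, Fin.reduceFinMk,
      dd_wp, dd_wm, bil_add_left, bil_add_right, bil_sub_left, bil_sub_right] <;>
    linarith [c (du f x) (dv f x), c (du f x) (N₁ x), c (du f x) (N₂ x), c (dv f x) (N₁ x),
      c (dv f x) (N₂ x), c (N₁ x) (N₂ x), c (du f x) (xi L₀ (f x)), c (dv f x) (xi L₀ (f x)),
      c (N₁ x) (xi L₀ (f x)), c (N₂ x) (xi L₀ (f x))]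

/-- The Gauss and Weingarten equations of a surface with zero mean curvature vector. -/
theorem IsZMCOn.isNullFrame (hV : IsOpen V) (hf : IsZMCOn L₀ V f)
    (hN : IsNormalFrame L₀ o V f N₁ N₂) :
    IsNullFrame L₀ V (dataOf L₀ f N₁ N₂) (nullFrame L₀ f N₁ N₂) := by
  have hD := hf.isSmoothOn hV hN
  have hd : ∀ {W : ℝ × ℝ → Fin 5 → ℝ}, ContDiffOn ℝ ∞ W V → ∀ {x}, x ∈ V →
      DifferentiableAt ℝ W x := fun h _ hx => differentiableAt_of_contDiffOn hV h hx
  have s1 : ContDiffOn ℝ ∞ (du f) V := contDiffOn_dd hV hf.smooth _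
  have s2 : ContDiffOn ℝ ∞ (dv f) V := contDiffOn_dd hV hf.smooth _
  have hxi : ∀ x ∈ V, ∀ w, dd w (fun y => xi L₀ (f y)) x = (kap L₀ * L₀) • dd w f x := by
    intro x hx w
    unfold xi kap
    split_ifs with h0
    · simp [dd_const, h0]
    · simp [h0]
  -- scalar products with normal vectors may be computed with `form`
  have conv : ∀ {x}, x ∈ V → ∀ {a b : Fin 5 → ℝ}, IsTangent L₀ (f x) b →
      form L₀ a b = bil (tau L₀) a b := fun _ _ _ hb =>
    form_eq_bil fun h0 => Or.inr (hb.apply_four h0)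
  have hwp : dd wp f = fun y => du f y + dv f y := funext fun y => dd_wp f y
  have hwm : dd wm f = fun y => du f y - dv f y := funext fun y => dd_wm f y
  have second : ∀ x ∈ V,
      dd wp (dd wp f) x = du (du f) x + (2 : ℝ) • du (dv f) x + dv (dv f) x ∧
      dd wp (dd wm f) x = du (du f) x - dv (dv f) x ∧
      dd wm (dd wm f) x = du (du f) x - (2 : ℝ) • du (dv f) x + dv (dv f) x := by
    intro x hx
    have hc : dv (du f) x = du (dv f) x := dd_comm hV hf.smooth hx _ _
    have a1 := hd s1 hx
    have a2 := hd s2 hx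
    rw [hwp, hwm]
    simp only [dd_add a1 a2, dd_sub a1 a2, dd_wp, dd_wm, hc]
    refine ⟨?_, ?_, ?_⟩ <;> module
  have normalD : ∀ x ∈ V, ∀ w (m : ℝ),
      form L₀ (dd w N₁ x - (L₀ * form L₀ (dd w N₁ x) (f x)) • f x) (N₂ x)
        / form L₀ (N₂ x) (N₂ x) = m →
      bil (tau L₀) (dd w N₁ x) (N₁ x)
        = (dataOf L₀ f N₁ N₂).ee x * dd w (dataOf L₀ f N₁ N₂).lam x ∧
      bil (tau L₀) (dd w N₂ x) (N₂ x)
        = -((dataOf L₀ f N₁ N₂).ee x * dd w (dataOf L₀ f N₁ N₂).lam x) ∧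
      bil (tau L₀) (dd w N₁ x) (N₂ x) = -((dataOf L₀ f N₁ N₂).ee x * m) ∧
      bil (tau L₀) (dd w N₂ x) (N₁ x) = (dataOf L₀ f N₁ N₂).ee x * m := by
    intro x hx w m hm
    have b1 := hd hN.smooth₁ hx
    have b2 := hd hN.smooth₂ hx
    have hl := hd (W := fun x => du f x) s1 hx
    have hlam := differentiableAt_of_contDiffOn hV hD.lam hx
    have hE := hf.pos x hx
    have c11 : EqOn (fun y => bil (tau L₀) (N₁ y) (N₁ y)) (dataOf L₀ f N₁ N₂).ee V := by
      intro y hy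
      simp only
      rw [hf.ee_eq hy, ← hN.norm₁ y hy, conv hy (hN.tangent₁ y hy)]
    have c22 : EqOn (fun y => bil (tau L₀) (N₂ y) (N₂ y))
        (fun y => -(dataOf L₀ f N₁ N₂).ee y) V := by
      intro y hy
      simp only
      rw [hf.ee_eq hy, ← hN.norm₂ y hy, conv hy (hN.tangent₂ y hy)]
    have c12 : EqOn (fun y => bil (tau L₀) (N₁ y) (N₂ y)) (fun y => 0) V := by
      intro y hy
      simp only
      rw [← hN.orth y hy, conv hy (hN.tangent₂ y hy)]
    have d11 := dd_bil (tau L₀) b1 b1 w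
    have d22 := dd_bil (tau L₀) b2 b2 w
    have d12 := dd_bil (tau L₀) b1 b2 w
    rw [dd_congr hV c11 hx, Data.dd_ee hlam, bil_comm _ (N₁ x)] at d11
    rw [dd_congr hV c22 hx, dd_neg, Data.dd_ee hlam, bil_comm _ (N₂ x)] at d22
    rw [dd_congr hV c12 hx, dd_const, bil_comm _ (N₁ x)] at d12
    have key : bil (tau L₀) (dd w N₁ x) (N₂ x) = -((dataOf L₀ f N₁ N₂).ee x * m) := by
      rw [← hm, hN.norm₂ x hx, hf.ee_eq hx, ← conv hx (hN.tangent₂ x hx)]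
      have ht := (hN.tangent₂ x hx).mul_form
      simp only [form_eq_bil_sign, bil_sub_left, bil_smul_left] at ht hE ⊢
      rw [bil_comm _ (f x)]
      field_simp
      linear_combination (bil L₀.sign (dd w N₁ x) (f x)) * ht
    refine ⟨by linarith, by linarith, key, by linarith⟩
  have smooth : ∀ i, ContDiffOn ℝ ∞ (nullFrame L₀ f N₁ N₂ i) V := by
    intro i
    fin_cases i
    · exact contDiffOn_dd hV hf.smooth _
    · exact contDiffOn_dd hV hf.smooth _
    · exact hN.smooth₁.add hN.smooth₂
    · exact hN.smooth₁.sub hN.smooth₂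
    · exact contDiffOn_xi hf.smooth
  refine IsNullFrame.of_coeffs hV hD.lam smooth (fun x hx => hf.gram hV hN hx)
    (fun x hx => dd_comm hV hf.smooth hx _ _) (fun x hx => hxi x hx _) (fun x hx => hxi x hx _)
    (fun x hx => ?_) (fun x hx => ?_)
  · obtain ⟨c1, c2, c3, c4, c5, c6⟩ := hf.second_coeffs hN hx
    have t1 := hN.tangent₁ x hx
    have t2 := hN.tangent₂ x hx
    rw [conv hx t1] at c1 c2 c3
    rw [conv hx t2] at c4 c5 c6
    obtain ⟨u1, u2, u3, u4⟩ := normalD x hx (1, 0) ((dataOf L₀ f N₁ N₂).μ₁ x) rfl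
    obtain ⟨v1, v2, v3, v4⟩ := normalD x hx (0, 1) ((dataOf L₀ f N₁ N₂).μ₂ x) rfl
    obtain ⟨q1, q2, q3⟩ := second x hx
    simp only [du_eq_dd, dv_eq_dd] at c1 c2 c3 c4 c5 c6 q1 q2 q3
    simp only [nullFrame, Matrix.cons_val, q1, q2, dd_add (hd hN.smooth₁ hx) (hd hN.smooth₂ hx),
      dd_wp, bil_add_left, bil_add_right, bil_sub_left, bil_sub_right, bil_smul_left, c1, c2, c3,
      c4, c5, c6, du_eq_dd, dv_eq_dd, u1, u2, u3, u4, v1, v2, v3, v4]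
    simp only [Data.cA, Data.cB, Data.Xp, Data.Yp, Data.Xm, Data.Ym, Data.mp]
    refine ⟨?_, ?_, ?_, ?_, ?_⟩ <;> ring
  · obtain ⟨c1, c2, c3, c4, c5, c6⟩ := hf.second_coeffs hN hx
    have t1 := hN.tangent₁ x hx
    have t2 := hN.tangent₂ x hx
    rw [conv hx t1] at c1 c2 c3
    rw [conv hx t2] at c4 c5 c6
    obtain ⟨u1, u2, u3, u4⟩ := normalD x hx (1, 0) ((dataOf L₀ f N₁ N₂).μ₁ x) rfl
    obtain ⟨v1, v2, v3, v4⟩ := normalD x hx (0, 1) ((dataOf L₀ f N₁ N₂).μ₂ x) rfl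
    obtain ⟨q1, q2, q3⟩ := second x hx
    simp only [du_eq_dd, dv_eq_dd] at c1 c2 c3 c4 c5 c6 q1 q2 q3
    simp only [nullFrame, Matrix.cons_val, q3, dd_add (hd hN.smooth₁ hx) (hd hN.smooth₂ hx),
      dd_wm, bil_add_left, bil_add_right, bil_sub_left, bil_sub_right, bil_smul_left, c1, c2, c3,
      c4, c5, c6, du_eq_dd, dv_eq_dd, u1, u2, u3, u4, v1, v2, v3, v4]
    simp only [Data.cC, Data.cD, Data.Xp, Data.Yp, Data.Xm, Data.Ym, Data.mm]
    refine ⟨?_, ?_, ?_⟩ <;> ring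

end Surface

/-! ### Flatness and the Gauss, Codazzi and Ricci equations -/

/-- The integrability condition `∂₋∂₊ W = ∂₊∂₋ W` of the structure equations
`∂₊ W = M₊ W`, `∂₋ W = M₋ W`. -/
def Data.IsFlatAt (D : Data) (L₀ c : ℝ) (x : ℝ × ℝ) : Prop :=
  ∀ i j, dd wm (fun y => D.mPlus y L₀ c i j) x + (D.mPlus x L₀ c * D.mMinus x L₀ c) i j
    = dd wp (fun y => D.mMinus y L₀ c i j) x + (D.mMinus x L₀ c * D.mPlus x L₀ c) i j

/-- The Gauss, Codazzi and Ricci equations for a surface with `X₋ = Y₋`. -/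
structure Data.GCR (D : Data) (L₀ : ℝ) (x : ℝ × ℝ) : Prop where
  codazzi_A : dd wm D.cA x = -D.cA x * (dd wm D.lam x + D.mm x)
  codazzi_B : dd wm D.cB x = -D.cB x * (dd wm D.lam x - D.mm x)
  codazzi_C : dd wp D.cC x = -D.cC x * (dd wp D.lam x - D.mp x)
  gauss : 2 * dd wm (dd wp D.lam) x = D.cA x * D.cC x - 2 * L₀ * D.ee x
  ricci : dd wm D.mp x - dd wp D.mm x = -(D.cA x * D.cC x)

section

variable {L₀ : ℝ} {V : Set (ℝ × ℝ)} {D : Data} {x : ℝ × ℝ}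

theorem Data.IsSmoothOn.mPlus (hV : IsOpen V) (hD : D.IsSmoothOn V) (L₀ c : ℝ) (i j : Fin 5) :
    ContDiffOn ℝ ∞ (fun y => D.mPlus y L₀ c i j) V := by
  have hl := contDiffOn_dd hV hD.lam wp
  have hA := hD.cA
  have hB := hD.cB
  have hm := hD.mp
  have hE := hD.ee
  fin_cases i <;> fin_cases j <;>
    simp only [Data.mPlus, Matrix.of_apply, Matrix.cons_val, Fin.zero_eta, Fin.mk_one,
      Fin.reduceFinMk] <;> fun_prop

theorem Data.IsSmoothOn.mMinus (hV : IsOpen V) (hD : D.IsSmoothOn V) (L₀ c : ℝ) (i j : Fin 5) :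
    ContDiffOn ℝ ∞ (fun y => D.mMinus y L₀ c i j) V := by
  have hl := contDiffOn_dd hV hD.lam wm
  have hC := hD.cC
  have hB := hD.cD
  have hm := hD.mm
  have hE := hD.ee
  fin_cases i <;> fin_cases j <;>
    simp only [Data.mMinus, Matrix.of_apply, Matrix.cons_val, Fin.zero_eta, Fin.mk_one,
      Fin.reduceFinMk] <;> fun_prop

/-- The existence of a null frame forces flatness. -/
theorem IsNullFrame.isFlatAt (hV : IsOpen V) (hD : D.IsSmoothOn V)
    {W : Fin 5 → ℝ × ℝ → Fin 5 → ℝ} (hW : IsNullFrame L₀ V D W) (hx : x ∈ V) :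
    D.IsFlatAt L₀ (kap L₀ * L₀) x := by
  set c := kap L₀ * L₀
  have hd := fun i => differentiableAt_of_contDiffOn hV (hW.smooth i) hx
  have hP := fun i j => differentiableAt_of_contDiffOn hV (hD.mPlus hV L₀ c i j) hx
  have hM := fun i j => differentiableAt_of_contDiffOn hV (hD.mMinus hV L₀ c i j) hx
  have sum_dd : ∀ (w : ℝ × ℝ) (g : Fin 5 → ℝ × ℝ → ℝ), (∀ j, DifferentiableAt ℝ (g j) x) →
      dd w (fun y => ∑ j, g j y • W j y) x
        = ∑ j, (dd w (g j) x • W j x + g j x • dd w (W j) x) := by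
    intro w g hg
    have h1 : ∀ j ∈ Finset.univ, DifferentiableAt ℝ (fun y => g j y • W j y) x :=
      fun j _ => (hg j).smul (hd j)
    have h2 := fderiv_fun_sum h1
    simp only [dd] at h2 ⊢
    rw [h2, sum_apply]
    exact Finset.sum_congr rfl fun j _ => dd_smul (hg j) (hd j) w
  intro i j
  have key : ∑ k, (dd wm (fun y => D.mPlus y L₀ c i k) x
        + (D.mPlus x L₀ c * D.mMinus x L₀ c) i k) • W k x
      = ∑ k, (dd wp (fun y => D.mMinus y L₀ c i k) x
        + (D.mMinus x L₀ c * D.mPlus x L₀ c) i k) • W k x := by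
    have e := dd_comm hV (hW.smooth i) hx wm wp
    rw [dd_congr hV (fun y hy => hW.plus y hy i) hx, dd_congr hV (fun y hy => hW.minus y hy i) hx,
      sum_dd _ _ (hP i), sum_dd _ _ (hM i)] at e
    simp only [hW.plus x hx, hW.minus x hx, Finset.sum_add_distrib] at e
    have swap : ∀ (a : Fin 5 → ℝ) (b : Fin 5 → Fin 5 → ℝ),
        ∑ k, (∑ l, a l * b l k) • W k x = ∑ l, a l • ∑ k, b l k • W k x := by
      intro a b
      simp only [Finset.sum_smul, Finset.smul_sum, mul_smul]
      exact Finset.sum_comm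
    simp only [add_smul, Finset.sum_add_distrib, Matrix.mul_apply]
    refine Eq.trans (congrArg _ (swap _ _)) (e.trans (congrArg _ (swap _ _)).symm)
  have he : 2 * D.ee x ≠ 0 := by have := D.ee_pos x; positivity
  have hg := hW.gram x hx
  -- pairing with the dual frame separates the coefficients
  have pair : ∀ a b : Fin 5 → ℝ, ∑ k, a k • W k x = ∑ k, b k • W k x → ∀ k, a k = b k := by
    intro a b hab k
    have h := fun l => congrArg (fun y => bil (tau L₀) y (W l x)) hab
    simp only [Fin.sum_univ_five, bil_add_left, bil_smul_left, hg] at h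
    have h0 := h 0
    have h1 := h 1
    have h2 := h 2
    have h3 := h 3
    have h4 := h 4
    simp only [nullGram, Matrix.of_apply, Matrix.cons_val, mul_zero, add_zero, zero_add]
      at h0 h1 h2 h3 h4
    have hk := kap_ne_zero L₀
    fin_cases k
    · exact mul_right_cancel₀ he h1
    · exact mul_right_cancel₀ he h0
    · exact mul_right_cancel₀ he h3
    · exact mul_right_cancel₀ he h2
    · exact mul_right_cancel₀ hk h4
  exact pair _ _ key j

theorem Data.IsFlatAt.gcr (hV : IsOpen V) (hD : D.IsSmoothOn V) (hx : x ∈ V)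
    (h : D.IsFlatAt L₀ (kap L₀ * L₀) x) (h0 : D.cD x = 0) : D.GCR L₀ x := by
  have e02 := h 0 2
  have e03 := h 0 3
  have e13 := h 1 3
  have e00 := h 0 0
  have e22 := h 2 2
  have dl := fun w => differentiableAt_of_contDiffOn hV (contDiffOn_dd hV hD.lam w) hx
  have dp := differentiableAt_of_contDiffOn hV hD.mp hx
  have dm := differentiableAt_of_contDiffOn hV hD.mm hx
  have hc := dd_comm hV hD.lam hx wm wp
  have hk := kap_mul_sq L₀
  simp only [Matrix.mul_apply, Fin.sum_univ_five, Data.mPlus, Data.mMinus, Matrix.of_apply,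
    Matrix.cons_val, dd_const, dd_const_mul _ (dl _), dd_add (dl _) dp, dd_add (dl _) dm, h0, hc]
    at e02 e03 e13 e00 e22
  refine ⟨by linarith, by linarith, by linarith, ?_, by linarith⟩
  rw [hc]
  linear_combination e00 - 2 * D.ee x * hk

theorem Data.GCR.isFlatAt (hV : IsOpen V) (hD : D.IsSmoothOn V) (hx : x ∈ V)
    (h : D.GCR L₀ x) (h0 : ∀ y ∈ V, D.cD y = 0) {c : ℝ} (hc : c * L₀ = L₀) :
    D.IsFlatAt L₀ c x := by
  have dl := fun w => differentiableAt_of_contDiffOn hV (contDiffOn_dd hV hD.lam w) hx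
  have dl0 := differentiableAt_of_contDiffOn hV hD.lam hx
  have dp := differentiableAt_of_contDiffOn hV hD.mp hx
  have dm := differentiableAt_of_contDiffOn hV hD.mm hx
  have dE := differentiableAt_of_contDiffOn hV hD.ee hx
  have hcm := dd_comm hV hD.lam hx wp wm
  have hz := h0 x hx
  have hz' : dd wp D.cD x = 0 := by rw [dd_congr (g := fun _ => 0) hV h0 hx, dd_const]
  have cA := h.codazzi_A
  have cB := h.codazzi_B
  have cC := h.codazzi_C
  have g := h.gauss
  have r := h.ricci
  intro i j
  fin_cases i <;> fin_cases j <;>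
    simp only [Matrix.mul_apply, Fin.sum_univ_five, Data.mPlus, Data.mMinus, Matrix.of_apply,
      Matrix.cons_val, Fin.zero_eta, Fin.mk_one, Fin.reduceFinMk, dd_const, dd_const_mul _ (dl _),
      dd_const_mul _ dE, dd_neg, dd_add (dl _) dp, dd_add (dl _) dm, dd_sub (dl _) dp,
      dd_sub (dl _) dm, hz, hz', hcm, Data.dd_ee dl0, cA, cB, cC] <;>
    first
    | ring1
    | linear_combination g + (2 * D.ee x) * hc
    | linear_combination -g - (2 * D.ee x) * hc
    | linear_combination r
    | linear_combination -r

end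

/-! ### Explicit data satisfy the Gauss, Codazzi and Ricci equations -/

theorem unit_mul_self (ε : ℤˣ) : ((ε : ℤ) : ℝ) * ((ε : ℤ) : ℝ) = 1 := by
  rcases Int.units_eq_one_or ε with h | h <;> simp [h]

section Explicit

variable {L₀ : ℝ} {V : Set (ℝ × ℝ)} {D D' : Data} {x : ℝ × ℝ}

/-- In the null directions, `μ₁ + μ₂` of the explicit data. -/
theorem explicitData_mp (ε ε' ε'' : ℤˣ) (P Q R : ℝ × ℝ → ℝ) (y : ℝ × ℝ) :
    (explicitData ε ε' ε'' P Q R).mp y = dd wp Q y - (dd wp P y + dd wp R y) / 2 := by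
  have : √2 * √2 = (2 : ℝ) := Real.mul_self_sqrt (by norm_num)
  have h2 : 1 / √2 * ds Q y = dd wp Q y / 2 := by
    rw [ds, dd_wp, div_mul_div_comm, one_mul, this]
  simp only [Data.mp, explicitData]
  rw [h2, dd_wp P, dd_wp R]
  ring

/-- In the null directions, `μ₁ - μ₂` of the explicit data. -/
theorem explicitData_mm (ε ε' ε'' : ℤˣ) (P Q R : ℝ × ℝ → ℝ) (y : ℝ × ℝ) :
    (explicitData ε ε' ε'' P Q R).mm y = (dd wm R y - dd wm P y) / 2 := by
  simp only [Data.mm, explicitData, dd_wm]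
  ring

theorem explicitData_cA (ε ε' ε'' : ℤˣ) (P Q R : ℝ × ℝ → ℝ) (y : ℝ × ℝ) :
    (explicitData ε ε' ε'' P Q R).cA y = ((ε' : ℤ) : ℝ) * Real.exp (P y) := by
  simp only [Data.cA, Data.Xp, Data.Yp, explicitData]; ring

theorem explicitData_cB (ε ε' ε'' : ℤˣ) (P Q R : ℝ × ℝ → ℝ) (y : ℝ × ℝ) :
    (explicitData ε ε' ε'' P Q R).cB y = ((ε'' : ℤ) : ℝ) * Real.exp (R y) := by
  simp only [Data.cB, Data.Xm, Data.Ym, explicitData]; ring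

theorem explicitData_cC (ε ε' ε'' : ℤˣ) (P Q R : ℝ × ℝ → ℝ) (y : ℝ × ℝ) :
    (explicitData ε ε' ε'' P Q R).cC y
      = ((ε' : ℤ) : ℝ) * ((ε : ℤ) : ℝ) * Real.exp (Q y) := by
  simp only [Data.cC, Data.Xp, Data.Yp, explicitData]; ring

theorem explicitData_cD (ε ε' ε'' : ℤˣ) (P Q R : ℝ × ℝ → ℝ) (y : ℝ × ℝ) :
    (explicitData ε ε' ε'' P Q R).cD y = 0 := by
  simp only [Data.cD, Data.Xm, Data.Ym, explicitData]; ring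

theorem explicitData_isSmoothOn (hV : IsOpen V) (ε ε' ε'' : ℤˣ) {P Q R : ℝ × ℝ → ℝ}
    (hP : ContDiffOn ℝ ∞ P V) (hQ : ContDiffOn ℝ ∞ Q V) (hR : ContDiffOn ℝ ∞ R V) :
    (explicitData ε ε' ε'' P Q R).IsSmoothOn V := by
  have p1 : ContDiffOn ℝ ∞ (du P) V := contDiffOn_dd hV hP _
  have p2 : ContDiffOn ℝ ∞ (dv P) V := contDiffOn_dd hV hP _
  have r1 : ContDiffOn ℝ ∞ (du R) V := contDiffOn_dd hV hR _
  have r2 : ContDiffOn ℝ ∞ (dv R) V := contDiffOn_dd hV hR _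
  have q : ContDiffOn ℝ ∞ (ds Q) V :=
    ((contDiffOn_dd hV hQ _).add (contDiffOn_dd hV hQ _)).div_const _
  constructor <;> simp only [explicitData] <;> fun_prop

/-- The semilinear hyperbolic system is what is left of the Gauss and Ricci equations; the Codazzi
equations hold because of the form of `λ`, `μ₁`, `μ₂`. -/
theorem explicitData_gcr (hV : IsOpen V) {ε : ℤˣ} (ε' ε'' : ℤˣ) {f₁ f₂ P Q R : ℝ × ℝ → ℝ}
    (hP : ContDiffOn ℝ ∞ P V) (hQ : ContDiffOn ℝ ∞ Q V) (hR : ContDiffOn ℝ ∞ R V)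
    (h₁ : ContDiffOn ℝ ∞ f₁ V) (h₂ : ContDiffOn ℝ ∞ f₂ V)
    (e₁ : ∀ x ∈ V, ds (dt f₁) x = L₀ * Real.exp (-f₁ x - f₂ x))
    (e₂ : ∀ x ∈ V, ds (dt f₂) x = -(((ε : ℤ) : ℝ) / 2) * Real.exp (f₁ x + 2 * f₂ x))
    (hf₁ : ∀ x ∈ V, f₁ x = P x - Q x + 2 * R x) (hf₂ : ∀ x ∈ V, f₂ x = Q x - R x)
    (hx : x ∈ V) : (explicitData ε ε' ε'' P Q R).GCR L₀ x := by
  set D := explicitData ε ε' ε'' P Q R with hD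
  have dP := differentiableAt_of_contDiffOn hV hP hx
  have dQ := differentiableAt_of_contDiffOn hV hQ hx
  have dR := differentiableAt_of_contDiffOn hV hR hx
  have dPw := fun w => differentiableAt_of_contDiffOn hV (contDiffOn_dd hV hP w) hx
  have dQw := fun w => differentiableAt_of_contDiffOn hV (contDiffOn_dd hV hQ w) hx
  have dRw := fun w => differentiableAt_of_contDiffOn hV (contDiffOn_dd hV hR w) hx
  have cP := dd_comm hV hP hx wp wm
  have cQ := dd_comm hV hQ hx wp wm
  have cR := dd_comm hV hR hx wp wm
  have lam : ∀ y ∈ V, ∀ w, dd w D.lam y = -(1 / 2) * (dd w P y + dd w R y) := by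
    intro y hy w
    have dP := differentiableAt_of_contDiffOn hV hP hy
    have dR := differentiableAt_of_contDiffOn hV hR hy
    have : D.lam = fun y => -(1 / 2) * (P y + R y) := rfl
    rw [this, dd_const_mul _ (dP.fun_add dR), dd_add dP dR]
  have hA : D.cA = fun y => ((ε' : ℤ) : ℝ) * Real.exp (P y) := funext (explicitData_cA _ _ _ _ _ _)
  have hB : D.cB = fun y => ((ε'' : ℤ) : ℝ) * Real.exp (R y) :=
    funext (explicitData_cB _ _ _ _ _ _)
  have hC : D.cC = fun y => ((ε' : ℤ) : ℝ) * ((ε : ℤ) : ℝ) * Real.exp (Q y) :=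
    funext (explicitData_cC _ _ _ _ _ _)
  have hmp : D.mp = fun y => dd wp Q y - (1 / 2) * (dd wp P y + dd wp R y) := by
    funext y; rw [hD, explicitData_mp]; ring
  have hmm : D.mm = fun y => (1 / 2) * (dd wm R y - dd wm P y) := by
    funext y; rw [hD, explicitData_mm]; ring
  have second : ∀ w, dd w (fun y => dd wp P y + dd wp R y) x
      = dd w (dd wp P) x + dd w (dd wp R) x := fun w => dd_add (dPw _) (dRw _) w
  have gauss_rhs : D.cA x * D.cC x = ((ε : ℤ) : ℝ) * Real.exp (P x + Q x) := by
    rw [hA, hC, Real.exp_add]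
    linear_combination (((ε : ℤ) : ℝ) * Real.exp (P x) * Real.exp (Q x)) * unit_mul_self ε'
  have E₁ := e₁ x hx
  have E₂ := e₂ x hx
  rw [ds_dt_eq hV h₁ hx, hf₁ x hx, hf₂ x hx] at E₁
  rw [ds_dt_eq hV h₂ hx, hf₁ x hx, hf₂ x hx] at E₂
  have F₁ : dd wp (dd wm f₁) x = dd wm (dd wp P) x - dd wm (dd wp Q) x + 2 * dd wm (dd wp R) x := by
    have : EqOn (dd wm f₁) (fun y => dd wm P y - dd wm Q y + 2 * dd wm R y) V := by
      intro y hy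
      have a := differentiableAt_of_contDiffOn hV hP hy
      have b := differentiableAt_of_contDiffOn hV hQ hy
      have c := differentiableAt_of_contDiffOn hV hR hy
      simp only
      rw [dd_congr (g := fun y => (P y - Q y) + 2 * R y) hV hf₁ hy,
        dd_add (a.fun_sub b) (c.const_mul 2), dd_sub a b, dd_const_mul 2 c]
    rw [dd_congr hV this hx, dd_add ((dPw _).fun_sub (dQw _)) ((dRw _).const_mul 2),
      dd_sub (dPw _) (dQw _), dd_const_mul 2 (dRw _), cP, cQ, cR]
  have F₂ : dd wp (dd wm f₂) x = dd wm (dd wp Q) x - dd wm (dd wp R) x := by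
    have : EqOn (dd wm f₂) (fun y => dd wm Q y - dd wm R y) V := by
      intro y hy
      have b := differentiableAt_of_contDiffOn hV hQ hy
      have c := differentiableAt_of_contDiffOn hV hR hy
      simp only
      rw [dd_congr (g := fun y => Q y - R y) hV hf₂ hy, dd_sub b c]
    rw [dd_congr hV this hx, dd_sub (dQw _) (dRw _), cQ, cR]
  rw [F₁] at E₁
  rw [F₂] at E₂
  have x₁ : -(P x - Q x + 2 * R x) - (Q x - R x) = 2 * D.lam x := by
    rw [hD]; simp only [explicitData]; ring
  have x₂ : P x - Q x + 2 * R x + 2 * (Q x - R x) = P x + Q x := by ring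
  rw [x₁] at E₁
  rw [x₂] at E₂
  have hee : D.ee x = Real.exp (2 * D.lam x) := rfl
  refine ⟨?_, ?_, ?_, ?_, ?_⟩
  · rw [lam x hx, hA, hmm, dd_const_mul _ dP.exp, dd_exp dP]; ring
  · rw [lam x hx, hB, hmm, dd_const_mul _ dR.exp, dd_exp dR]; ring
  · rw [lam x hx, hC, hmp, dd_const_mul _ dQ.exp, dd_exp dQ]; ring
  · rw [dd_congr hV (fun y hy => lam y hy wp) hx, dd_const_mul _ ((dPw _).fun_add (dRw _)), second,
      gauss_rhs, hee]
    linarith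
  · rw [hmp, hmm, dd_sub (dQw _) (((dPw _).fun_add (dRw _)).const_mul _),
      dd_const_mul _ ((dPw _).fun_add (dRw _)), second, dd_const_mul _ ((dRw _).fun_sub (dPw _)),
      dd_sub (dRw _) (dPw _), gauss_rhs, cP, cR]
    linarith

end Explicit

/-! ### Solving the structure equations -/

/-- The Frobenius theorem in the plane, in terms of the derivatives in the null directions. -/
theorem exists_planar_solution {F : Type*} [NormedAddCommGroup F] [NormedSpace ℝ F]
    [CompleteSpace F] {A B : ℝ × ℝ → F →L[ℝ] F} {U : Set (ℝ × ℝ)} (hU : IsOpen U)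
    (hA : ContDiffOn ℝ ∞ A U) (hB : ContDiffOn ℝ ∞ B U)
    (flat : ∀ x ∈ U, dd wm A x + (A x).comp (B x) = dd wp B x + (B x).comp (A x))
    {p : ℝ × ℝ} (hp : p ∈ U) :
    ∃ δ : ℝ, 0 < δ ∧ Metric.ball p δ ⊆ U ∧ ∀ w₀ : F, ∃ w : ℝ × ℝ → F, w p = w₀ ∧
      ContDiffOn ℝ ∞ w (Metric.ball p δ) ∧
      ∀ x ∈ Metric.ball p δ, dd wp w x = A x (w x) ∧ dd wm w x = B x (w x) := by
  set lp : ℝ × ℝ →L[ℝ] ℝ :=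
    (1 / 2 : ℝ) • (ContinuousLinearMap.fst ℝ ℝ ℝ + ContinuousLinearMap.snd ℝ ℝ ℝ) with hlp
  set lm : ℝ × ℝ →L[ℝ] ℝ :=
    (1 / 2 : ℝ) • (ContinuousLinearMap.fst ℝ ℝ ℝ - ContinuousLinearMap.snd ℝ ℝ ℝ) with hlm
  have hpp : lp wp = 1 := by simp [hlp]; norm_num
  have hpm : lp wm = 0 := by simp [hlp]
  have hmp : lm wp = 0 := by simp [hlm]
  have hmm : lm wm = 1 := by simp [hlm]; norm_num
  have hlpa : ∀ a, lp a = (a.1 + a.2) / 2 := fun a => by simp [hlp]; ring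
  have hlma : ∀ a, lm a = (a.1 - a.2) / 2 := fun a => by simp [hlm]; ring
  set Ω : ℝ × ℝ → ℝ × ℝ →L[ℝ] F →L[ℝ] F := fun x => lp.smulRight (A x) + lm.smulRight (B x)
    with hΩ
  have sΩ : ContDiffOn ℝ ∞ Ω U :=
    (contDiffOn_const.smulRight hA).add (contDiffOn_const.smulRight hB)
  have dΩ : ∀ x ∈ U, ∀ a b, fderiv ℝ Ω x a b
      = lp b • (lp a • dd wp A x + lm a • dd wm A x)
        + lm b • (lp a • dd wp B x + lm a • dd wm B x) := by
    intro x hx a b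
    have d1 := differentiableAt_of_contDiffOn hU sΩ hx
    have d2 := differentiableAt_of_contDiffOn hU hA hx
    have d3 := differentiableAt_of_contDiffOn hU hB hx
    have e1 := (d1.hasFDerivAt.clm_apply (hasFDerivAt_const b x)).fderiv
    have e2 : (fun y => Ω y b) = fun y => lp b • A y + lm b • B y := by
      funext y; simp [hΩ]
    have e3 := ((d2.hasFDerivAt.const_smul (lp b)).add (d3.hasFDerivAt.const_smul (lm b))).fderiv
    have e4 : fderiv ℝ (fun y => Ω y b) x a = fderiv ℝ Ω x a b := by rw [e1]; simp
    rw [← e4, e2]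
    have e5 := congrArg (fun T => T a) e3
    refine e5.trans ?_
    simp only [add_apply, smul_apply, fderiv_apply_eq_dd A x a,
      fderiv_apply_eq_dd B x a, hlpa a, hlma a]
  obtain ⟨δ, hδ, hsub, hsol⟩ := exists_solution_of_flat hU (contDiffOn_infty.1 sΩ 2)
    (fun x hx a b => by
      rw [dΩ x hx, dΩ x hx]
      have h := flat x hx
      have h' : dd wm A x = dd wp B x + (B x).comp (A x) - (A x).comp (B x) := by
        rw [← h]; abel
      ext v
      simp only [hΩ, h', add_apply, sub_apply, smul_apply, ContinuousLinearMap.comp_apply,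
        ContinuousLinearMap.smulRight_apply, map_add, map_smul]
      module) hp
  refine ⟨δ, hδ, hsub, fun w₀ => ?_⟩
  obtain ⟨w, hw0, hw⟩ := hsol w₀
  refine ⟨w, hw0, contDiffOn_of_solution Metric.isOpen_ball (sΩ.mono hsub) hw, fun x hx => ?_⟩
  simp only [dd, (hw x hx).fderiv, hΩ, ContinuousLinearMap.flip_apply, add_apply,
    ContinuousLinearMap.smulRight_apply, hpp, hpm, hmp, hmm, one_smul, zero_smul, add_zero,
    zero_add]
  simp

/-- A matrix as a continuous linear map, depending linearly on the entries. -/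
def mulVecCLM : (Fin 5 → Fin 5 → ℝ) →L[ℝ] (Fin 5 → ℝ) →L[ℝ] (Fin 5 → ℝ) :=
  LinearMap.toContinuousLinearMap
    { toFun := fun M => LinearMap.toContinuousLinearMap (Matrix.mulVecLin (Matrix.of M))
      map_add' := fun M N => by
        ext v i; simp [Matrix.mulVec, dotProduct, add_mul, Finset.sum_add_distrib]
      map_smul' := fun a M => by
        ext v i; simp [Matrix.mulVec, dotProduct, Finset.mul_sum, mul_assoc] }

theorem mulVecCLM_apply (M : Fin 5 → Fin 5 → ℝ) (v : Fin 5 → ℝ) (i : Fin 5) :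
    mulVecCLM M v i = ∑ j, M i j * v j := rfl

/-- Flat structure equations have local solutions with any initial frame. -/
theorem Data.exists_frame {L₀ c : ℝ} {U : Set (ℝ × ℝ)} (hU : IsOpen U) {D : Data}
    (hD : D.IsSmoothOn U) (flat : ∀ x ∈ U, D.IsFlatAt L₀ c x) {p : ℝ × ℝ} (hp : p ∈ U) :
    ∃ δ : ℝ, 0 < δ ∧ Metric.ball p δ ⊆ U ∧ ∀ W₀ : Fin 5 → Fin 5 → ℝ,
      ∃ W : Fin 5 → ℝ × ℝ → Fin 5 → ℝ, (∀ i, W i p = W₀ i) ∧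
      (∀ i, ContDiffOn ℝ ∞ (W i) (Metric.ball p δ)) ∧
      ∀ x ∈ Metric.ball p δ, ∀ i, dd wp (W i) x = ∑ j, D.mPlus x L₀ c i j • W j x ∧
        dd wm (W i) x = ∑ j, D.mMinus x L₀ c i j • W j x := by
  set A : ℝ × ℝ → Fin 5 → Fin 5 → ℝ := fun x i j => D.mPlus x L₀ c i j
  set B : ℝ × ℝ → Fin 5 → Fin 5 → ℝ := fun x i j => D.mMinus x L₀ c i j
  have sA : ContDiffOn ℝ ∞ A U :=
    contDiffOn_pi.2 fun i => contDiffOn_pi.2 fun j => hD.mPlus hU L₀ c i j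
  have sB : ContDiffOn ℝ ∞ B U :=
    contDiffOn_pi.2 fun i => contDiffOn_pi.2 fun j => hD.mMinus hU L₀ c i j
  have hdd : ∀ {M : ℝ × ℝ → Fin 5 → Fin 5 → ℝ}, ContDiffOn ℝ ∞ M U → ∀ x ∈ U, ∀ w,
      dd w (fun y => mulVecCLM (M y)) x = mulVecCLM (dd w M x) := by
    intro M hM x hx w
    have := differentiableAt_of_contDiffOn hU hM hx
    exact congrArg (fun T => T w) ((mulVecCLM.hasFDerivAt.comp x this.hasFDerivAt).fderiv)
  have hentry : ∀ {M : ℝ × ℝ → Fin 5 → Fin 5 → ℝ}, ContDiffOn ℝ ∞ M U → ∀ x ∈ U, ∀ w i j,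
      dd w M x i j = dd w (fun y => M y i j) x := by
    intro M hM x hx w i j
    have h1 := differentiableAt_of_contDiffOn hU hM hx
    have h2 := hasFDerivAt_pi'.1 (hasFDerivAt_pi'.1 h1.hasFDerivAt i) j
    simp [dd, h2.fderiv]
  obtain ⟨δ, hδ, hsub, hsol⟩ := exists_planar_solution hU (A := fun x => mulVecCLM (A x))
    (B := fun x => mulVecCLM (B x)) (mulVecCLM.contDiff.comp_contDiffOn sA)
    (mulVecCLM.contDiff.comp_contDiffOn sB) (fun x hx => by
      rw [hdd sA x hx, hdd sB x hx]
      have swap : ∀ (M N : Fin 5 → Fin 5 → ℝ) (v : Fin 5 → ℝ) (i : Fin 5),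
          ∑ j, M i j * ∑ k, N j k * v k = ∑ k, (∑ j, M i j * N j k) * v k := by
        intro M N v i
        simp only [Finset.mul_sum, Finset.sum_mul, mul_assoc]
        exact Finset.sum_comm
      ext v i
      simp only [add_apply, Pi.add_apply, ContinuousLinearMap.comp_apply, mulVecCLM_apply, swap,
        hentry sA x hx, hentry sB x hx, ← Finset.sum_add_distrib, ← add_mul]
      refine Finset.sum_congr rfl fun k _ => ?_
      congr 1
      exact flat x hx i k) hp
  refine ⟨δ, hδ, hsub, fun W₀ => ?_⟩
  choose w hw0 hws hw using fun k => hsol fun i => W₀ i k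
  refine ⟨fun i x k => w k x i, fun i => funext fun k => congrFun (hw0 k) i, fun i => ?_,
    fun x hx i => ?_⟩
  · exact contDiffOn_pi.2 fun k => contDiffOn_pi.1 (hws k) i
  · have d1 : ∀ k, DifferentiableAt ℝ (w k) x := fun k =>
      differentiableAt_of_contDiffOn Metric.isOpen_ball (hws k) hx
    have d2 : DifferentiableAt ℝ (fun y k => w k y i) x :=
      differentiableAt_pi.2 fun k => differentiableAt_pi.1 (d1 k) i
    constructor <;> ext k
    · rw [dd_pi d2, ← dd_pi (d1 k), (hw k x hx).1, mulVecCLM_apply]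
      simp [A]
    · rw [dd_pi d2, ← dd_pi (d1 k), (hw k x hx).2, mulVecCLM_apply]
      simp [B]

/-- For two solutions of the structure equations, the contraction `Wᵀ G⁻¹ W'` with the inverse of
the Gram matrix is constant. This yields both the scalar products of a solution and its uniqueness
up to a linear map. -/
theorem dual_const {L₀ : ℝ} {V : Set (ℝ × ℝ)} (hV : IsOpen V) (hVc : IsPreconnected V) {D : Data}
    (hD : ContDiffOn ℝ ∞ D.lam V) {W W' : Fin 5 → ℝ × ℝ → Fin 5 → ℝ}
    (s : ∀ i, ContDiffOn ℝ ∞ (W i) V) (s' : ∀ i, ContDiffOn ℝ ∞ (W' i) V)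
    (plus : ∀ x ∈ V, ∀ i, dd wp (W i) x = ∑ j, D.mPlus x L₀ (kap L₀ * L₀) i j • W j x)
    (minus : ∀ x ∈ V, ∀ i, dd wm (W i) x = ∑ j, D.mMinus x L₀ (kap L₀ * L₀) i j • W j x)
    (plus' : ∀ x ∈ V, ∀ i, dd wp (W' i) x = ∑ j, D.mPlus x L₀ (kap L₀ * L₀) i j • W' j x)
    (minus' : ∀ x ∈ V, ∀ i, dd wm (W' i) x = ∑ j, D.mMinus x L₀ (kap L₀ * L₀) i j • W' j x)
    {x y : ℝ × ℝ} (hx : x ∈ V) (hy : y ∈ V) :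
    (Matrix.of fun i => W i x).transpose * nullGram (2 * D.ee x)⁻¹ (kap L₀)⁻¹
        * (Matrix.of fun i => W' i x)
      = (Matrix.of fun i => W i y).transpose * nullGram (2 * D.ee y)⁻¹ (kap L₀)⁻¹
        * (Matrix.of fun i => W' i y) := by
  ext k l
  have entry : ∀ z, ((Matrix.of fun i => W i z).transpose * nullGram (2 * D.ee z)⁻¹ (kap L₀)⁻¹
        * (Matrix.of fun i => W' i z)) k l
      = (1 / 2) * (Real.exp (-2 * D.lam z) * (W 0 z k * W' 1 z l + W 1 z k * W' 0 z l
        + (W 2 z k * W' 3 z l + W 3 z k * W' 2 z l))) + (kap L₀)⁻¹ * (W 4 z k * W' 4 z l) := by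
    intro z
    have h1 : (2 * D.ee z)⁻¹ = 1 / 2 * Real.exp (-2 * D.lam z) := by
      rw [mul_inv, Data.ee, ← Real.exp_neg]; congr 2 <;> ring
    simp only [Matrix.mul_apply, Fin.sum_univ_five, nullGram, Matrix.of_apply,
      Matrix.transpose_apply, Matrix.cons_val, h1]
    ring
  rw [entry, entry]
  set φ : ℝ × ℝ → ℝ := fun z =>
    (1 / 2) * (Real.exp (-2 * D.lam z) * (W 0 z k * W' 1 z l + W 1 z k * W' 0 z l
        + (W 2 z k * W' 3 z l + W 3 z k * W' 2 z l))) + (kap L₀)⁻¹ * (W 4 z k * W' 4 z l) with hφ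
  have se := fun i => contDiffOn_pi.1 (s i) k
  have se' := fun i => contDiffOn_pi.1 (s' i) l
  have e0 : ContDiffOn ℝ ∞ (fun z => Real.exp (-2 * D.lam z)) V :=
    (contDiffOn_const.mul hD).exp
  have sφ : ContDiffOn ℝ ∞ φ V :=
    (contDiffOn_const.mul (e0.mul ((((se 0).mul (se' 1)).add ((se 1).mul (se' 0))).add
      (((se 2).mul (se' 3)).add ((se 3).mul (se' 2)))))).add
      (contDiffOn_const.mul ((se 4).mul (se' 4)))
  have dφ : ∀ z ∈ V, ∀ w, dd w φ z = (1 / 2) * ((Real.exp (-2 * D.lam z) * (-2 * dd w D.lam z))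
        * (W 0 z k * W' 1 z l + W 1 z k * W' 0 z l
        + (W 2 z k * W' 3 z l + W 3 z k * W' 2 z l)) + Real.exp (-2 * D.lam z) *
        ((dd w (W 0) z k * W' 1 z l + W 0 z k * dd w (W' 1) z l)
        + (dd w (W 1) z k * W' 0 z l + W 1 z k * dd w (W' 0) z l)
        + ((dd w (W 2) z k * W' 3 z l + W 2 z k * dd w (W' 3) z l)
        + (dd w (W 3) z k * W' 2 z l + W 3 z k * dd w (W' 2) z l))))
        + (kap L₀)⁻¹ * (dd w (W 4) z k * W' 4 z l + W 4 z k * dd w (W' 4) z l) := by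
    intro z hz w
    have d := fun i => differentiableAt_of_contDiffOn hV (se i) hz
    have d' := fun i => differentiableAt_of_contDiffOn hV (se' i) hz
    have dv := fun i => differentiableAt_of_contDiffOn hV (s i) hz
    have dv' := fun i => differentiableAt_of_contDiffOn hV (s' i) hz
    have dl := differentiableAt_of_contDiffOn hV hD hz
    have m := fun i j => (d i).fun_mul (d' j)
    have a1 := (m 0 1).fun_add (m 1 0)
    have a2 := (m 2 3).fun_add (m 3 2)
    have b := (dl.const_mul (-2)).exp
    rw [hφ, dd_add ((b.fun_mul (a1.fun_add a2)).const_mul _) ((m 4 4).const_mul _),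
      dd_const_mul _ (b.fun_mul (a1.fun_add a2)), dd_const_mul _ (m 4 4),
      dd_mul b (a1.fun_add a2), dd_exp (dl.const_mul (-2)), dd_const_mul _ dl, dd_add a1 a2,
      dd_add (m 0 1) (m 1 0), dd_add (m 2 3) (m 3 2)]
    simp only [dd_mul (d _) (d' _), dd_pi (dv _), dd_pi (dv' _)]
  have hk := kap_ne_zero L₀
  have hE : ∀ z, Real.exp (-(2 * D.lam z)) * D.ee z = 1 := fun z => by
    rw [Data.ee, ← Real.exp_add]; simp
  refine hV.is_const_of_fderiv_eq_zero (𝕜 := ℝ) (f := φ) hVc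
    (sφ.differentiableOn (by simp)) (fun z hz => ?_) hx hy
  have hz0 : dd wp φ z = 0 ∧ dd wm φ z = 0 := by
    constructor
    · rw [dφ z hz]
      simp only [plus z hz, plus' z hz, Fin.sum_univ_five, Data.mPlus, Matrix.of_apply,
        Matrix.cons_val, Pi.add_apply, Pi.smul_apply, smul_eq_mul]
      field_simp
      linear_combination (-2 * kap L₀ * L₀ * (W' 0 z l * W 4 z k + W 0 z k * W' 4 z l)) * hE z
    · rw [dφ z hz]
      simp only [minus z hz, minus' z hz, Fin.sum_univ_five, Data.mMinus, Matrix.of_apply,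
        Matrix.cons_val, Pi.add_apply, Pi.smul_apply, smul_eq_mul]
      field_simp
      linear_combination (-2 * kap L₀ * L₀ * (W' 1 z l * W 4 z k + W 1 z k * W' 4 z l)) * hE z
  refine ContinuousLinearMap.ext fun h => ?_
  rw [fderiv_apply_eq_dd, hz0.1, hz0.2]
  simp

/-! ### From solutions of the structure equations to surfaces -/

/-- A solution of the structure equations that is a null frame at one point is one everywhere. -/
theorem IsNullFrame.of_solution {L₀ : ℝ} {V : Set (ℝ × ℝ)} (hV : IsOpen V)
    (hVc : IsPreconnected V) {D : Data} (hD : ContDiffOn ℝ ∞ D.lam V)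
    {W : Fin 5 → ℝ × ℝ → Fin 5 → ℝ} (s : ∀ i, ContDiffOn ℝ ∞ (W i) V)
    (plus : ∀ x ∈ V, ∀ i, dd wp (W i) x = ∑ j, D.mPlus x L₀ (kap L₀ * L₀) i j • W j x)
    (minus : ∀ x ∈ V, ∀ i, dd wm (W i) x = ∑ j, D.mMinus x L₀ (kap L₀ * L₀) i j • W j x)
    {p : ℝ × ℝ} (hp : p ∈ V)
    (gram : ∀ i j, bil (tau L₀) (W i p) (W j p) = nullGram (2 * D.ee p) (kap L₀) i j) :
    IsNullFrame L₀ V D W := by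
  have he : ∀ x, 2 * D.ee x ≠ 0 := fun x => by have := D.ee_pos x; positivity
  refine ⟨s, fun x hx => ?_, plus, minus⟩
  rw [gram_iff_matrix _ _ _ fun i => W i x,
    gram_iff_dual (tau_mul_self L₀) (he x) (kap_ne_zero L₀),
    dual_const hV hVc hD s s plus minus plus minus hx hp,
    ← gram_iff_dual (tau_mul_self L₀) (he p) (kap_ne_zero L₀), ← gram_iff_matrix]
  exact gram

theorem Data.AgreeOn.symm {V : Set (ℝ × ℝ)} {D D' : Data} (h : D.AgreeOn V D') :
    D'.AgreeOn V D := fun x hx =>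
  ⟨(h x hx).1.symm, (h x hx).2.1.symm, (h x hx).2.2.1.symm, (h x hx).2.2.2.1.symm,
    (h x hx).2.2.2.2.1.symm, (h x hx).2.2.2.2.2.1.symm, (h x hx).2.2.2.2.2.2.symm⟩

theorem IsNullFrame.congr {L₀ : ℝ} {V : Set (ℝ × ℝ)} (hV : IsOpen V) {D D' : Data}
    (h : D.AgreeOn V D') {W : Fin 5 → ℝ × ℝ → Fin 5 → ℝ} (hW : IsNullFrame L₀ V D W) :
    IsNullFrame L₀ V D' W := by
  have hl : EqOn D.lam D'.lam V := fun x hx => (h x hx).1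
  refine ⟨hW.smooth, fun x hx => ?_, fun x hx => ?_, fun x hx => ?_⟩
  · have : D'.ee x = D.ee x := by rw [Data.ee, Data.ee, hl hx]
    rw [this]; exact hW.gram x hx
  · have : ∀ c, D'.mPlus x L₀ c = D.mPlus x L₀ c := by
      obtain ⟨a0, a1, a2, a3, a4, a5, a6⟩ := h x hx
      intro c
      simp only [Data.mPlus, Data.cA, Data.cB, Data.mp, Data.ee, Data.Xp, Data.Yp, Data.Xm,
        Data.Ym, a0, a1, a2, a3, a4, a5, a6, dd_congr hV hl hx]
    rw [this]; exact hW.plus x hx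
  · have : ∀ c, D'.mMinus x L₀ c = D.mMinus x L₀ c := by
      obtain ⟨a0, a1, a2, a3, a4, a5, a6⟩ := h x hx
      intro c
      simp only [Data.mMinus, Data.cC, Data.cD, Data.mm, Data.ee, Data.Xp, Data.Yp, Data.Xm,
        Data.Ym, a0, a1, a2, a3, a4, a5, a6, dd_congr hV hl hx]
    rw [this]; exact hW.minus x hx

/-- The orientation of the frame `(T₁, N₁, T₂, N₂)` in terms of the null frame. -/
theorem orientationForm_null (L₀ : ℝ) (y a b n k : Fin 5 → ℝ) :
    orientationForm L₀ y ((1 / 2 : ℝ) • (a + b)) ((1 / 2 : ℝ) • (n + k))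
      ((1 / 2 : ℝ) • (a - b)) ((1 / 2 : ℝ) • (n - k))
      = -(1 / 4) * Matrix.det (Matrix.of ![a, b, n, k, xi L₀ y]) := by
  set S : Matrix (Fin 5) (Fin 5) ℝ := !![1 / 2, 1 / 2, 0, 0, 0; 0, 0, 1 / 2, 1 / 2, 0;
    1 / 2, -(1 / 2), 0, 0, 0; 0, 0, 1 / 2, -(1 / 2), 0; 0, 0, 0, 0, 1]
  have hS : S.det = -(1 / 4) := by
    simp [S, Matrix.det_succ_row_zero, Fin.sum_univ_succ, Fin.succAbove]
    norm_num
  have hmul : Matrix.of ![(1 / 2 : ℝ) • (a + b), (1 / 2 : ℝ) • (n + k), (1 / 2 : ℝ) • (a - b),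
      (1 / 2 : ℝ) • (n - k), xi L₀ y] = S * Matrix.of ![a, b, n, k, xi L₀ y] := by
    ext i j
    fin_cases i <;> simp [S, Matrix.mul_apply, Fin.sum_univ_five] <;> ring
  rw [← hS, ← Matrix.det_mul, ← hmul]
  rfl

theorem normalPart_sub (L₀ : ℝ) (f : ℝ × ℝ → Fin 5 → ℝ) (x : ℝ × ℝ) (y z : Fin 5 → ℝ) :
    normalPart L₀ f x (y - z) = normalPart L₀ f x y - normalPart L₀ f x z := by
  simp only [normalPart, form_eq_bil_sign, bil_sub_left, sub_div, sub_smul]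
  abel

/-- A null frame whose first two vectors are the null derivatives of a map `f` into the space form,
and whose last one is `xi`, comes from a surface with zero mean curvature vector. -/
theorem IsNullFrame.realizes {L₀ : ℝ} {o : ℤˣ} {V : Set (ℝ × ℝ)} (hV : IsOpen V) {D : Data}
    {W : Fin 5 → ℝ × ℝ → Fin 5 → ℝ} (hW : IsNullFrame L₀ V D W)
    {f : ℝ × ℝ → Fin 5 → ℝ} (hf : ContDiffOn ℝ ∞ f V) (hmem : ∀ x ∈ V, f x ∈ spaceForm L₀)
    (hp : ∀ x ∈ V, dd wp f x = W 0 x) (hm : ∀ x ∈ V, dd wm f x = W 1 x)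
    (hxi : ∀ x ∈ V, W 4 x = xi L₀ (f x))
    (ho : ∀ x ∈ V, ((o : ℤ) : ℝ) * Matrix.det (Matrix.of fun i => W i x) < 0) :
    Realizes L₀ o V D f (fun x => (1 / 2 : ℝ) • (W 2 x + W 3 x))
      (fun x => (1 / 2 : ℝ) • (W 2 x - W 3 x)) := by
  have hu : ∀ x ∈ V, du f x = (1 / 2 : ℝ) • (W 0 x + W 1 x) := by
    intro x hx
    rw [← hp x hx, ← hm x hx, dd_wp, dd_wm]; module
  have hv : ∀ x ∈ V, dv f x = (1 / 2 : ℝ) • (W 0 x - W 1 x) := by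
    intro x hx
    rw [← hp x hx, ← hm x hx, dd_wp, dd_wm]; module
  have hd := fun i x hx => differentiableAt_of_contDiffOn hV (hW.smooth i) (x := x) hx
  -- the scalar products of the frame, as equations for `bil`
  have g : ∀ x ∈ V, ∀ i j, bil (tau L₀) (W i x) (W j x) = nullGram (2 * D.ee x) (kap L₀) i j :=
    hW.gram
  have tan0 : ∀ x ∈ V, ∀ i, i ≠ 4 → IsTangent L₀ (f x) (W i x) := by
    intro x hx i hi
    rw [isTangent_iff, ← hxi x hx, g x hx]
    fin_cases i <;> simp [nullGram] at hi ⊢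
  have tan1 : ∀ x ∈ V, ∀ i j, i ≠ 4 → j ≠ 4 → ∀ a : ℝ,
      IsTangent L₀ (f x) ((1 / 2 : ℝ) • (W i x + a • W j x)) := by
    intro x hx i j hi hj a
    have h1 := tan0 x hx i hi
    have h2 := tan0 x hx j hj
    rw [isTangent_iff] at h1 h2 ⊢
    rw [bil_smul_left, bil_add_left, bil_smul_left, h1, h2]; ring
  have tp : ∀ x ∈ V, ∀ i j, i ≠ 4 → j ≠ 4 → IsTangent L₀ (f x) ((1 / 2 : ℝ) • (W i x + W j x)) := by
    intro x hx i j hi hj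
    simpa using tan1 x hx i j hi hj 1
  have tm : ∀ x ∈ V, ∀ i j, i ≠ 4 → j ≠ 4 → IsTangent L₀ (f x) ((1 / 2 : ℝ) • (W i x - W j x)) := by
    intro x hx i j hi hj
    simpa [sub_eq_add_neg] using tan1 x hx i j hi hj (-1)
  have conv : ∀ {x}, x ∈ V → ∀ {a b : Fin 5 → ℝ}, IsTangent L₀ (f x) b →
      form L₀ a b = bil (tau L₀) a b := fun _ _ _ hb =>
    form_eq_bil fun h0 => Or.inr (hb.apply_four h0)
  have ne : (0 : Fin 5) ≠ 4 ∧ (1 : Fin 5) ≠ 4 ∧ (2 : Fin 5) ≠ 4 ∧ (3 : Fin 5) ≠ 4 := by decide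
  obtain ⟨n0, n1, n2, n3⟩ := ne
  have epos := D.ee_pos
  have fu : ∀ x ∈ V, form L₀ (du f x) (du f x) = D.ee x := by
    intro x hx
    rw [hu x hx, conv hx (tp x hx 0 1 n0 n1)]
    simp only [bil_smul_left, bil_smul_right, bil_add_left, bil_add_right, g x hx, nullGram,
      Matrix.of_apply, Matrix.cons_val]
    ring
  have fN₁ : ∀ x ∈ V, form L₀ ((1 / 2 : ℝ) • (W 2 x + W 3 x)) ((1 / 2 : ℝ) • (W 2 x + W 3 x))
      = D.ee x := by
    intro x hx
    rw [conv hx (tp x hx 2 3 n2 n3)]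
    simp only [bil_smul_left, bil_smul_right, bil_add_left, bil_add_right, g x hx, nullGram,
      Matrix.of_apply, Matrix.cons_val]
    ring
  have fN₂ : ∀ x ∈ V, form L₀ ((1 / 2 : ℝ) • (W 2 x - W 3 x)) ((1 / 2 : ℝ) • (W 2 x - W 3 x))
      = -D.ee x := by
    intro x hx
    rw [conv hx (tm x hx 2 3 n2 n3)]
    simp only [bil_smul_left, bil_smul_right, bil_sub_left, bil_sub_right, g x hx, nullGram,
      Matrix.of_apply, Matrix.cons_val]
    ring
  have normal₁ : ∀ x ∈ V, form L₀ ((1 / 2 : ℝ) • (W 2 x + W 3 x)) (du f x) = 0 ∧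
      form L₀ ((1 / 2 : ℝ) • (W 2 x + W 3 x)) (dv f x) = 0 := by
    intro x hx
    rw [hu x hx, hv x hx, conv hx (tp x hx 0 1 n0 n1), conv hx (tm x hx 0 1 n0 n1)]
    simp only [bil_smul_left, bil_smul_right, bil_sub_right, bil_add_left,
      bil_add_right, g x hx, nullGram, Matrix.of_apply, Matrix.cons_val]
    constructor <;> ring
  have normal₂ : ∀ x ∈ V, form L₀ ((1 / 2 : ℝ) • (W 2 x - W 3 x)) (du f x) = 0 ∧
      form L₀ ((1 / 2 : ℝ) • (W 2 x - W 3 x)) (dv f x) = 0 := by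
    intro x hx
    rw [hu x hx, hv x hx, conv hx (tp x hx 0 1 n0 n1), conv hx (tm x hx 0 1 n0 n1)]
    simp only [bil_smul_left, bil_smul_right, bil_sub_left, bil_sub_right, bil_add_right,
      g x hx, nullGram, Matrix.of_apply, Matrix.cons_val]
    constructor <;> ring
  -- derivatives of linear combinations of the frame, in the coordinate directions
  have uder : ∀ (W' : ℝ × ℝ → Fin 5 → ℝ) x,
      dd (1, 0) W' x = (1 / 2 : ℝ) • (dd wp W' x + dd wm W' x) := by
    intro W' x
    rw [dd_wp, dd_wm, du_eq_dd]; module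
  have vder : ∀ (W' : ℝ × ℝ → Fin 5 → ℝ) x,
      dd (0, 1) W' x = (1 / 2 : ℝ) • (dd wp W' x - dd wm W' x) := by
    intro W' x
    rw [dd_wp, dd_wm, dv_eq_dd]; module
  have addder : ∀ x ∈ V, ∀ i j w, dd w (fun y => (1 / 2 : ℝ) • (W i y + W j y)) x
      = (1 / 2 : ℝ) • (dd w (W i) x + dd w (W j) x) := by
    intro x hx i j w
    rw [dd_const_smul _ ((hd i x hx).fun_add (hd j x hx)), dd_add (hd i x hx) (hd j x hx)]
  have subder : ∀ x ∈ V, ∀ i j w, dd w (fun y => (1 / 2 : ℝ) • (W i y - W j y)) x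
      = (1 / 2 : ℝ) • (dd w (W i) x - dd w (W j) x) := by
    intro x hx i j w
    rw [dd_const_smul _ ((hd i x hx).fun_sub (hd j x hx)), dd_sub (hd i x hx) (hd j x hx)]
  have comm : ∀ x ∈ V, dd wp (W 1) x = dd wm (W 0) x := by
    intro x hx
    rw [← dd_congr hV hm hx, ← dd_congr hV hp hx, dd_comm hV hf hx]
  have huu : ∀ x ∈ V, du (du f) x
      = (1 / 4 : ℝ) • (dd wp (W 0) x + (2 : ℝ) • dd wp (W 1) x + dd wm (W 1) x) := by
    intro x hx
    rw [du_eq_dd (du f), dd_congr hV hu hx, addder x hx, uder, uder, ← comm x hx]; module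
  have huv : ∀ x ∈ V, du (dv f) x = (1 / 4 : ℝ) • (dd wp (W 0) x - dd wm (W 1) x) := by
    intro x hx
    rw [du_eq_dd (dv f), dd_congr hV hv hx, subder x hx, uder, uder, ← comm x hx]; module
  have hvv : ∀ x ∈ V, dv (dv f) x
      = (1 / 4 : ℝ) • (dd wp (W 0) x - (2 : ℝ) • dd wp (W 1) x + dd wm (W 1) x) := by
    intro x hx
    rw [dv_eq_dd (dv f), dd_congr hV hv hx, subder x hx, vder, vder, ← comm x hx]; module
  have sN₁ : ContDiffOn ℝ ∞ (fun x => (1 / 2 : ℝ) • (W 2 x + W 3 x)) V :=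
    ((hW.smooth 2).add (hW.smooth 3)).const_smul (1 / 2 : ℝ)
  have sN₂ : ContDiffOn ℝ ∞ (fun x => (1 / 2 : ℝ) • (W 2 x - W 3 x)) V :=
    ((hW.smooth 2).sub (hW.smooth 3)).const_smul (1 / 2 : ℝ)
  have hNF : IsNormalFrame L₀ o V f (fun x => (1 / 2 : ℝ) • (W 2 x + W 3 x))
      (fun x => (1 / 2 : ℝ) • (W 2 x - W 3 x)) := by
    refine ⟨sN₁, sN₂, fun x hx => tp x hx 2 3 n2 n3, fun x hx => tm x hx 2 3 n2 n3, normal₁,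
      normal₂, fun x hx => by rw [fN₁ x hx, fu x hx], fun x hx => by rw [fN₂ x hx, fu x hx],
      fun x hx => ?_, fun x hx => ?_⟩
    · rw [conv hx (tm x hx 2 3 n2 n3)]
      simp only [bil_smul_left, bil_smul_right, bil_sub_right, bil_add_left, g x hx, nullGram,
        Matrix.of_apply, Matrix.cons_val]
      ring
    · rw [hu x hx, hv x hx, orientationForm_null, ← hxi x hx]
      have e : (Matrix.of ![W 0 x, W 1 x, W 2 x, W 3 x, W 4 x]) = Matrix.of fun i => W i x := by
        ext i j; fin_cases i <;> rfl
      rw [e]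
      linarith [ho x hx]
  have hpn1 := fun x hx w => form_normalPart_sub (w := w) (hNF.tangent₁ x hx) (hNF.normal₁ x hx).1
    (hNF.normal₁ x hx).2
  have hpn2 := fun x hx w => form_normalPart_sub (w := w) (hNF.tangent₂ x hx) (hNF.normal₂ x hx).1
    (hNF.normal₂ x hx).2
  refine ⟨⟨hf, hmem, fun x hx => by rw [fu x hx]; exact epos x, fun x hx => ?_, fun x hx => ?_,
    fun x hx => ?_⟩, hNF, fun x hx => ?_⟩
  · rw [fu x hx, hv x hx, conv hx (tm x hx 0 1 n0 n1)]
    simp only [bil_smul_left, bil_smul_right, bil_sub_left, bil_sub_right, g x hx, nullGram,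
      Matrix.of_apply, Matrix.cons_val]
    ring
  · rw [hu x hx, hv x hx, conv hx (tm x hx 0 1 n0 n1)]
    simp only [bil_smul_left, bil_smul_right, bil_sub_right, bil_add_left, g x hx, nullGram,
      Matrix.of_apply, Matrix.cons_val]
    ring
  · have hvneg : form L₀ (dv f x) (dv f x) = -D.ee x := by
      rw [hv x hx, conv hx (tm x hx 0 1 n0 n1)]
      simp only [bil_smul_left, bil_smul_right, bil_sub_left, bil_sub_right, g x hx, nullGram,
        Matrix.of_apply, Matrix.cons_val]
      ring
    have hs : sigmaUU L₀ f x = sigmaVV L₀ f x := by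
      rw [← sub_eq_zero, sigmaUU, sigmaVV, ← normalPart_sub]
      have h0 : nablaU L₀ f (du f) x - nablaV L₀ f (dv f) x = 0 := by
        have h1 : du (du f) x - dv (dv f) x = (-2 * L₀ * D.ee x) • xi L₀ (f x) := by
          rw [huu x hx, hvv x hx, hW.plus x hx 1, ← hxi x hx]
          simp only [Fin.sum_univ_five, Data.mPlus, Matrix.of_apply, Matrix.cons_val]
          module
        have h2 : nablaU L₀ f (du f) x - nablaV L₀ f (dv f) x
            = (du (du f) x - dv (dv f) x)
              - (L₀ * form L₀ (du (du f) x - dv (dv f) x) (f x)) • f x := by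
          simp only [nablaU, nablaV, form_eq_bil_sign, bil_sub_left, mul_sub, sub_smul]
          abel
        rw [h2, h1]
        by_cases h0 : L₀ = 0
        · simp [h0]
        · have h3 := mem_spaceForm_ne (hmem x hx) h0
          simp only [xi, h0, if_false, form_eq_bil_sign, bil_smul_left] at h3 ⊢
          rw [h3]
          have : L₀ * (-2 * L₀ * D.ee x * (1 / L₀)) = -2 * L₀ * D.ee x := by field_simp
          rw [this, sub_self]
      rw [h0]
      simp [normalPart, form_eq_bil_sign, bil_zero_left]
    rw [meanCurvature, hs, fu x hx, hvneg]
    simp [inv_neg]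
  · have w20 := fu x hx
    have key1 := fun a => conv hx (a := a) (tp x hx 2 3 n2 n3)
    have key2 := fun a => conv hx (a := a) (tm x hx 2 3 n2 n3)
    have he := (epos x).ne'
    refine ⟨?_, ?_, ?_, ?_, ?_, ?_, ?_⟩
    · simp only [dataOf]
      rw [w20, Data.ee, Real.log_exp]; ring
    · simp only [dataOf]
      rw [fN₁ x hx, sigmaUU, nablaU, hpn1 x hx, huu x hx, key1, hW.plus x hx, hW.plus x hx,
        hW.minus x hx]
      simp only [Fin.sum_univ_five, Data.mPlus, Data.mMinus, bil_smul_left, bil_smul_right,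
        bil_add_left, bil_add_right, g x hx, nullGram, Matrix.of_apply, Matrix.cons_val, Data.cA,
        Data.cB, Data.cC, Data.cD, Data.Xp, Data.Xm, Data.Yp, Data.Ym]
      field_simp
      ring
    · simp only [dataOf]
      rw [fN₁ x hx, sigmaUV, nablaU, hpn1 x hx, huv x hx, key1, hW.plus x hx, hW.minus x hx]
      simp only [Fin.sum_univ_five, Data.mPlus, Data.mMinus, bil_smul_left, bil_smul_right,
        bil_add_left, bil_add_right, bil_sub_left, g x hx, nullGram, Matrix.of_apply,
        Matrix.cons_val, Data.cA,
        Data.cB, Data.cC, Data.cD, Data.Xp, Data.Xm, Data.Yp, Data.Ym]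
      field_simp
      ring
    · simp only [dataOf]
      rw [fN₂ x hx, sigmaUU, nablaU, hpn2 x hx, huu x hx, key2, hW.plus x hx, hW.plus x hx,
        hW.minus x hx]
      simp only [Fin.sum_univ_five, Data.mPlus, Data.mMinus, bil_smul_left, bil_smul_right,
        bil_add_left, bil_sub_right, g x hx, nullGram, Matrix.of_apply, Matrix.cons_val, Data.cA,
        Data.cB, Data.cC, Data.cD, Data.Xp, Data.Xm, Data.Yp, Data.Ym]
      field_simp
      ring
    · simp only [dataOf]
      rw [fN₂ x hx, sigmaUV, nablaU, hpn2 x hx, huv x hx, key2, hW.plus x hx, hW.minus x hx]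
      simp only [Fin.sum_univ_five, Data.mPlus, Data.mMinus, bil_smul_left, bil_smul_right,
        bil_add_left, bil_sub_right, bil_sub_left, g x hx, nullGram, Matrix.of_apply,
        Matrix.cons_val, Data.cA,
        Data.cB, Data.cC, Data.cD, Data.Xp, Data.Xm, Data.Yp, Data.Ym]
      field_simp
      ring
    · have ht := (tm x hx 2 3 n2 n3).mul_form
      have e : form L₀ (nablaU L₀ f (fun x => (1 / 2 : ℝ) • (W 2 x + W 3 x)) x)
          ((1 / 2 : ℝ) • (W 2 x - W 3 x))
          = bil (tau L₀) (dd (1, 0) (fun x => (1 / 2 : ℝ) • (W 2 x + W 3 x)) x)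
            ((1 / 2 : ℝ) • (W 2 x - W 3 x)) := by
        rw [← key2, nablaU, du_eq_dd]
        simp only [form_eq_bil_sign] at ht ⊢
        rw [bil_sub_left, bil_smul_left, bil_comm _ (f x)]
        linear_combination (-bil L₀.sign
          (dd (1, 0) (fun x => (1 / 2 : ℝ) • (W 2 x + W 3 x)) x) (f x)) * ht
      simp only [dataOf]
      rw [e, fN₂ x hx, addder x hx, uder, uder, hW.plus x hx, hW.plus x hx, hW.minus x hx,
        hW.minus x hx]
      simp only [Fin.sum_univ_five, Data.mPlus, Data.mMinus, bil_smul_left, bil_smul_right,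
        bil_add_left, bil_sub_right, g x hx, nullGram, Matrix.of_apply,
        Matrix.cons_val, Data.mp, Data.mm]
      field_simp
      ring
    · have ht := (tm x hx 2 3 n2 n3).mul_form
      have e : form L₀ (nablaV L₀ f (fun x => (1 / 2 : ℝ) • (W 2 x + W 3 x)) x)
          ((1 / 2 : ℝ) • (W 2 x - W 3 x))
          = bil (tau L₀) (dd (0, 1) (fun x => (1 / 2 : ℝ) • (W 2 x + W 3 x)) x)
            ((1 / 2 : ℝ) • (W 2 x - W 3 x)) := by
        rw [← key2, nablaV, dv_eq_dd]
        simp only [form_eq_bil_sign] at ht ⊢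
        rw [bil_sub_left, bil_smul_left, bil_comm _ (f x)]
        linear_combination (-bil L₀.sign
          (dd (0, 1) (fun x => (1 / 2 : ℝ) • (W 2 x + W 3 x)) x) (f x)) * ht
      simp only [dataOf]
      rw [e, fN₂ x hx, addder x hx, vder, vder, hW.plus x hx, hW.plus x hx, hW.minus x hx,
        hW.minus x hx]
      simp only [Fin.sum_univ_five, Data.mPlus, Data.mMinus, bil_smul_left, bil_smul_right,
        bil_add_left, bil_sub_left, bil_sub_right, g x hx, nullGram, Matrix.of_apply,
        Matrix.cons_val, Data.mp, Data.mm]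
      field_simp
      ring

/-! ### Existence of surfaces with given functions -/

theorem det_ne_zero_of_gram {c e κ : ℝ} (he : e ≠ 0) (hκ : κ ≠ 0) {W : Fin 5 → Fin 5 → ℝ}
    (hW : ∀ i j, bil c (W i) (W j) = nullGram e κ i j) : (Matrix.of W).det ≠ 0 := by
  rw [gram_iff_matrix] at hW
  have h1 : Matrix.of W * (bilMatrix c * (Matrix.of W).transpose * nullGram e⁻¹ κ⁻¹) = 1 := by
    rw [← nullGram_mul_inv he hκ, ← hW]; simp only [Matrix.mul_assoc]
  exact (Matrix.isUnit_det_of_right_inverse h1).ne_zero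

/-- Along a null frame on a connected set, the orientation does not change. -/
theorem IsNullFrame.det_neg {L₀ : ℝ} {V : Set (ℝ × ℝ)} (hVc : IsPreconnected V)
    {D : Data} {W : Fin 5 → ℝ × ℝ → Fin 5 → ℝ} (hW : IsNullFrame L₀ V D W) {p : ℝ × ℝ}
    (hp : p ∈ V) (o : ℝ) (h : o * Matrix.det (Matrix.of fun i => W i p) < 0) {x : ℝ × ℝ}
    (hx : x ∈ V) : o * Matrix.det (Matrix.of fun i => W i x) < 0 := by
  have ho : o ≠ 0 := by rintro rfl; simp at h
  have hc : ContinuousOn (fun y => o * Matrix.det (Matrix.of fun i => W i y)) V := by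
    have h1 : ContinuousOn (fun y => (Matrix.of fun i => W i y : Matrix (Fin 5) (Fin 5) ℝ)) V :=
      continuousOn_pi.2 fun i => (hW.smooth i).continuousOn
    have h2 : Continuous (Matrix.det : Matrix (Fin 5) (Fin 5) ℝ → ℝ) := continuous_id.matrix_det
    have h3 := h2.comp_continuousOn h1
    simp only [Function.comp_def] at h3
    exact continuousOn_const.mul h3
  by_contra! h'
  have hne : ∀ y ∈ V, o * Matrix.det (Matrix.of fun i => W i y) ≠ 0 := fun y hy =>
    mul_ne_zero ho (det_ne_zero_of_gram (by have := D.ee_pos y; positivity) (kap_ne_zero L₀)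
      (W := fun i => W i y) (hW.gram y hy))
  obtain ⟨y, hy, hy0⟩ := hVc.intermediate_value hp hx hc (Set.mem_Icc.2 ⟨h.le, h'⟩)
  exact hne y hy hy0

/-- At some point of the space form there is a null frame of either orientation with a prescribed
conformal factor. -/
theorem exists_initial_frame (L₀ : ℝ) (o : ℤˣ) {E : ℝ} (hE : 0 < E) :
    ∃ (a b n k y : Fin 5 → ℝ), y ∈ spaceForm L₀ ∧
      (∀ i j, bil (tau L₀) (![a, b, n, k, xi L₀ y] i) (![a, b, n, k, xi L₀ y] j)
        = nullGram (2 * E) (kap L₀) i j) ∧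
      ((o : ℤ) : ℝ) * Matrix.det (Matrix.of ![a, b, n, k, xi L₀ y]) < 0 := by
  obtain ⟨r, hr, rfl⟩ : ∃ r : ℝ, 0 < r ∧ r * r = E :=
    ⟨√E, Real.sqrt_pos.2 hE, Real.mul_self_sqrt hE.le⟩
  obtain ⟨s, y, hs, hy, hxi, hsq⟩ : ∃ (s : ℝ) (y : Fin 5 → ℝ), 0 < s ∧ y ∈ spaceForm L₀ ∧
      xi L₀ y = ![0, 0, 0, 0, s] ∧ tau L₀ * (s * s) = kap L₀ := by
    by_cases h0 : L₀ = 0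
    · refine ⟨1, 0, one_pos, ?_, ?_, ?_⟩
      · simp [spaceForm, h0]
      · simp only [xi, h0, if_true]
        ext i; fin_cases i <;> simp
      · simp [tau, kap, h0]
    · have ha : 0 < |L₀| := abs_pos.2 h0
      have hss : (1 / √|L₀|) * (1 / √|L₀|) = 1 / |L₀| := by
        rw [div_mul_div_comm, Real.mul_self_sqrt ha.le, one_mul]
      have hq : Real.sign L₀ * (1 / |L₀|) = 1 / L₀ := by
        rcases lt_or_gt_of_ne h0 with h | h
        · rw [Real.sign_of_neg h, abs_of_neg h]; field_simp
        · rw [Real.sign_of_pos h, abs_of_pos h]; ring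
      refine ⟨1 / √|L₀|, ![0, 0, 0, 0, 1 / √|L₀|], by positivity, ?_, ?_, ?_⟩
      · change if L₀ = 0 then _ else _
        rw [if_neg h0]
        simp only [form, Matrix.cons_val, hss, hq]; ring
      · simp [xi, h0]
      · rw [hss, tau, kap, if_neg h0, if_neg h0, hq]
  have hoo := unit_mul_self o
  set t : ℝ := ((o : ℤ) : ℝ)
  refine ⟨![r, 0, r, 0, 0], ![r, 0, -r, 0, 0], ![0, r, 0, t * r, 0], ![0, r, 0, -(t * r), 0], y,
    hy, ?_, ?_⟩
  · have e : r * r - t * r * (t * r) = 0 := by linear_combination (-(r * r)) * hoo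
    have e' : r * r + t * r * (t * r) = 2 * (r * r) := by linear_combination (r * r) * hoo
    rw [hxi]
    intro i j
    fin_cases i <;> fin_cases j <;>
      simp only [bil, nullGram, Matrix.of_apply, Matrix.cons_val, Fin.zero_eta, Fin.mk_one,
        Fin.reduceFinMk] <;> linarith
  · have h := orientationForm_null L₀ y ![r, 0, r, 0, 0] ![r, 0, -r, 0, 0] ![0, r, 0, t * r, 0]
      ![0, r, 0, -(t * r), 0]
    have h2 : orientationForm L₀ y ((1 / 2 : ℝ) • (![r, 0, r, 0, 0] + ![r, 0, -r, 0, 0]))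
        ((1 / 2 : ℝ) • (![0, r, 0, t * r, 0] + ![0, r, 0, -(t * r), 0]))
        ((1 / 2 : ℝ) • (![r, 0, r, 0, 0] - ![r, 0, -r, 0, 0]))
        ((1 / 2 : ℝ) • (![0, r, 0, t * r, 0] - ![0, r, 0, -(t * r), 0]))
        = t * r * r * r * r * s := by
      have e : Matrix.of ![(1 / 2 : ℝ) • (![r, 0, r, 0, 0] + ![r, 0, -r, 0, 0]),
          (1 / 2 : ℝ) • (![0, r, 0, t * r, 0] + ![0, r, 0, -(t * r), 0]),
          (1 / 2 : ℝ) • (![r, 0, r, 0, 0] - ![r, 0, -r, 0, 0]),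
          (1 / 2 : ℝ) • (![0, r, 0, t * r, 0] - ![0, r, 0, -(t * r), 0]), xi L₀ y]
          = Matrix.diagonal ![r, r, r, t * r, s] := by
        rw [hxi]
        ext i j
        fin_cases i <;> fin_cases j <;> simp <;> ring
      refine (congrArg Matrix.det e).trans ?_
      rw [Matrix.det_diagonal, Fin.prod_univ_five]
      simp only [Matrix.cons_val]; ring
    rw [h2] at h
    have : 0 < r * r * r * r * s := by positivity
    have h3 : t * Matrix.det (Matrix.of ![![r, 0, r, 0, 0], ![r, 0, -r, 0, 0], ![0, r, 0, t * r, 0],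
        ![0, r, 0, -(t * r), 0], xi L₀ y]) = -4 * (r * r * r * r * s) := by
      linear_combination (4 * t) * h - (4 * r * r * r * r * s) * hoo
    rw [h3]; linarith

/-- The fundamental theorem for the functions of a surface with `X₋ = Y₋`: they come from a
surface if they satisfy the Gauss, Codazzi and Ricci equations. -/
theorem Data.GCR.exists_realizes {L₀ : ℝ} {U : Set (ℝ × ℝ)} (hU : IsOpen U) {D : Data}
    (hD : D.IsSmoothOn U) (h : ∀ x ∈ U, D.GCR L₀ x) (h0 : ∀ x ∈ U, D.cD x = 0) (o : ℤˣ)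
    {p : ℝ × ℝ} (hp : p ∈ U) :
    ∃ δ : ℝ, 0 < δ ∧ Metric.ball p δ ⊆ U ∧
      ∃ f N₁ N₂, Realizes L₀ o (Metric.ball p δ) D f N₁ N₂ := by
  -- with `c = 1`, the last row of a solution is the surface itself, also if `L₀ = 0`
  obtain ⟨δ, hδ, hsub, hsol⟩ := Data.exists_frame (L₀ := L₀) (c := 1) hU hD
    (fun x hx => (h x hx).isFlatAt hU hD hx h0 (one_mul _)) hp
  refine ⟨δ, hδ, hsub, ?_⟩
  obtain ⟨a, b, n, k, y, hy, hgram, hdet⟩ := exists_initial_frame L₀ o (D.ee_pos p)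
  obtain ⟨W, hW0, hWs, hW⟩ := hsol ![a, b, n, k, y]
  set V := Metric.ball p δ
  have hV : IsOpen V := Metric.isOpen_ball
  have hVc : IsPreconnected V := (convex_ball p δ).isPreconnected
  have hpV : p ∈ V := Metric.mem_ball_self hδ
  set f := W 4
  set W' : Fin 5 → ℝ × ℝ → Fin 5 → ℝ := ![W 0, W 1, W 2, W 3, fun x => xi L₀ (f x)] with hW'
  have hmul : ∀ x, L₀ • xi L₀ (f x) = L₀ • f x := by
    intro x
    by_cases h : L₀ = 0 <;> simp [xi, h]
  have fp : ∀ x ∈ V, dd wp f x = W 0 x := by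
    intro x hx
    rw [(hW x hx 4).1]
    simp [Fin.sum_univ_five, Data.mPlus]
  have fm : ∀ x ∈ V, dd wm f x = W 1 x := by
    intro x hx
    rw [(hW x hx 4).2]
    simp [Fin.sum_univ_five, Data.mMinus]
  have hxi : ∀ x w, dd w (fun y => xi L₀ (f y)) x = (kap L₀ * L₀) • dd w f x := by
    intro x w
    unfold xi kap
    split_ifs with h0
    · simp [dd_const, h0]
    · simp [h0]
  have smooth : ∀ i, ContDiffOn ℝ ∞ (W' i) V := by
    intro i
    fin_cases i
    · exact hWs 0
    · exact hWs 1
    · exact hWs 2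
    · exact hWs 3
    · exact contDiffOn_xi (hWs 4)
  have key : ∀ x t, (-2 * L₀ * t) • f x = (-2 * L₀ * t) • xi L₀ (f x) := by
    intro x t
    have : ∀ z : Fin 5 → ℝ, (-2 * L₀ * t) • z = (-2 * t) • (L₀ • z) := fun z => by module
    rw [this, this, hmul]
  have plus : ∀ x ∈ V, ∀ i, dd wp (W' i) x = ∑ j, D.mPlus x L₀ (kap L₀ * L₀) i j • W' j x := by
    intro x hx i
    have h0 := (hW x hx 0).1
    have h1 := (hW x hx 1).1
    have h2 := (hW x hx 2).1
    have h3 := (hW x hx 3).1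
    fin_cases i <;>
      simp only [hW', Fin.sum_univ_five, Data.mPlus, Matrix.of_apply, Matrix.cons_val,
        Fin.zero_eta, Fin.mk_one, Fin.reduceFinMk, hxi, fp x hx, zero_smul, add_zero, zero_add]
        at h0 h1 h2 h3 ⊢
    · exact h0
    · rw [← key]; exact h1
    · exact h2
    · exact h3
  have minus : ∀ x ∈ V, ∀ i,
      dd wm (W' i) x = ∑ j, D.mMinus x L₀ (kap L₀ * L₀) i j • W' j x := by
    intro x hx i
    have h0 := (hW x hx 0).2
    have h1 := (hW x hx 1).2
    have h2 := (hW x hx 2).2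
    have h3 := (hW x hx 3).2
    fin_cases i <;>
      simp only [hW', Fin.sum_univ_five, Data.mMinus, Matrix.of_apply, Matrix.cons_val,
        Fin.zero_eta, Fin.mk_one, Fin.reduceFinMk, hxi, fm x hx, zero_smul, add_zero, zero_add]
        at h0 h1 h2 h3 ⊢
    · rw [← key]; exact h0
    · exact h1
    · exact h2
    · exact h3
  have hW'p : ∀ i, W' i p = ![a, b, n, k, xi L₀ y] i := by
    intro i
    have e0 := hW0 0
    have e1 := hW0 1
    have e2 := hW0 2
    have e3 := hW0 3
    have e4 : f p = y := hW0 4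
    simp only [Matrix.cons_val] at e0 e1 e2 e3
    fin_cases i <;> simp only [hW', Matrix.cons_val, Fin.zero_eta, Fin.mk_one, Fin.reduceFinMk,
      e0, e1, e2, e3, e4]
  -- the scalar products with `ξ` show that the surface lies in the space form
  have hN : IsNullFrame L₀ V D W' := IsNullFrame.of_solution hV hVc (hD.lam.mono hsub) smooth
    plus minus hpV fun i j => by rw [hW'p, hW'p]; exact hgram i j
  have hmem : ∀ x ∈ V, f x ∈ spaceForm L₀ := by
    intro x hx
    change if L₀ = 0 then _ else _
    split_ifs with hL
    · have t4 : ∀ i, i ≠ 4 → ∀ z ∈ V, W' i z 4 = 0 := by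
        intro i hi z hz
        have h1 : bil (tau L₀) (W' i z) (xi L₀ (f z)) = nullGram (2 * D.ee z) (kap L₀) i 4 :=
          hN.gram z hz i 4
        have h2 : nullGram (2 * D.ee z) (kap L₀) i 4 = 0 := by
          fin_cases i <;> simp [nullGram] at hi ⊢
        rw [h2, ← isTangent_iff] at h1
        exact h1.apply_four hL
      have hy4 : f p 4 = 0 := by
        rw [show f p = y from hW0 4]; exact mem_spaceForm_zero hy hL
      rw [← hy4]
      refine hV.is_const_of_fderiv_eq_zero (𝕜 := ℝ) (f := fun z => f z 4) hVc
        ((contDiffOn_pi.1 (hWs 4) 4).differentiableOn (by simp)) (fun z hz => ?_) hx hpV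
      refine ContinuousLinearMap.ext fun w => ?_
      have hd := differentiableAt_of_contDiffOn hV (hWs 4) hz
      rw [fderiv_apply_eq_dd, ← dd_pi hd, ← dd_pi hd, fp z hz, fm z hz]
      have a0 : W 0 z 4 = 0 := t4 0 (by decide) z hz
      have a1 : W 1 z 4 = 0 := t4 1 (by decide) z hz
      simp [a0, a1]
    · have h1 : bil (tau L₀) (xi L₀ (f x)) (xi L₀ (f x)) = nullGram (2 * D.ee x) (kap L₀) 4 4 :=
        hN.gram x hx 4 4
      simpa [xi, kap, tau, hL, nullGram, form_eq_bil_sign] using h1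
  have hdp : ((o : ℤ) : ℝ) * Matrix.det (Matrix.of fun i => W' i p) < 0 := by
    have : (fun i => W' i p) = ![a, b, n, k, xi L₀ y] := funext hW'p
    rw [this]; exact hdet
  exact ⟨f, _, _, hN.realizes hV (hWs 4) hmem fp fm (fun _ _ => rfl)
    fun x hx => hN.det_neg hVc hpV _ hdp hx⟩

theorem Data.AgreeOn.trans {V : Set (ℝ × ℝ)} {D D' D'' : Data} (h : D.AgreeOn V D')
    (h' : D'.AgreeOn V D'') : D.AgreeOn V D'' := fun x hx =>
  ⟨(h x hx).1.trans (h' x hx).1, (h x hx).2.1.trans (h' x hx).2.1,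
    (h x hx).2.2.1.trans (h' x hx).2.2.1, (h x hx).2.2.2.1.trans (h' x hx).2.2.2.1,
    (h x hx).2.2.2.2.1.trans (h' x hx).2.2.2.2.1,
    (h x hx).2.2.2.2.2.1.trans (h' x hx).2.2.2.2.2.1,
    (h x hx).2.2.2.2.2.2.trans (h' x hx).2.2.2.2.2.2⟩

theorem Data.AgreeOn.mono {V V' : Set (ℝ × ℝ)} {D D' : Data} (h : D.AgreeOn V D')
    (hV : V' ⊆ V) : D.AgreeOn V' D' := fun x hx => h x (hV hx)

/-- The conditions on `X₊`, `Y₊`, `X₋`, `Y₋` in terms of their sums and differences. -/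
theorem Data.isNullTypeOn_iff {D : Data} {V : Set (ℝ × ℝ)} :
    D.IsNullTypeOn V ↔ ∀ x ∈ V, D.cA x ≠ 0 ∧ D.cC x ≠ 0 ∧ D.cD x = 0 ∧ D.cB x ≠ 0 := by
  refine forall₂_congr fun x _ => ?_
  have h1 : D.Xp x ^ 2 ≠ D.Yp x ^ 2 ↔ D.cA x ≠ 0 ∧ D.cC x ≠ 0 := by
    rw [← mul_ne_zero_iff, ← sub_ne_zero, sq_sub_sq]; rfl
  have h2 : D.Xm x = D.Ym x ↔ D.cD x = 0 := by rw [← sub_eq_zero]; rfl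
  rw [h1, h2, and_assoc]
  refine and_congr_right fun _ => and_congr_right fun _ => and_congr_right fun h => ?_
  have : D.cB x = 2 * D.Xm x := by
    have h3 : D.Xm x - D.Ym x = 0 := h
    change D.Xm x + D.Ym x = _
    linarith
  rw [this]
  simp

theorem unit_ne_zero (ε : ℤˣ) : ((ε : ℤ) : ℝ) ≠ 0 := by
  rcases Int.units_eq_one_or ε with h | h <;> simp [h]

theorem Data.AgreeOn.isNullTypeOn {V : Set (ℝ × ℝ)} {D D' : Data} (h : D.AgreeOn V D')
    (h' : D'.IsNullTypeOn V) : D.IsNullTypeOn V := by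
  intro x hx
  obtain ⟨a0, a1, a2, a3, a4, a5, a6⟩ := h x hx
  have := h' x hx
  simp only [Data.Xp, Data.Yp, Data.Xm, Data.Ym, a1, a2, a3, a4] at this ⊢
  exact this

theorem explicitData_isNullTypeOn (ε ε' ε'' : ℤˣ) (P Q R : ℝ × ℝ → ℝ) (V : Set (ℝ × ℝ)) :
    (explicitData ε ε' ε'' P Q R).IsNullTypeOn V := by
  rw [Data.isNullTypeOn_iff]
  intro x _
  rw [explicitData_cA, explicitData_cB, explicitData_cC, explicitData_cD]
  refine ⟨?_, ?_, rfl, ?_⟩ <;>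
    simp [Real.exp_ne_zero]

theorem IsExplicitOn.isNullTypeOn {L₀ : ℝ} {V : Set (ℝ × ℝ)} {D : Data}
    (h : IsExplicitOn L₀ V D) : D.IsNullTypeOn V := by
  obtain ⟨ε, ε', ε'', f₁, f₂, P, Q, R, -, -, -, -, -, -, -, -, -, hD⟩ := h
  exact hD.isNullTypeOn (explicitData_isNullTypeOn _ _ _ _ _ _ _)

theorem IsExplicitOn.exists_realizes {L₀ : ℝ} {U : Set (ℝ × ℝ)} (hU : IsOpen U) {D : Data}
    (h : IsExplicitOn L₀ U D) (o : ℤˣ) {p : ℝ × ℝ} (hp : p ∈ U) :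
    ∃ V : Set (ℝ × ℝ), IsOpen V ∧ p ∈ V ∧ V ⊆ U ∧
      ∃ f N₁ N₂ : ℝ × ℝ → Fin 5 → ℝ, Realizes L₀ o V D f N₁ N₂ ∧
        (dataOf L₀ f N₁ N₂).IsNullTypeOn V := by
  have hnull := h.isNullTypeOn
  obtain ⟨ε, ε', ε'', f₁, f₂, P, Q, R, h₁, h₂, e₁, e₂, hP, hQ, hR, hf₁, hf₂, hD⟩ := h
  obtain ⟨δ, hδ, hsub, f, N₁, N₂, hf, hN, hdata⟩ :=
    Data.GCR.exists_realizes hU (explicitData_isSmoothOn hU ε ε' ε'' hP hQ hR)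
      (fun x hx => explicitData_gcr hU ε' ε'' hP hQ hR h₁ h₂ e₁ e₂ hf₁ hf₂ hx)
      (fun x _ => explicitData_cD _ _ _ _ _ _ x) o hp
  have hagree := hdata.trans (hD.mono hsub).symm
  exact ⟨_, Metric.isOpen_ball, Metric.mem_ball_self hδ, hsub, f, N₁, N₂, ⟨hf, hN, hagree⟩,
    hagree.isNullTypeOn fun x hx => hnull x (hsub hx)⟩

/-! ### Uniqueness of surfaces with given functions -/

/-- `Λ`, acting on row vectors, preserves `bil (tau L₀)` and, for `L₀ = 0`, fixes the last basis
vector. -/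
structure IsIsometryMatrix (L₀ : ℝ) (Λ : Matrix (Fin 5) (Fin 5) ℝ) : Prop where
  orth : Λ * bilMatrix (tau L₀) * Λ.transpose = bilMatrix (tau L₀)
  last : L₀ = 0 → Matrix.vecMul (Pi.single 4 1) Λ = Pi.single 4 1

namespace IsIsometryMatrix

variable {L₀ : ℝ} {Λ : Matrix (Fin 5) (Fin 5) ℝ} (h : IsIsometryMatrix L₀ Λ)
include h

theorem mul_inverse :
    Λ * (bilMatrix (tau L₀) * Λ.transpose * bilMatrix (tau L₀)) = 1 := by
  rw [← Matrix.mul_assoc, ← Matrix.mul_assoc, h.orth, bilMatrix_mul_self (tau_mul_self L₀)]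

theorem inverse_mul :
    bilMatrix (tau L₀) * Λ.transpose * bilMatrix (tau L₀) * Λ = 1 :=
  mul_eq_one_comm.1 h.mul_inverse

theorem inverse :
    IsIsometryMatrix L₀ (bilMatrix (tau L₀) * Λ.transpose * bilMatrix (tau L₀)) := by
  have hJ := bilMatrix_mul_self (tau_mul_self L₀)
  have hJt : (bilMatrix (tau L₀)).transpose = bilMatrix (tau L₀) := Matrix.diagonal_transpose _
  refine ⟨?_, fun h0 => ?_⟩
  · simp only [Matrix.transpose_mul, Matrix.transpose_transpose, hJt]
    calc _ = bilMatrix (tau L₀) * Λ.transpose * (bilMatrix (tau L₀) * bilMatrix (tau L₀))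
          * bilMatrix (tau L₀) * Λ * bilMatrix (tau L₀) := by simp only [Matrix.mul_assoc]
      _ = bilMatrix (tau L₀) * Λ.transpose * bilMatrix (tau L₀) * Λ * bilMatrix (tau L₀) := by
          rw [hJ, Matrix.mul_one]
      _ = _ := by rw [h.inverse_mul, Matrix.one_mul]
  · nth_rewrite 1 [← h.last h0]
    rw [Matrix.vecMul_vecMul, h.mul_inverse, Matrix.vecMul_one]

theorem bil_vecMul (y z : Fin 5 → ℝ) :
    bil (tau L₀) (Matrix.vecMul y Λ) (Matrix.vecMul z Λ) = bil (tau L₀) y z := by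
  have key : ∀ a b : Fin 5 → ℝ, bil (tau L₀) a b = a ⬝ᵥ (bilMatrix (tau L₀)).mulVec b := by
    intro a b
    simp only [bilMatrix, Matrix.mulVec_diagonal, dotProduct, Fin.sum_univ_five, bil,
      Matrix.cons_val]
    ring
  rw [key, key, ← Matrix.mulVec_transpose Λ z, ← Matrix.dotProduct_mulVec, Matrix.mulVec_mulVec,
    Matrix.mulVec_mulVec, h.orth]

theorem vecMul_four (h0 : L₀ = 0) (y : Fin 5 → ℝ) : Matrix.vecMul y Λ 4 = y 4 := by
  have h1 := h.bil_vecMul y (Pi.single 4 1)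
  rw [h.last h0] at h1
  simpa [bil, tau, h0] using h1

theorem mapsTo {c : Fin 5 → ℝ} (hc : L₀ = 0 → c 4 = 0) (hc' : L₀ ≠ 0 → c = 0) :
    MapsTo (fun y => Matrix.vecMul y Λ + c) (spaceForm L₀) (spaceForm L₀) := by
  intro y hy
  change if L₀ = 0 then _ else _
  split_ifs with h0
  · simp only
    rw [Pi.add_apply, h.vecMul_four h0, hc h0, mem_spaceForm_zero hy h0, add_zero]
  · simp only [hc' h0, add_zero]
    rw [← mem_spaceForm_ne hy h0, form_eq_bil fun h => absurd h h0,
      form_eq_bil fun h => absurd h h0, h.bil_vecMul]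

omit h in
theorem contDiff_affine (Λ : Matrix (Fin 5) (Fin 5) ℝ) (c : Fin 5 → ℝ) :
    ContDiff ℝ ∞ (fun y => Matrix.vecMul y Λ + c) :=
  ((Matrix.vecMulLinear Λ).toContinuousLinearMap.contDiff).add contDiff_const

theorem isIsometry {c : Fin 5 → ℝ} (hc : L₀ = 0 → c 4 = 0) (hc' : L₀ ≠ 0 → c = 0) :
    IsIsometry L₀ (fun y => Matrix.vecMul y Λ + c) := by
  set Λ' := bilMatrix (tau L₀) * Λ.transpose * bilMatrix (tau L₀)
  refine ⟨contDiff_affine Λ c, h.mapsTo hc hc',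
    ⟨fun y => Matrix.vecMul y Λ' + -Matrix.vecMul c Λ', contDiff_affine _ _, h.inverse.mapsTo ?_ ?_,
      fun y _ => ?_, fun y _ => ?_⟩, fun x _ a b ha hb => ?_⟩
  · intro h0
    rw [Pi.neg_apply, h.inverse.vecMul_four h0, hc h0, neg_zero]
  · intro h0
    rw [hc' h0, Matrix.zero_vecMul, neg_zero]
  · simp only [Matrix.add_vecMul, Matrix.vecMul_vecMul, h.mul_inverse, Matrix.vecMul_one, Λ']
    abel
  · simp only [Matrix.add_vecMul, Matrix.neg_vecMul, Matrix.vecMul_vecMul, h.inverse_mul,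
      Matrix.vecMul_one, Λ']
    abel
  · have hd : ∀ w, fderiv ℝ (fun y => Matrix.vecMul y Λ + c) x w = Matrix.vecMul w Λ := by
      intro w
      have := ((Matrix.vecMulLinear Λ).toContinuousLinearMap.hasFDerivAt (x := x)).add_const c
      exact congrArg (fun T => T w) this.fderiv
    have h1 := fun h0 => Or.inl (b := b 4 = 0) (ha.apply_four h0)
    rw [hd, hd, form_eq_bil h1, form_eq_bil, h.bil_vecMul]
    intro h0
    rw [h.vecMul_four h0]
    exact Or.inl (ha.apply_four h0)

end IsIsometryMatrix

/-- Surfaces with the same functions differ by an isometry of the space form. -/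
theorem Realizes.exists_isometry {L₀ : ℝ} {o o' : ℤˣ} {V : Set (ℝ × ℝ)} (hV : IsOpen V)
    (hVc : IsPreconnected V) {D : Data} {f N₁ N₂ f' N₁' N₂' : ℝ × ℝ → Fin 5 → ℝ}
    (h : Realizes L₀ o V D f N₁ N₂) (h' : Realizes L₀ o' V D f' N₁' N₂') :
    ∃ Φ : (Fin 5 → ℝ) → (Fin 5 → ℝ), IsIsometry L₀ Φ ∧ ∀ x ∈ V, f' x = Φ (f x) := by
  have hJ := bilMatrix_mul_self (tau_mul_self L₀)
  rcases V.eq_empty_or_nonempty with rfl | ⟨p, hp⟩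
  · have h1 : IsIsometryMatrix L₀ 1 := ⟨by simp, fun _ => by simp⟩
    exact ⟨_, h1.isIsometry (c := 0) (fun _ => rfl) (fun _ => rfl), fun x hx => hx.elim⟩
  obtain ⟨hf, hN, hD⟩ := h
  obtain ⟨hf', hN', hD'⟩ := h'
  have hW := (hf.isNullFrame hV hN).congr hV hD
  have hW' := (hf'.isNullFrame hV hN').congr hV hD'
  have hlam : ContDiffOn ℝ ∞ D.lam V :=
    (hf.isSmoothOn hV hN).lam.congr fun x hx => (hD x hx).1.symm
  set W := nullFrame L₀ f N₁ N₂
  set W' := nullFrame L₀ f' N₁' N₂'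
  set A : ℝ × ℝ → Matrix (Fin 5) (Fin 5) ℝ := fun x => Matrix.of fun i => W i x
  set B : ℝ × ℝ → Matrix (Fin 5) (Fin 5) ℝ := fun x => Matrix.of fun i => W' i x
  set J := bilMatrix (tau L₀)
  have gA : ∀ x ∈ V, A x * J * (A x).transpose = nullGram (2 * D.ee x) (kap L₀) := fun x hx =>
    (gram_iff_matrix _ _ _ fun i => W i x).1 (hW.gram x hx)
  have gB : ∀ x ∈ V, B x * J * (B x).transpose = nullGram (2 * D.ee x) (kap L₀) := fun x hx =>
    (gram_iff_matrix _ _ _ fun i => W' i x).1 (hW'.gram x hx)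
  have hG : ∀ x, nullGram (2 * D.ee x) (kap L₀) * nullGram (2 * D.ee x)⁻¹ (kap L₀)⁻¹ = 1 :=
    fun x => nullGram_mul_inv (by have := D.ee_pos x; positivity) (kap_ne_zero L₀)
  set Λ := J * ((A p).transpose * nullGram (2 * D.ee p)⁻¹ (kap L₀)⁻¹ * B p) with hΛ
  have hAB : ∀ x ∈ V, A x * Λ = B x := by
    intro x hx
    have h1 : (A x).transpose * nullGram (2 * D.ee x)⁻¹ (kap L₀)⁻¹ * B x
        = (A p).transpose * nullGram (2 * D.ee p)⁻¹ (kap L₀)⁻¹ * B p :=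
      dual_const hV hVc hlam hW.smooth hW'.smooth hW.plus hW.minus hW'.plus hW'.minus hx hp
    rw [hΛ, ← h1]
    calc _ = A x * J * (A x).transpose * nullGram (2 * D.ee x)⁻¹ (kap L₀)⁻¹ * B x := by
          simp only [Matrix.mul_assoc]
      _ = B x := by rw [gA x hx, hG, Matrix.one_mul]
  have hrow : ∀ x ∈ V, ∀ i, Matrix.vecMul (W i x) Λ = W' i x := by
    intro x hx i
    have := congrFun (hAB x hx) i
    rwa [Matrix.mul_apply_eq_vecMul] at this
  have hL : IsIsometryMatrix L₀ Λ := by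
    refine ⟨?_, fun h0 => ?_⟩
    · have h1 : A p * (J * (A p).transpose * nullGram (2 * D.ee p)⁻¹ (kap L₀)⁻¹) = 1 := by
        rw [← hG p, ← gA p hp]; simp only [Matrix.mul_assoc]
      have h2 := mul_eq_one_comm.1 h1
      have h3 := congrArg Matrix.transpose h2
      rw [Matrix.transpose_mul, Matrix.transpose_one] at h3
      set Y := J * (A p).transpose * nullGram (2 * D.ee p)⁻¹ (kap L₀)⁻¹
      have h4 : A p * (Λ * J * Λ.transpose) * (A p).transpose = A p * J * (A p).transpose := by
        rw [gA p hp, ← gB p hp, ← hAB p hp, Matrix.transpose_mul (A p) Λ]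
        simp only [Matrix.mul_assoc]
      calc Λ * J * Λ.transpose
          = (Y * A p) * (Λ * J * Λ.transpose) * ((A p).transpose * Y.transpose) := by
            rw [h2, h3, Matrix.one_mul, Matrix.mul_one]
        _ = Y * (A p * (Λ * J * Λ.transpose) * (A p).transpose) * Y.transpose := by
            simp only [Matrix.mul_assoc]
        _ = (Y * A p) * J * ((A p).transpose * Y.transpose) := by
            rw [h4]; simp only [Matrix.mul_assoc]
        _ = J := by rw [h2, h3, Matrix.one_mul, Matrix.mul_one]
    · have h1 : Matrix.vecMul (xi L₀ (f p)) Λ = xi L₀ (f' p) := hrow p hp 4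
      simpa only [xi, h0, if_true] using h1
  set c := f' p - Matrix.vecMul (f p) Λ with hc
  refine ⟨_, hL.isIsometry (c := c) (fun h0 => ?_) (fun h0 => ?_), fun x hx => ?_⟩
  · rw [hc, Pi.sub_apply, hL.vecMul_four h0, mem_spaceForm_zero (hf.mem p hp) h0,
      mem_spaceForm_zero (hf'.mem p hp) h0, sub_zero]
  · have h1 : Matrix.vecMul (xi L₀ (f p)) Λ = xi L₀ (f' p) := hrow p hp 4
    simp only [xi, h0, if_false] at h1
    rw [hc, h1, sub_self]
  · set T := (Matrix.vecMulLinear Λ).toContinuousLinearMap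
    have hconst : f' x - T (f x) = f' p - T (f p) := by
      refine hV.is_const_of_fderiv_eq_zero (𝕜 := ℝ) (f := fun z => f' z - T (f z)) hVc
        ((hf'.smooth.sub (T.contDiff.comp_contDiffOn hf.smooth)).differentiableOn (by simp))
        (fun z hz => ?_) hx hp
      have d1 := differentiableAt_of_contDiffOn hV hf'.smooth hz
      have d2 := differentiableAt_of_contDiffOn hV hf.smooth hz
      have h2 : ∀ w, dd w (fun y => T (f y)) z = T (dd w f z) := fun w =>
        congrArg (fun S => S w) (T.hasFDerivAt.comp z d2.hasFDerivAt).fderiv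
      refine ContinuousLinearMap.ext fun w => ?_
      have r0 : T (dd wp f z) = dd wp f' z := hrow z hz 0
      have r1 : T (dd wm f z) = dd wm f' z := hrow z hz 1
      have d3 : DifferentiableAt ℝ (fun y => T (f y)) z :=
        (T.hasFDerivAt.comp z d2.hasFDerivAt).differentiableAt
      rw [fderiv_apply_eq_dd, dd_sub d1 d3, dd_sub d1 d3, h2, h2, r0, r1]
      simp
    have h3 : f' x = T (f x) + (f' p - T (f p)) := by rw [← hconst]; abel
    exact h3

/-! ### Local normal frames -/

theorem exists_ne_zero_dotProduct (r : Fin 4 → Fin 5 → ℝ) :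
    ∃ z : Fin 5 → ℝ, z ≠ 0 ∧ ∀ i, r i ⬝ᵥ z = 0 := by
  have hdet : (Matrix.of ![r 0, r 1, r 2, r 3, 0]).det = 0 :=
    Matrix.det_eq_zero_of_row_eq_zero 4 fun j => rfl
  obtain ⟨z, hz, h⟩ := Matrix.exists_mulVec_eq_zero_iff.2 hdet
  refine ⟨z, hz, fun i => ?_⟩
  fin_cases i
  · exact congrFun h 0
  · exact congrFun h 1
  · exact congrFun h 2
  · exact congrFun h 3

/-- The component of `w` orthogonal to `a`, `b`, `ξ`, where these vectors are orthogonal with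
squares `E`, `-E`, `κ`. -/
def orthPart (c E κ : ℝ) (a b ξ w : Fin 5 → ℝ) : Fin 5 → ℝ :=
  w - (bil c w a / E) • a + (bil c w b / E) • b - (bil c w ξ / κ) • ξ

section Orth

variable {c E κ : ℝ} {a b ξ : Fin 5 → ℝ}

theorem bil_orthPart (hE : 0 < E) (hκ : κ ≠ 0)
    (haa : bil c a a = E) (hbb : bil c b b = -E) (hξξ : bil c ξ ξ = κ) (hab : bil c a b = 0)
    (haξ : bil c a ξ = 0) (hbξ : bil c b ξ = 0) (w : Fin 5 → ℝ) :
    bil c (orthPart c E κ a b ξ w) a = 0 ∧ bil c (orthPart c E κ a b ξ w) b = 0 ∧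
    bil c (orthPart c E κ a b ξ w) ξ = 0 ∧
    bil c (orthPart c E κ a b ξ w) (orthPart c E κ a b ξ w)
      = bil c w w - bil c w a ^ 2 / E + bil c w b ^ 2 / E - bil c w ξ ^ 2 / κ := by
  have hba : bil c b a = 0 := by rw [bil_comm, hab]
  have hξa : bil c ξ a = 0 := by rw [bil_comm, haξ]
  have hξb : bil c ξ b = 0 := by rw [bil_comm, hbξ]
  have e1 := bil_comm c a w
  have e2 := bil_comm c b w
  have e3 := bil_comm c ξ w
  simp only [orthPart, bil_add_left, bil_sub_left, bil_smul_left, bil_add_right, bil_sub_right,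
    bil_smul_right, haa, hbb, hξξ, hab, haξ, hbξ, hba, hξa, hξb, e1, e2, e3]
  refine ⟨?_, ?_, ?_, ?_⟩ <;> field_simp <;> ring

/-- The orthogonal complement of a time-like plane and of the normal vector `ξ` of the space form
is not semidefinite. -/
theorem exists_orthPart_pos_neg (hc : c * c = 1) (hE : 0 < E) (hκ : 0 < κ * c)
    (haa : bil c a a = E) (hbb : bil c b b = -E) (hξξ : bil c ξ ξ = κ) (hab : bil c a b = 0)
    (haξ : bil c a ξ = 0) (hbξ : bil c b ξ = 0) :
    (∃ w, 0 < bil c (orthPart c E κ a b ξ w) (orthPart c E κ a b ξ w)) ∧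
    ∃ w, bil c (orthPart c E κ a b ξ w) (orthPart c E κ a b ξ w) < 0 := by
  have hκ0 : κ ≠ 0 := by rintro rfl; simp at hκ
  have hb := fun w => (bil_orthPart hE hκ0 haa hbb hξξ hab haξ hbξ w).2.2.2
  have row : ∀ y z : Fin 5 → ℝ, ![y 0, y 1, -y 2, -y 3, c * y 4] ⬝ᵥ z = bil c z y := by
    intro y z
    simp only [dotProduct, Fin.sum_univ_five, Matrix.cons_val, bil]; ring
  have sq : ∀ y : Fin 5 → ℝ, y ≠ 0 → 0 < y 0 ^ 2 + y 1 ^ 2 + y 2 ^ 2 + y 3 ^ 2 + y 4 ^ 2 := by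
    intro y hy
    by_contra! h
    apply hy
    have := sq_nonneg (y 0)
    have := sq_nonneg (y 1)
    have := sq_nonneg (y 2)
    have := sq_nonneg (y 3)
    have := sq_nonneg (y 4)
    ext i
    refine (pow_eq_zero_iff two_ne_zero).1 ?_
    fin_cases i <;> simp only [Fin.zero_eta, Fin.mk_one, Fin.reduceFinMk] <;> linarith
  -- a vector in the maximal definite subspace spanned by basis vectors, orthogonal to those of
  -- `a`, `b`, `ξ` whose components would have the wrong sign
  rcases mul_self_eq_one_iff.1 hc with rfl | rfl
  · have hκ' : 0 < κ := by linarith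
    constructor
    · obtain ⟨z, hz, h⟩ := exists_ne_zero_dotProduct ![Pi.single 2 1, Pi.single 3 1,
        ![a 0, a 1, -a 2, -a 3, 1 * a 4], ![ξ 0, ξ 1, -ξ 2, -ξ 3, 1 * ξ 4]]
      have h2 := h 0
      have h3 := h 1
      have h4 := h 2
      have h5 := h 3
      simp only [Matrix.cons_val, row, single_one_dotProduct] at h2 h3 h4 h5
      refine ⟨z, ?_⟩
      have := sq z hz
      rw [hb, h4, h5]
      have h6 : bil 1 z z = z 0 ^ 2 + z 1 ^ 2 + z 2 ^ 2 + z 3 ^ 2 + z 4 ^ 2 := by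
        simp only [bil, h2, h3]; ring
      have h7 : 0 ≤ bil 1 z b ^ 2 / E := by positivity
      rw [h6]; simp only [ne_eq, OfNat.ofNat_ne_zero, not_false_eq_true, zero_pow, zero_div]
      linarith
    · obtain ⟨z, hz, h⟩ := exists_ne_zero_dotProduct ![Pi.single 0 1, Pi.single 1 1,
        Pi.single 4 1, ![b 0, b 1, -b 2, -b 3, 1 * b 4]]
      have h2 := h 0
      have h3 := h 1
      have h4 := h 2
      have h5 := h 3
      simp only [Matrix.cons_val, row, single_one_dotProduct] at h2 h3 h4 h5
      refine ⟨z, ?_⟩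
      have := sq z hz
      rw [hb, h5]
      have h6 : bil 1 z z = -(z 0 ^ 2 + z 1 ^ 2 + z 2 ^ 2 + z 3 ^ 2 + z 4 ^ 2) := by
        simp only [bil, h2, h3, h4]; ring
      have h7 : 0 ≤ bil 1 z a ^ 2 / E := by positivity
      have h8 : 0 ≤ bil 1 z ξ ^ 2 / κ := by positivity
      rw [h6]; simp only [ne_eq, OfNat.ofNat_ne_zero, not_false_eq_true, zero_pow, zero_div]
      linarith
  · have hκ' : 0 < -κ := by linarith
    constructor
    · obtain ⟨z, hz, h⟩ := exists_ne_zero_dotProduct ![Pi.single 2 1, Pi.single 3 1,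
        Pi.single 4 1, ![a 0, a 1, -a 2, -a 3, -1 * a 4]]
      have h2 := h 0
      have h3 := h 1
      have h4 := h 2
      have h5 := h 3
      simp only [Matrix.cons_val, row, single_one_dotProduct] at h2 h3 h4 h5
      refine ⟨z, ?_⟩
      have := sq z hz
      rw [hb, h5]
      have h6 : bil (-1) z z = z 0 ^ 2 + z 1 ^ 2 + z 2 ^ 2 + z 3 ^ 2 + z 4 ^ 2 := by
        simp only [bil, h2, h3, h4]; ring
      have h7 : 0 ≤ bil (-1) z b ^ 2 / E := by positivity
      have h8 : 0 ≤ bil (-1) z ξ ^ 2 / -κ := by positivity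
      rw [div_neg] at h8
      rw [h6]; simp only [ne_eq, OfNat.ofNat_ne_zero, not_false_eq_true, zero_pow, zero_div]
      linarith
    · obtain ⟨z, hz, h⟩ := exists_ne_zero_dotProduct ![Pi.single 0 1, Pi.single 1 1,
        ![b 0, b 1, -b 2, -b 3, -1 * b 4], ![ξ 0, ξ 1, -ξ 2, -ξ 3, -1 * ξ 4]]
      have h2 := h 0
      have h3 := h 1
      have h4 := h 2
      have h5 := h 3
      simp only [Matrix.cons_val, row, single_one_dotProduct] at h2 h3 h4 h5
      refine ⟨z, ?_⟩
      have := sq z hz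
      rw [hb, h4, h5]
      have h6 : bil (-1) z z = -(z 0 ^ 2 + z 1 ^ 2 + z 2 ^ 2 + z 3 ^ 2 + z 4 ^ 2) := by
        simp only [bil, h2, h3]; ring
      have h7 : 0 ≤ bil (-1) z a ^ 2 / E := by positivity
      rw [h6]; simp only [ne_eq, OfNat.ofNat_ne_zero, not_false_eq_true, zero_pow, zero_div]
      linarith

end Orth

theorem det_ne_zero_of_orthogonal {c E κ : ℝ} (hE : E ≠ 0) (hκ : κ ≠ 0)
    {a n b m ξ : Fin 5 → ℝ} (haa : bil c a a = E) (hbb : bil c b b = -E) (hξξ : bil c ξ ξ = κ)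
    (hab : bil c a b = 0) (haξ : bil c a ξ = 0) (hbξ : bil c b ξ = 0)
    (hna : bil c n a = 0) (hnb : bil c n b = 0) (hnξ : bil c n ξ = 0)
    (hma : bil c m a = 0) (hmb : bil c m b = 0) (hmξ : bil c m ξ = 0)
    (hnn : bil c n n = E) (hmm : bil c m m = -E) (hnm : bil c n m = 0) :
    (Matrix.of ![a, n, b, m, ξ]).det ≠ 0 := by
  have h : Matrix.of ![a, n, b, m, ξ] * bilMatrix c * (Matrix.of ![a, n, b, m, ξ]).transpose
      = Matrix.diagonal ![E, E, -E, -E, κ] := by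
    ext i j
    rw [mul_bilMatrix_mul_transpose]
    have := bil_comm c
    fin_cases i <;> fin_cases j <;> simp <;> first | assumption | (rw [bil_comm]; assumption)
  intro h0
  have h1 := congrArg Matrix.det h
  rw [Matrix.det_mul, Matrix.det_mul, h0, Matrix.det_diagonal, Fin.prod_univ_five] at h1
  simp [hE, hκ] at h1

/-- Every point of a time-like surface has a neighbourhood with a normal frame. -/
theorem IsZMCOn.exists_normalFrame {L₀ : ℝ} {V : Set (ℝ × ℝ)} (hV : IsOpen V)
    {f : ℝ × ℝ → Fin 5 → ℝ} (hf : IsZMCOn L₀ V f) (o : ℤˣ) {p : ℝ × ℝ} (hp : p ∈ V) :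
    ∃ V' : Set (ℝ × ℝ), IsOpen V' ∧ p ∈ V' ∧ V' ⊆ V ∧
      ∃ N₁ N₂ : ℝ × ℝ → Fin 5 → ℝ, IsNormalFrame L₀ o V' f N₁ N₂ := by
  set c := tau L₀
  set κ := kap L₀
  set a := du f
  set b := dv f
  set ξ := fun x => xi L₀ (f x)
  set E := fun x => form L₀ (du f x) (du f x)
  have sa : ContDiffOn ℝ ∞ a V := contDiffOn_dd hV hf.smooth _
  have sb : ContDiffOn ℝ ∞ b V := contDiffOn_dd hV hf.smooth _
  have sξ : ContDiffOn ℝ ∞ ξ V := contDiffOn_xi hf.smooth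
  have sE : ContDiffOn ℝ ∞ E V := contDiffOn_bil _ sa sa
  have ta : ∀ x ∈ V, IsTangent L₀ (f x) (a x) := fun x hx => hf.tangent hV hx _
  have tb : ∀ x ∈ V, IsTangent L₀ (f x) (b x) := fun x hx => hf.tangent hV hx _
  have conv : ∀ {x} {y z : Fin 5 → ℝ}, IsTangent L₀ (f x) z → form L₀ y z = bil c y z := fun h =>
    form_eq_bil fun h0 => Or.inr (h.apply_four h0)
  have haa : ∀ x ∈ V, bil c (a x) (a x) = E x := fun x hx => (conv (ta x hx)).symm
  have hbb : ∀ x ∈ V, bil c (b x) (b x) = -E x := fun x hx =>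
    (conv (tb x hx)).symm.trans (hf.neg x hx)
  have hab : ∀ x ∈ V, bil c (a x) (b x) = 0 := fun x hx =>
    (conv (tb x hx)).symm.trans (hf.orth x hx)
  have haξ : ∀ x ∈ V, bil c (a x) (ξ x) = 0 := fun x hx => isTangent_iff.1 (ta x hx)
  have hbξ : ∀ x ∈ V, bil c (b x) (ξ x) = 0 := fun x hx => isTangent_iff.1 (tb x hx)
  have hξξ : ∀ x ∈ V, bil c (ξ x) (ξ x) = κ := fun x hx => bil_xi_self (hf.mem x hx)
  have hE : ∀ x ∈ V, 0 < E x := hf.pos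
  have hκ := kap_ne_zero L₀
  obtain ⟨⟨w₁, hw₁⟩, ⟨w₂, hw₂⟩⟩ := exists_orthPart_pos_neg (tau_mul_self L₀) (hE p hp)
    (kap_mul_tau_pos L₀) (haa p hp) (hbb p hp) (hξξ p hp) (hab p hp) (haξ p hp) (hbξ p hp)
  set π : (Fin 5 → ℝ) → ℝ × ℝ → Fin 5 → ℝ := fun w x => orthPart c (E x) κ (a x) (b x) (ξ x) w
  have hπ : ∀ w, ∀ x ∈ V, bil c (π w x) (a x) = 0 ∧ bil c (π w x) (b x) = 0 ∧
      bil c (π w x) (ξ x) = 0 := by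
    intro w x hx
    obtain ⟨h1, h2, h3, -⟩ := bil_orthPart (hE x hx) hκ (haa x hx) (hbb x hx) (hξξ x hx)
      (hab x hx) (haξ x hx) (hbξ x hx) w
    exact ⟨h1, h2, h3⟩
  have sπ : ∀ w, ContDiffOn ℝ ∞ (π w) V := by
    intro w
    have hne : ∀ x ∈ V, E x ≠ 0 := fun x hx => (hE x hx).ne'
    exact ((contDiffOn_const.sub
      (((contDiffOn_bil c contDiffOn_const sa).div sE hne).smul sa)).add
      (((contDiffOn_bil c contDiffOn_const sb).div sE hne).smul sb)).sub
      (((contDiffOn_bil c contDiffOn_const sξ).div_const κ).smul sξ)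
  set n := π w₁
  set A := fun x => bil c (n x) (n x)
  have sA : ContDiffOn ℝ ∞ A V := contDiffOn_bil _ (sπ w₁) (sπ w₁)
  have oA : IsOpen (V ∩ A ⁻¹' Ioi 0) := sA.continuousOn.isOpen_inter_preimage hV isOpen_Ioi
  set V₁ := V ∩ A ⁻¹' Ioi 0
  have sub₁ : V₁ ⊆ V := inter_subset_left
  have hA : ∀ x ∈ V₁, 0 < A x := fun x hx => hx.2
  set m : ℝ × ℝ → Fin 5 → ℝ := fun x => π w₂ x - (bil c (π w₂ x) (n x) / A x) • n x
  have sm : ContDiffOn ℝ ∞ m V₁ := ((sπ w₂).mono sub₁).sub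
    ((((contDiffOn_bil c (sπ w₂) (sπ w₁)).mono sub₁).div (sA.mono sub₁)
      fun x hx => (hA x hx).ne').smul ((sπ w₁).mono sub₁))
  set B := fun x => -bil c (m x) (m x)
  have sB : ContDiffOn ℝ ∞ B V₁ := (contDiffOn_bil _ sm sm).neg
  have oB : IsOpen (V₁ ∩ B ⁻¹' Ioi 0) := sB.continuousOn.isOpen_inter_preimage oA isOpen_Ioi
  set V₂ := V₁ ∩ B ⁻¹' Ioi 0
  have sub₂ : V₂ ⊆ V₁ := inter_subset_left
  have hB : ∀ x ∈ V₂, 0 < B x := fun x hx => hx.2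
  have hnm : ∀ x ∈ V₁, bil c (n x) (m x) = 0 := by
    intro x hx
    have h1 := (hA x hx).ne'
    simp only [m, bil_sub_right, bil_smul_right, A] at h1 ⊢
    rw [bil_comm _ (π w₂ x)]
    field_simp
    ring
  have hm : ∀ x ∈ V₁, bil c (m x) (a x) = 0 ∧ bil c (m x) (b x) = 0 ∧ bil c (m x) (ξ x) = 0 := by
    intro x hx
    obtain ⟨h1, h2, h3⟩ := hπ w₁ x (sub₁ hx)
    obtain ⟨h4, h5, h6⟩ := hπ w₂ x (sub₁ hx)
    simp only [m, n, bil_sub_left, bil_smul_left, h1, h2, h3, h4, h5, h6]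
    simp
  have hp₁ : p ∈ V₁ := ⟨hp, hw₁⟩
  have hp₂ : p ∈ V₂ := by
    refine ⟨hp₁, ?_⟩
    have h1 := hA p hp₁
    have h2 : B p = -bil c (π w₂ p) (π w₂ p) + bil c (π w₂ p) (n p) ^ 2 / A p := by
      have h3 := hnm p hp₁
      simp only [B, m] at h3 ⊢
      rw [bil_sub_left, bil_smul_left, h3, bil_sub_right, bil_smul_right]
      ring
    change 0 < B p
    rw [h2]
    have h4 : bil c (π w₂ p) (π w₂ p) < 0 := hw₂
    have h5 : 0 ≤ bil c (π w₂ p) (n p) ^ 2 / A p := by positivity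
    linarith
  have sub : V₂ ⊆ V := sub₂.trans sub₁
  set N₁ : ℝ × ℝ → Fin 5 → ℝ := fun x => √(E x / A x) • n x
  set M : ℝ × ℝ → Fin 5 → ℝ := fun x => √(E x / B x) • m x
  have pEA : ∀ x ∈ V₂, 0 < E x / A x := fun x hx => div_pos (hE x (sub hx)) (hA x (sub₂ hx))
  have pEB : ∀ x ∈ V₂, 0 < E x / B x := fun x hx => div_pos (hE x (sub hx)) (hB x hx)
  have sN : ContDiffOn ℝ ∞ N₁ V₂ :=
    (((sE.mono sub).div (sA.mono sub) fun x hx => (hA x (sub₂ hx)).ne').sqrt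
      fun x hx => (pEA x hx).ne').smul ((sπ w₁).mono sub)
  have sM : ContDiffOn ℝ ∞ M V₂ :=
    (((sE.mono sub).div (sB.mono sub₂) fun x hx => (hB x hx).ne').sqrt
      fun x hx => (pEB x hx).ne').smul (sm.mono sub₂)
  have N_orth : ∀ x ∈ V₂, bil c (N₁ x) (a x) = 0 ∧ bil c (N₁ x) (b x) = 0 ∧
      bil c (N₁ x) (ξ x) = 0 := by
    intro x hx
    obtain ⟨h1, h2, h3⟩ := hπ w₁ x (sub hx)
    simp only [N₁, n, bil_smul_left, h1, h2, h3]; simp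
  have M_orth : ∀ x ∈ V₂, bil c (M x) (a x) = 0 ∧ bil c (M x) (b x) = 0 ∧
      bil c (M x) (ξ x) = 0 := by
    intro x hx
    obtain ⟨h1, h2, h3⟩ := hm x (sub₂ hx)
    simp only [M, bil_smul_left, h1, h2, h3]; simp
  have hNN : ∀ x ∈ V₂, bil c (N₁ x) (N₁ x) = E x := by
    intro x hx
    have h1 := (hA x (sub₂ hx)).ne'
    have h2 := Real.mul_self_sqrt (pEA x hx).le
    simp only [N₁, bil_smul_left, bil_smul_right]
    rw [← mul_assoc, h2]
    exact div_mul_cancel₀ _ h1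
  have hMM : ∀ x ∈ V₂, bil c (M x) (M x) = -E x := by
    intro x hx
    have h1 := (hB x hx).ne'
    have h2 := Real.mul_self_sqrt (pEB x hx).le
    simp only [M, bil_smul_left, bil_smul_right]
    rw [← mul_assoc, h2, show bil c (m x) (m x) = -B x from (neg_neg _).symm, mul_neg,
      div_mul_cancel₀ _ h1]
  have hNM : ∀ x ∈ V₂, bil c (N₁ x) (M x) = 0 := by
    intro x hx
    simp only [N₁, M, bil_smul_left, bil_smul_right, hnm x (sub₂ hx)]; simp
  clear_value N₁ M
  set vol : ℝ × ℝ → ℝ := fun x => (Matrix.of ![a x, N₁ x, b x, M x, ξ x]).det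
  have hvol : ∀ x ∈ V₂, vol x ≠ 0 := by
    intro x hx
    have hx' := sub hx
    obtain ⟨h1, h2, h3⟩ := N_orth x hx
    obtain ⟨h4, h5, h6⟩ := M_orth x hx
    exact det_ne_zero_of_orthogonal (hE x hx').ne' hκ (haa x hx') (hbb x hx') (hξξ x hx')
      (hab x hx') (haξ x hx') (hbξ x hx') h1 h2 h3 h4 h5 h6 (hNN x hx) (hMM x hx) (hNM x hx)
  have cvol : ContinuousOn vol V₂ := by
    have h1 : ContinuousOn (fun y => (Matrix.of ![a y, N₁ y, b y, M y, ξ y] :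
        Matrix (Fin 5) (Fin 5) ℝ)) V₂ := by
      refine continuousOn_pi.2 fun i => ?_
      fin_cases i
      · exact (sa.mono sub).continuousOn
      · exact sN.continuousOn
      · exact (sb.mono sub).continuousOn
      · exact sM.continuousOn
      · exact (sξ.mono sub).continuousOn
    have h2 : Continuous (Matrix.det : Matrix (Fin 5) (Fin 5) ℝ → ℝ) := continuous_id.matrix_det
    have h3 := h2.comp_continuousOn h1
    simp only [Function.comp_def] at h3
    exact h3
  -- the sign of the time-like normal vector is determined by the orientation
  obtain ⟨t, ht, ht0⟩ : ∃ t : ℝ, t * t = 1 ∧ 0 < ((o : ℤ) : ℝ) * (t * vol p) := by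
    have h1 : ((o : ℤ) : ℝ) * vol p ≠ 0 := mul_ne_zero (unit_ne_zero o) (hvol p hp₂)
    rcases lt_or_gt_of_ne h1 with h | h
    · exact ⟨-1, by norm_num, by linarith⟩
    · exact ⟨1, by norm_num, by linarith⟩
  have oV : IsOpen (V₂ ∩ (fun x => ((o : ℤ) : ℝ) * (t * vol x)) ⁻¹' Ioi 0) :=
    (continuousOn_const.mul (continuousOn_const.mul cvol)).isOpen_inter_preimage oB isOpen_Ioi
  refine ⟨_, oV, ⟨hp₂, ht0⟩, inter_subset_left.trans sub, N₁, fun x => t • M x, ?_⟩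
  have tN : ∀ x ∈ V₂, IsTangent L₀ (f x) (N₁ x) := fun x hx =>
    isTangent_iff.2 (N_orth x hx).2.2
  have tM : ∀ x ∈ V₂, IsTangent L₀ (f x) (t • M x) := fun x hx =>
    isTangent_iff.2 (by rw [bil_smul_left, (M_orth x hx).2.2, mul_zero])
  refine ⟨sN.mono inter_subset_left, (sM.const_smul t).mono inter_subset_left,
    fun x hx => tN x hx.1, fun x hx => tM x hx.1, fun x hx => ?_, fun x hx => ?_, fun x hx => ?_,
    fun x hx => ?_, fun x hx => ?_, fun x hx => ?_⟩
  · rw [conv (ta x (sub hx.1)), conv (tb x (sub hx.1))]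
    exact ⟨(N_orth x hx.1).1, (N_orth x hx.1).2.1⟩
  · rw [conv (ta x (sub hx.1)), conv (tb x (sub hx.1)), bil_smul_left, bil_smul_left,
      (M_orth x hx.1).1, (M_orth x hx.1).2.1]
    simp
  · rw [conv (tN x hx.1), hNN x hx.1]
  · rw [conv (tM x hx.1), bil_smul_left, bil_smul_right, hMM x hx.1, ← mul_assoc, ht, one_mul]
  · rw [conv (tM x hx.1), bil_smul_right, hNM x hx.1, mul_zero]
  · have h1 : orientationForm L₀ (f x) (a x) (N₁ x) (b x) (t • M x) = t * vol x := by
      have h2 : Matrix.of ![a x, N₁ x, b x, t • M x, ξ x]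
          = (Matrix.of ![a x, N₁ x, b x, M x, ξ x]).updateRow 3
            (t • (Matrix.of ![a x, N₁ x, b x, M x, ξ x]) 3) := by
        ext i j
        fin_cases i <;> rfl
      change (Matrix.of ![a x, N₁ x, b x, t • M x, ξ x]).det = _
      rw [h2, Matrix.det_updateRow_smul, Matrix.updateRow_eq_self]
    rw [h1]
    exact hx.2

/-! ### Change of the paracomplex coordinate -/

section Change

variable {L₀ : ℝ} {o : ℤˣ} {V V₁ : Set (ℝ × ℝ)} {g : ℝ × ℝ → ℝ × ℝ}
  {f f₁ N₁ N₂ M₁ M₂ : ℝ × ℝ → Fin 5 → ℝ}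

/-- A paraholomorphic map preserves the null directions. -/
theorem IsParaholomorphicOn.dd_null (hg : IsParaholomorphicOn g V) {x : ℝ × ℝ} (hx : x ∈ V) :
    dd wp g x = (dd wp g x).1 • wp ∧ dd wm g x = (dd wm g x).1 • wm ∧
      0 < (dd wp g x).1 * (dd wm g x).1 := by
  obtain ⟨h1, h2, h3⟩ := hg.2 x hx
  rw [dd_wp, dd_wm]
  refine ⟨?_, ?_, ?_⟩
  · ext
    · simp
    · simp [← h1, ← h2, add_comm]
  · ext
    · simp
    · simp [← h1, ← h2]
  · simp only [Prod.fst_add, Prod.fst_sub]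
    nlinarith

theorem dd_comp {E : Type*} [NormedAddCommGroup E] [NormedSpace ℝ E] {h : ℝ × ℝ → E} {x : ℝ × ℝ}
    (dh : DifferentiableAt ℝ h (g x)) (dg : DifferentiableAt ℝ g x) (w : ℝ × ℝ) :
    dd w (fun y => h (g y)) x = dd (dd w g x) h (g x) := by
  have := (dh.hasFDerivAt.comp x dg.hasFDerivAt).fderiv
  exact congrArg (fun T => T w) this

theorem dd_smul_dir {E : Type*} [NormedAddCommGroup E] [NormedSpace ℝ E] (h : ℝ × ℝ → E)
    (x : ℝ × ℝ) (k : ℝ) (w : ℝ × ℝ) : dd (k • w) h x = k • dd w h x :=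
  map_smul (fderiv ℝ h x) k w

/-- The condition on the orientation of a normal frame, in terms of the null frame. -/
theorem IsNormalFrame.det_neg (hN : IsNormalFrame L₀ o V f N₁ N₂) {x : ℝ × ℝ} (hx : x ∈ V) :
    ((o : ℤ) : ℝ) * Matrix.det (Matrix.of fun i => nullFrame L₀ f N₁ N₂ i x) < 0 := by
  have h := hN.oriented x hx
  have e := orientationForm_null L₀ (f x) (dd wp f x) (dd wm f x) (N₁ x + N₂ x) (N₁ x - N₂ x)
  have e1 : (1 / 2 : ℝ) • (dd wp f x + dd wm f x) = du f x := by rw [dd_wp, dd_wm]; module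
  have e2 : (1 / 2 : ℝ) • (dd wp f x - dd wm f x) = dv f x := by rw [dd_wp, dd_wm]; module
  have e3 : (1 / 2 : ℝ) • (N₁ x + N₂ x + (N₁ x - N₂ x)) = N₁ x := by module
  have e4 : (1 / 2 : ℝ) • (N₁ x + N₂ x - (N₁ x - N₂ x)) = N₂ x := by module
  have e5 : (Matrix.of fun i => nullFrame L₀ f N₁ N₂ i x)
      = Matrix.of ![dd wp f x, dd wm f x, N₁ x + N₂ x, N₁ x - N₂ x, xi L₀ (f x)] := by
    ext i j; fin_cases i <;> rfl
  rw [e1, e2, e3, e4] at e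
  rw [e] at h
  rw [e5]
  linarith

/-- The null directions of two normal frames with the same orientation correspond. -/
theorem exists_null_scaling {c E E₁ κ : ℝ} {k l t : ℝ} (hE₁ : 0 < E₁) (hκ : κ ≠ 0)
    (hkl : 0 < k * l) {W W' : Fin 5 → Fin 5 → ℝ}
    (gW : ∀ i j, bil c (W i) (W j) = nullGram (2 * E) κ i j)
    (gW' : ∀ i j, bil c (W' i) (W' j) = nullGram (2 * E₁) κ i j)
    (h0 : W 0 = k • W' 0) (h1 : W 1 = l • W' 1) (h4 : W 4 = W' 4)
    (hd : t * (Matrix.of W).det < 0) (hd' : t * (Matrix.of W').det < 0) :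
    ∃ r s : ℝ, W 2 = r • W' 2 ∧ W 3 = s • W' 3 ∧ E = k * l * E₁ ∧ r * s = k * l := by
  have hEE : E = k * l * E₁ := by
    have h := gW 0 1
    rw [h0, h1, bil_smul_left, bil_smul_right, gW' 0 1] at h
    simp only [nullGram, Matrix.of_apply, Matrix.cons_val] at h
    linarith
  have ex : ∀ i, i = 2 ∨ i = 3 → ∃ p q : ℝ, W i = p • W' 2 + q • W' 3 := by
    intro i hi
    refine ⟨bil c (W i) (W' 3) / (2 * E₁), bil c (W i) (W' 2) / (2 * E₁), ?_⟩
    refine gram_ext (by positivity) hκ gW' fun j => ?_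
    have hk : k ≠ 0 := left_ne_zero_of_mul hkl.ne'
    have hl : l ≠ 0 := right_ne_zero_of_mul hkl.ne'
    have a0 : bil c (W i) (W' 0) = 0 := by
      have h := gW i 0
      rw [h0, bil_smul_right] at h
      have h' : nullGram (2 * E) κ i 0 = 0 := by rcases hi with rfl | rfl <;> simp [nullGram]
      exact (mul_eq_zero.1 (h.trans h')).resolve_left hk
    have a1 : bil c (W i) (W' 1) = 0 := by
      have h := gW i 1
      rw [h1, bil_smul_right] at h
      have h' : nullGram (2 * E) κ i 1 = 0 := by rcases hi with rfl | rfl <;> simp [nullGram]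
      exact (mul_eq_zero.1 (h.trans h')).resolve_left hl
    have a4 : bil c (W i) (W' 4) = 0 := by
      rw [← h4, gW]
      rcases hi with rfl | rfl <;> simp [nullGram]
    simp only [bil_add_left, bil_smul_left, gW']
    fin_cases j <;>
      simp only [nullGram, Matrix.of_apply, Matrix.cons_val, Fin.zero_eta, Fin.mk_one,
        Fin.reduceFinMk, a0, a1, a4] <;> field_simp <;> ring
  obtain ⟨p, q, h2⟩ := ex 2 (Or.inl rfl)
  obtain ⟨p', q', h3⟩ := ex 3 (Or.inr rfl)
  have g22 := gW 2 2
  have g33 := gW 3 3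
  have g23 := gW 2 3
  rw [h2] at g22 g23
  rw [h3] at g33 g23
  simp only [bil_add_left, bil_add_right, bil_smul_left, bil_smul_right, gW', nullGram,
    Matrix.of_apply, Matrix.cons_val] at g22 g33 g23
  have e1 : p * q = 0 := by
    have : p * q * (4 * E₁) = 0 := by linear_combination g22
    exact (mul_eq_zero.1 this).resolve_right (by positivity)
  have e2 : p' * q' = 0 := by
    have : p' * q' * (4 * E₁) = 0 := by linear_combination g33
    exact (mul_eq_zero.1 this).resolve_right (by positivity)
  have e3 : p * q' + q * p' = k * l := by
    have : (p * q' + q * p' - k * l) * (2 * E₁) = 0 := by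
      rw [hEE] at g23; linear_combination g23
    linarith [(mul_eq_zero.1 this).resolve_right (by positivity)]
  have hdet : (Matrix.of W).det = k * l * (p * q' - q * p') * (Matrix.of W').det := by
    have hmul : Matrix.of W = !![k, 0, 0, 0, 0; 0, l, 0, 0, 0; 0, 0, p, q, 0; 0, 0, p', q', 0;
        0, 0, 0, 0, 1] * Matrix.of W' := by
      ext i j
      fin_cases i <;> simp [Matrix.mul_apply, Fin.sum_univ_five, h0, h1, h2, h3, h4]
    rw [hmul, Matrix.det_mul]
    congr 1
    simp [Matrix.det_succ_row_zero, Fin.sum_univ_succ, Fin.succAbove]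
    ring
  have hpos : 0 < p * q' - q * p' := by
    rw [hdet] at hd
    by_contra! h
    have h5 : 0 ≤ (k * l * -(p * q' - q * p')) * -(t * (Matrix.of W').det) := by
      have : 0 ≤ -(p * q' - q * p') := by linarith
      have : 0 ≤ -(t * (Matrix.of W').det) := by linarith
      positivity
    linarith
  -- the orientation excludes that the two null directions are exchanged
  have hp : p ≠ 0 := by
    rintro rfl
    linarith
  have hq' : q' ≠ 0 := by
    rintro rfl
    linarith
  have hq : q = 0 := (mul_eq_zero.1 e1).resolve_left hp
  have hp' : p' = 0 := (mul_eq_zero.1 e2).resolve_right hq'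
  refine ⟨p, q', ?_, ?_, hEE, ?_⟩
  · rw [h2, hq]; simp
  · rw [h3, hp']; simp
  · rw [hq] at e3; linarith

/-- How `X₊ ± Y₊`, `X₋ ± Y₋` change with the paracomplex coordinate and the normal frame. -/
theorem IsZMCOn.change (hV : IsOpen V) (hV₁ : IsOpen V₁) (hg : IsParaholomorphicOn g V)
    (hmaps : MapsTo g V V₁) (hfg : ∀ x ∈ V, f x = f₁ (g x))
    (hf : IsZMCOn L₀ V f) (hN : IsNormalFrame L₀ o V f N₁ N₂)
    (hf₁ : IsZMCOn L₀ V₁ f₁) (hM : IsNormalFrame L₀ o V₁ f₁ M₁ M₂) {x : ℝ × ℝ} (hx : x ∈ V)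
    {k l : ℝ} (hk : k = (dd wp g x).1) (hl : l = (dd wm g x).1) :
    ∃ r s : ℝ, r * s = k * l ∧ 0 < k * l ∧
      (dataOf L₀ f N₁ N₂).ee x = k * l * (dataOf L₀ f₁ M₁ M₂).ee (g x) ∧
      r * (dataOf L₀ f N₁ N₂).cA x = k ^ 2 * (dataOf L₀ f₁ M₁ M₂).cA (g x) ∧
      s * (dataOf L₀ f N₁ N₂).cB x = k ^ 2 * (dataOf L₀ f₁ M₁ M₂).cB (g x) ∧
      s * (dataOf L₀ f N₁ N₂).cC x = l ^ 2 * (dataOf L₀ f₁ M₁ M₂).cC (g x) ∧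
      r * (dataOf L₀ f N₁ N₂).cD x = l ^ 2 * (dataOf L₀ f₁ M₁ M₂).cD (g x) := by
  have hW := hf.isNullFrame hV hN
  have hW' := hf₁.isNullFrame hV₁ hM
  set D := dataOf L₀ f N₁ N₂
  set D' := dataOf L₀ f₁ M₁ M₂
  have dg : ∀ y ∈ V, DifferentiableAt ℝ g y := fun y hy =>
    differentiableAt_of_contDiffOn hV hg.1 hy
  have first : ∀ y ∈ V, dd wp f y = (dd wp g y).1 • dd wp f₁ (g y) ∧
      dd wm f y = (dd wm g y).1 • dd wm f₁ (g y) := by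
    intro y hy
    have d1 := differentiableAt_of_contDiffOn hV₁ hf₁.smooth (hmaps hy)
    obtain ⟨n1, n2, -⟩ := hg.dd_null hy
    constructor
    · rw [dd_congr hV hfg hy, dd_comp d1 (dg y hy), ← dd_smul_dir, ← n1]
    · rw [dd_congr hV hfg hy, dd_comp d1 (dg y hy), ← dd_smul_dir, ← n2]
  obtain ⟨n1, n2, hkl⟩ := hg.dd_null hx
  rw [← hk] at n1
  rw [← hl] at n2
  rw [← hk, ← hl] at hkl
  have hfx := first x hx
  rw [← hk, ← hl] at hfx
  obtain ⟨r, s, h2, h3, hE, hrs⟩ := exists_null_scaling (D'.ee_pos (g x))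
    (kap_ne_zero L₀) hkl (W := fun i => nullFrame L₀ f N₁ N₂ i x)
    (W' := fun i => nullFrame L₀ f₁ M₁ M₂ i (g x)) (hW.gram x hx) (hW'.gram _ (hmaps hx))
    hfx.1 hfx.2 (by simp only [nullFrame, Matrix.cons_val, hfg x hx]) (hN.det_neg hx)
    (hM.det_neg (hmaps hx))
  have hE₁ := D'.ee_pos (g x)
  have hr : r ≠ 0 := left_ne_zero_of_mul (hrs.trans_ne hkl.ne')
  have hs : s ≠ 0 := right_ne_zero_of_mul (hrs.trans_ne hkl.ne')
  refine ⟨r, s, hrs, hkl, hE, ?_⟩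
  -- the normal components of the second derivatives
  have second : ∀ w : ℝ × ℝ, (∀ y ∈ V, dd w f y = (dd w g y).1 • dd w f₁ (g y)) →
      dd w g x = (dd w g x).1 • w →
      ∃ m : ℝ, dd w (dd w f) x = m • dd w f₁ (g x) + (dd w g x).1 ^ 2 • dd w (dd w f₁) (g x) := by
    intro w h1 h2
    have d1 := differentiableAt_of_contDiffOn hV₁ (contDiffOn_dd hV₁ hf₁.smooth w) (hmaps hx)
    have d2 := differentiableAt_of_contDiffOn hV (contDiffOn_dd hV hg.1 w) hx
    refine ⟨dd w (fun y => (dd w g y).1) x, ?_⟩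
    have d3 : DifferentiableAt ℝ (fun y => dd w f₁ (g y)) x :=
      (d1.hasFDerivAt.comp x (dg x hx).hasFDerivAt).differentiableAt
    rw [dd_congr hV h1 hx, dd_smul d2.fst d3, dd_comp d1 (dg x hx)]
    congr 1
    rw [h2, dd_smul_dir]
    simp only [Prod.smul_fst, smul_eq_mul, smul_smul]
    congr 1
    have := congrArg Prod.fst h2
    simp only [Prod.smul_fst, smul_eq_mul] at this
    rw [← this]; ring
  obtain ⟨m, hm⟩ := second wp (fun y hy => (first y hy).1) (by rw [← hk]; exact n1)
  obtain ⟨m', hm'⟩ := second wm (fun y hy => (first y hy).2) (by rw [← hl]; exact n2)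
  rw [← hk] at hm
  rw [← hl] at hm'
  set W := nullFrame L₀ f N₁ N₂
  set W' := nullFrame L₀ f₁ M₁ M₂
  have P : dd wp (W 0) x = m • W' 0 (g x) + k ^ 2 • dd wp (W' 0) (g x) := hm
  have Q : dd wm (W 1) x = m' • W' 1 (g x) + l ^ 2 • dd wm (W' 1) (g x) := hm'
  have P2 := congrArg (fun y => bil (tau L₀) y (W 2 x)) P
  have P3 := congrArg (fun y => bil (tau L₀) y (W 3 x)) P
  have Q2 := congrArg (fun y => bil (tau L₀) y (W 2 x)) Q
  have Q3 := congrArg (fun y => bil (tau L₀) y (W 3 x)) Q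
  have gr := hW.gram x hx
  have gr' := hW'.gram _ (hmaps hx)
  rw [hW.plus x hx, hW'.plus _ (hmaps hx)] at P2 P3
  rw [hW.minus x hx, hW'.minus _ (hmaps hx)] at Q2 Q3
  simp only [Fin.sum_univ_five, bil_add_left, bil_smul_left, gr] at P2 P3 Q2 Q3
  simp only [h2, h3, bil_smul_right, gr'] at P2 P3 Q2 Q3
  simp only [Data.mPlus, Data.mMinus, nullGram, Matrix.of_apply, Matrix.cons_val, hE]
    at P2 P3 Q2 Q3
  have c1 : (2 * D'.ee (g x)) ≠ 0 := by positivity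
  have fin : ∀ {a b c d : ℝ}, d ≠ 0 → a * b * d = c * b * d → b ≠ 0 → a = c := by
    intro a b c d hd h hb
    exact mul_right_cancel₀ hb (mul_right_cancel₀ hd h)
  refine ⟨?_, ?_, ?_, ?_⟩
  · refine fin c1 (b := s) ?_ hs
    linear_combination P3 + D.cA x * (2 * D'.ee (g x)) * hrs
  · refine fin c1 (b := r) ?_ hr
    linear_combination P2 + D.cB x * (2 * D'.ee (g x)) * hrs
  · refine fin c1 (b := r) ?_ hr
    linear_combination Q2 + D.cC x * (2 * D'.ee (g x)) * hrs
  · refine fin c1 (b := s) ?_ hs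
    linear_combination Q3 + D.cD x * (2 * D'.ee (g x)) * hrs

end Change

/-! ### Surfaces with normalised coordinates have explicit data -/

/-- A nowhere zero continuous function on a connected set has constant sign. -/
theorem exists_unit_mul_exp_log {X : Type*} [TopologicalSpace X] {V : Set X}
    (hV : IsPreconnected V) {g : X → ℝ} (hg : ContinuousOn g V) (h0 : ∀ x ∈ V, g x ≠ 0) :
    ∃ ε : ℤˣ, ∀ x ∈ V, g x = ((ε : ℤ) : ℝ) * Real.exp (Real.log (g x)) := by
  have key : (∀ x ∈ V, 0 < g x) ∨ ∀ x ∈ V, g x < 0 := by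
    by_contra! h
    obtain ⟨⟨x, hx, hx0⟩, ⟨y, hy, hy0⟩⟩ := h
    obtain ⟨z, hz, hz0⟩ := hV.intermediate_value hx hy hg ⟨hx0, hy0⟩
    exact h0 z hz hz0
  rcases key with h | h
  · exact ⟨1, fun x hx => by rw [Real.exp_log (h x hx)]; simp⟩
  · exact ⟨-1, fun x hx => by
      rw [Real.exp_log_eq_abs (h x hx).ne, abs_of_neg (h x hx)]; simp⟩

/-- In a coordinate with `e^{2λ} |X₊ + Y₊| |X₋ + Y₋| = 1`, solutions of the Gauss, Codazzi and Ricci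
equations with `X₊² ≠ Y₊²` and `X₋ = Y₋ ≠ 0` are given by the explicit formulas. -/
theorem Data.GCR.isExplicitOn {L₀ : ℝ} {V : Set (ℝ × ℝ)} (hV : IsOpen V) (hVc : IsPreconnected V)
    {D : Data} (hD : D.IsSmoothOn V) (h : ∀ x ∈ V, D.GCR L₀ x) (hnull : D.IsNullTypeOn V)
    (hnorm : ∀ x ∈ V, |D.ee x * D.cA x * D.cB x| = 1) : IsExplicitOn L₀ V D := by
  rw [Data.isNullTypeOn_iff] at hnull
  have nA : ∀ x ∈ V, D.cA x ≠ 0 := fun x hx => (hnull x hx).1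
  have nC : ∀ x ∈ V, D.cC x ≠ 0 := fun x hx => (hnull x hx).2.1
  have hcD : ∀ x ∈ V, D.cD x = 0 := fun x hx => (hnull x hx).2.2.1
  have nB : ∀ x ∈ V, D.cB x ≠ 0 := fun x hx => (hnull x hx).2.2.2
  obtain ⟨ε', hA⟩ := exists_unit_mul_exp_log hVc hD.cA.continuousOn nA
  obtain ⟨ε'', hB⟩ := exists_unit_mul_exp_log hVc hD.cB.continuousOn nB
  obtain ⟨ε₁, hC⟩ := exists_unit_mul_exp_log hVc hD.cC.continuousOn nC
  set P : ℝ × ℝ → ℝ := fun x => Real.log (D.cA x) with hP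
  set R : ℝ × ℝ → ℝ := fun x => Real.log (D.cB x) with hR
  set Q : ℝ × ℝ → ℝ := fun x => Real.log (D.cC x) with hQ
  have sP : ContDiffOn ℝ ∞ P V := hD.cA.log nA
  have sR : ContDiffOn ℝ ∞ R V := hD.cB.log nB
  have sQ : ContDiffOn ℝ ∞ Q V := hD.cC.log nC
  have sf₁ : ContDiffOn ℝ ∞ (fun x => P x - Q x + 2 * R x) V :=
    (sP.sub sQ).add (contDiffOn_const.mul sR)
  have sf₂ : ContDiffOn ℝ ∞ (fun x => Q x - R x) V := sQ.sub sR
  have hlam : ∀ x ∈ V, D.lam x = -(1 / 2) * (P x + R x) := by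
    intro x hx
    have h1 := congrArg Real.log (hnorm x hx)
    rw [Real.log_abs, Real.log_one, mul_assoc, Real.log_mul (D.ee_pos x).ne'
      (mul_ne_zero (nA x hx) (nB x hx)), Real.log_mul (nA x hx) (nB x hx), Data.ee,
      Real.log_exp] at h1
    simp only [hP, hR]
    linarith
  have dlam : ∀ x ∈ V, ∀ w, dd w D.lam x = -(1 / 2) * (dd w P x + dd w R x) := by
    intro x hx w
    have d1 := differentiableAt_of_contDiffOn hV sP hx
    have d2 := differentiableAt_of_contDiffOn hV sR hx
    rw [dd_congr hV hlam hx, dd_const_mul _ (d1.fun_add d2), dd_add d1 d2]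
  have hmp : ∀ x ∈ V, D.mp x = dd wp Q x - (1 / 2) * (dd wp P x + dd wp R x) := by
    intro x hx
    have h1 := dd_log (differentiableAt_of_contDiffOn hV hD.cC hx) (nC x hx) wp
    rw [(h x hx).codazzi_C, dlam x hx] at h1
    have h2 : dd wp Q x = -(-(1 / 2) * (dd wp P x + dd wp R x) - D.mp x) := by
      refine h1.trans ?_
      have := nC x hx
      field_simp
    linarith
  have hmm : ∀ x ∈ V, D.mm x = (1 / 2) * (dd wm R x - dd wm P x) := by
    intro x hx
    have h1 := dd_log (differentiableAt_of_contDiffOn hV hD.cA hx) (nA x hx) wm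
    rw [(h x hx).codazzi_A, dlam x hx] at h1
    have h2 : dd wm P x = -(-(1 / 2) * (dd wm P x + dd wm R x) + D.mm x) := by
      refine h1.trans ?_
      have := nA x hx
      field_simp
    linarith
  have hAC : ∀ x ∈ V, D.cA x * D.cC x = ((ε' * ε₁ : ℤˣ) : ℤ) * Real.exp (P x + Q x) := by
    intro x hx
    rw [hA x hx, hC x hx, Real.exp_add]
    push_cast
    ring
  -- the Gauss and Ricci equations in terms of `P`, `Q`, `R`
  have second : ∀ x ∈ V, dd wm (dd wp P) x + dd wm (dd wp R) x
        = 2 * L₀ * D.ee x - D.cA x * D.cC x ∧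
      dd wm (dd wp Q) x - dd wm (dd wp R) x = -(D.cA x * D.cC x) := by
    intro x hx
    have dPw := fun w => differentiableAt_of_contDiffOn hV (contDiffOn_dd hV sP w) hx
    have dQw := fun w => differentiableAt_of_contDiffOn hV (contDiffOn_dd hV sQ w) hx
    have dRw := fun w => differentiableAt_of_contDiffOn hV (contDiffOn_dd hV sR w) hx
    have cP := dd_comm hV sP hx wp wm
    have cR := dd_comm hV sR hx wp wm
    have g := (h x hx).gauss
    have r := (h x hx).ricci
    rw [dd_congr hV (fun y hy => dlam y hy wp) hx, dd_const_mul _ ((dPw _).fun_add (dRw _)),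
      dd_add (dPw _) (dRw _)] at g
    rw [dd_congr hV hmp hx, dd_congr hV hmm hx, dd_sub (dQw _)
      (((dPw _).fun_add (dRw _)).const_mul _), dd_const_mul _ ((dPw _).fun_add (dRw _)),
      dd_add (dPw _) (dRw _), dd_const_mul _ ((dRw _).fun_sub (dPw _)), dd_sub (dRw _) (dPw _),
      cP, cR] at r
    constructor <;> linarith
  refine ⟨ε' * ε₁, ε', ε'', _, _, P, Q, R, sf₁, sf₂, fun x hx => ?_, fun x hx => ?_, sP, sQ, sR,
    fun _ _ => rfl, fun _ _ => rfl, fun x hx => ?_⟩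
  · obtain ⟨h1, h2⟩ := second x hx
    have hE : Real.exp (-(P x - Q x + 2 * R x) - (Q x - R x)) = D.ee x := by
      rw [Data.ee, hlam x hx]; ring_nf
    have hs : EqOn (dd wm fun x => P x - Q x + 2 * R x)
        (fun y => dd wm P y - dd wm Q y + 2 * dd wm R y) V := by
      intro y hy
      have a := differentiableAt_of_contDiffOn hV sP hy
      have b := differentiableAt_of_contDiffOn hV sQ hy
      have c := differentiableAt_of_contDiffOn hV sR hy
      simp only
      rw [dd_add (a.fun_sub b) (c.const_mul 2), dd_sub a b, dd_const_mul 2 c]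
    have a := differentiableAt_of_contDiffOn hV (contDiffOn_dd hV sP wm) hx
    have b := differentiableAt_of_contDiffOn hV (contDiffOn_dd hV sQ wm) hx
    have c := differentiableAt_of_contDiffOn hV (contDiffOn_dd hV sR wm) hx
    rw [ds_dt_eq hV sf₁ hx, hE, dd_congr hV hs hx, dd_add (a.fun_sub b) (c.const_mul 2),
      dd_sub a b, dd_const_mul 2 c, dd_comm hV sP hx wp wm, dd_comm hV sQ hx wp wm,
      dd_comm hV sR hx wp wm]
    linarith
  · obtain ⟨h1, h2⟩ := second x hx
    have hs : EqOn (dd wm fun x => Q x - R x) (fun y => dd wm Q y - dd wm R y) V := by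
      intro y hy
      exact dd_sub (differentiableAt_of_contDiffOn hV sQ hy)
        (differentiableAt_of_contDiffOn hV sR hy) _
    have b := differentiableAt_of_contDiffOn hV (contDiffOn_dd hV sQ wm) hx
    have c := differentiableAt_of_contDiffOn hV (contDiffOn_dd hV sR wm) hx
    have e : P x - Q x + 2 * R x + 2 * (Q x - R x) = P x + Q x := by ring
    rw [ds_dt_eq hV sf₂ hx, dd_congr hV hs hx, dd_sub b c, dd_comm hV sQ hx wp wm,
      dd_comm hV sR hx wp wm, h2, hAC x hx, e]
    ring
  · have eA := explicitData_cA (ε' * ε₁) ε' ε'' P Q R x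
    have eB := explicitData_cB (ε' * ε₁) ε' ε'' P Q R x
    have eC := explicitData_cC (ε' * ε₁) ε' ε'' P Q R x
    have eD := explicitData_cD (ε' * ε₁) ε' ε'' P Q R x
    have ep := explicitData_mp (ε' * ε₁) ε' ε'' P Q R x
    have em := explicitData_mm (ε' * ε₁) ε' ε'' P Q R x
    have hl : (explicitData (ε' * ε₁) ε' ε'' P Q R).lam x = -(1 / 2) * (P x + R x) := rfl
    rw [← hA x hx] at eA
    rw [← hB x hx] at eB
    have hu : ((ε' : ℤ) : ℝ) * ((ε' * ε₁ : ℤˣ) : ℤ) = ((ε₁ : ℤ) : ℝ) := by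
      push_cast
      rw [← mul_assoc, unit_mul_self, one_mul]
    rw [hu, ← hC x hx] at eC
    have eD' := hcD x hx
    have ep' := hmp x hx
    have em' := hmm x hx
    rw [← hlam x hx] at hl
    set D' := explicitData (ε' * ε₁) ε' ε'' P Q R
    simp only [Data.cA, Data.cB, Data.cC, Data.cD, Data.Xp, Data.Xm, Data.Yp, Data.Ym, Data.mp,
      Data.mm] at eA eB eC eD ep em eD' ep' em'
    refine ⟨hl.symm, ?_, ?_, ?_, ?_, ?_, ?_⟩ <;> linarith

/-! ### Paracomplex coordinates on a Lorentz surface -/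

theorem IsZMCOn.mono {L₀ : ℝ} {V V' : Set (ℝ × ℝ)} {f : ℝ × ℝ → Fin 5 → ℝ} (hf : IsZMCOn L₀ V f)
    (h : V' ⊆ V) : IsZMCOn L₀ V' f :=
  ⟨hf.smooth.mono h, fun x hx => hf.mem x (h hx), fun x hx => hf.pos x (h hx),
    fun x hx => hf.neg x (h hx), fun x hx => hf.orth x (h hx), fun x hx => hf.zero_mean x (h hx)⟩

theorem IsNormalFrame.mono {L₀ : ℝ} {o : ℤˣ} {V V' : Set (ℝ × ℝ)} {f N₁ N₂ : ℝ × ℝ → Fin 5 → ℝ}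
    (hN : IsNormalFrame L₀ o V f N₁ N₂) (h : V' ⊆ V) : IsNormalFrame L₀ o V' f N₁ N₂ :=
  ⟨hN.smooth₁.mono h, hN.smooth₂.mono h, fun x hx => hN.tangent₁ x (h hx),
    fun x hx => hN.tangent₂ x (h hx), fun x hx => hN.normal₁ x (h hx),
    fun x hx => hN.normal₂ x (h hx), fun x hx => hN.norm₁ x (h hx), fun x hx => hN.norm₂ x (h hx),
    fun x hx => hN.orth x (h hx), fun x hx => hN.oriented x (h hx)⟩

section Manifold

variable {L₀ : ℝ} {o : ℤˣ} {M : Type*} [TopologicalSpace M] [ChartedSpace (ℝ × ℝ) M]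
  {F : M → Fin 5 → ℝ}

theorem mem_lorentzGroupoid {φ : OpenPartialHomeomorph (ℝ × ℝ) (ℝ × ℝ)} :
    φ ∈ lorentzGroupoid ↔
      IsParaholomorphicOn φ φ.source ∧ IsParaholomorphicOn φ.symm φ.target :=
  mem_groupoid_of_pregroupoid

/-- Local changes of the coordinate of a chart give new charts. -/
theorem trans_mem_maximalAtlas {e : OpenPartialHomeomorph M (ℝ × ℝ)}
    (he : e ∈ lorentzGroupoid.maximalAtlas M) {φ : OpenPartialHomeomorph (ℝ × ℝ) (ℝ × ℝ)}
    (hφ : φ ∈ lorentzGroupoid) : e ≫ₕ φ ∈ lorentzGroupoid.maximalAtlas M := by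
  rw [mem_maximalAtlas_iff] at he ⊢
  intro e' he'
  obtain ⟨h1, h2⟩ := he e' he'
  constructor
  · rw [OpenPartialHomeomorph.trans_symm_eq_symm_trans_symm, OpenPartialHomeomorph.trans_assoc]
    exact lorentzGroupoid.trans (lorentzGroupoid.symm hφ) h1
  · rw [← OpenPartialHomeomorph.trans_assoc]
    exact lorentzGroupoid.trans h2 hφ

theorem ofSet_mem_lorentzGroupoid {V : Set (ℝ × ℝ)} (hV : IsOpen V) :
    OpenPartialHomeomorph.ofSet V hV ∈ lorentzGroupoid := by
  have h : IsParaholomorphicOn id V := by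
    refine ⟨contDiffOn_id, fun x _ => ?_⟩
    simp [du, dv]
  exact mem_lorentzGroupoid.2 ⟨h, h⟩

/-- The conditions on `X₊`, `Y₊`, `X₋`, `Y₋` do not depend on the coordinate and the normal
frame. -/
theorem IsLocallyExplicit.isNullType [HasGroupoid M lorentzGroupoid] (hF : IsZMCImmersion L₀ F)
    (h : IsLocallyExplicit L₀ o F) : IsNullType L₀ o F := by
  intro e he N₁ N₂ hN
  rw [Data.isNullTypeOn_iff]
  intro x hx
  obtain ⟨e₁, he₁, hp, M₁, M₂, hM, hexp⟩ := h (e.symm x)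
  have hnull := Data.isNullTypeOn_iff.1 hexp.isNullTypeOn
  have hg := (mem_lorentzGroupoid.1 (lorentzGroupoid.compatible_of_mem_maximalAtlas he he₁)).1
  have hsub : (e.symm ≫ₕ e₁).source ⊆ e.target := inter_subset_left
  have hmaps : MapsTo (e.symm ≫ₕ e₁) (e.symm ≫ₕ e₁).source e₁.target := fun y hy =>
    e₁.map_source hy.2
  have hxs : x ∈ (e.symm ≫ₕ e₁).source := ⟨hx, hp⟩
  obtain ⟨r, s, hrs, hkl, -, hA, hB, hC, hD⟩ := IsZMCOn.change (e.symm ≫ₕ e₁).open_source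
    e₁.open_target hg hmaps (f := F ∘ e.symm) (f₁ := F ∘ e₁.symm)
    (fun y hy => congrArg F (e₁.left_inv hy.2).symm) ((hF e he).mono hsub) (hN.mono hsub)
    (hF e₁ he₁) hM
    hxs rfl rfl
  obtain ⟨nA, nC, nD, nB⟩ := hnull _ (hmaps hxs)
  have hk := left_ne_zero_of_mul hkl.ne'
  have hl := right_ne_zero_of_mul hkl.ne'
  have hr : r ≠ 0 := left_ne_zero_of_mul (hrs.trans_ne hkl.ne')
  refine ⟨fun h0 => ?_, fun h0 => ?_, ?_, fun h0 => ?_⟩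
  · rw [h0, mul_zero] at hA
    exact mul_ne_zero (pow_ne_zero 2 hk) nA hA.symm
  · rw [h0, mul_zero] at hC
    exact mul_ne_zero (pow_ne_zero 2 hl) nC hC.symm
  · rw [nD, mul_zero] at hD
    exact (mul_eq_zero.1 hD).resolve_left hr
  · rw [h0, mul_zero] at hB
    exact mul_ne_zero (pow_ne_zero 2 hk) nB hB.symm

/-- The linear map that multiplies the null directions `∂/∂u ± ∂/∂v` by `k` and `l`. -/
def nullMap (k l : ℝ) : ℝ × ℝ →L[ℝ] ℝ × ℝ :=
  (k / 2) • ((ContinuousLinearMap.fst ℝ ℝ ℝ + ContinuousLinearMap.snd ℝ ℝ ℝ).smulRight wp)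
    + (l / 2) • ((ContinuousLinearMap.fst ℝ ℝ ℝ - ContinuousLinearMap.snd ℝ ℝ ℝ).smulRight wm)

theorem nullMap_apply (k l : ℝ) (w : ℝ × ℝ) : nullMap k l w
    = (k / 2 * (w.1 + w.2) + l / 2 * (w.1 - w.2), k / 2 * (w.1 + w.2) - l / 2 * (w.1 - w.2)) := by
  ext
  · simp [nullMap]
  · simp [nullMap]; ring

/-- `nullMap k l` as an equivalence. -/
def nullEquiv (k l : ℝ) (hk : k ≠ 0) (hl : l ≠ 0) : (ℝ × ℝ) ≃L[ℝ] ℝ × ℝ :=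
  ContinuousLinearEquiv.equivOfInverse (nullMap k l) (nullMap k⁻¹ l⁻¹)
    (fun w => by rw [nullMap_apply, nullMap_apply]; ext <;> simp <;> field_simp <;> ring)
    (fun w => by rw [nullMap_apply, nullMap_apply]; ext <;> simp <;> field_simp <;> ring)

theorem isParaholomorphicOn_of_nullMap {V : Set (ℝ × ℝ)} {g : ℝ × ℝ → ℝ × ℝ}
    (hg : ContDiffOn ℝ ∞ g V) {k l : ℝ × ℝ → ℝ} (hkl : ∀ x ∈ V, 0 < k x * l x)
    (h : ∀ x ∈ V, HasFDerivAt g (nullMap (k x) (l x)) x) : IsParaholomorphicOn g V := by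
  refine ⟨hg, fun x hx => ?_⟩
  have := hkl x hx
  simp only [du, dv, (h x hx).fderiv, nullMap_apply]
  refine ⟨by ring, by ring, by nlinarith⟩

/-- A function `θ > 0` with `θ_u = θ_v` is locally the factor `k` of a coordinate change with
`l = 1`. -/
theorem exists_coordinate_change {V : Set (ℝ × ℝ)} (hV : IsOpen V) {θ : ℝ × ℝ → ℝ}
    (hθ : ContDiffOn ℝ ∞ θ V) (pos : ∀ x ∈ V, 0 < θ x) (hm : ∀ x ∈ V, dd wm θ x = 0)
    {p : ℝ × ℝ} (hp : p ∈ V) :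
    ∃ φ : OpenPartialHomeomorph (ℝ × ℝ) (ℝ × ℝ), φ ∈ lorentzGroupoid ∧ p ∈ φ.source ∧
      φ.source ⊆ V ∧ ∀ x ∈ φ.source, (dd wp φ x).1 = θ x ∧ (dd wm φ x).1 = 1 := by
  obtain ⟨δ, hδ, hsub⟩ := Metric.isOpen_iff.1 hV p hp
  set B := Metric.ball p δ
  have hB : IsOpen B := Metric.isOpen_ball
  have hpB : p ∈ B := Metric.mem_ball_self hδ
  have dθ : ∀ x ∈ B, DifferentiableAt ℝ θ x := fun x hx =>
    differentiableAt_of_contDiffOn hV hθ (hsub hx)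
  have hw : ∀ x ∈ B, ∀ w : ℝ × ℝ, fderiv ℝ θ x w = (w.1 + w.2) / 2 * dd wp θ x := by
    intro x hx w
    rw [fderiv_apply_eq_dd, hm x (hsub hx)]
    simp
  -- the closed form `θ ds`, up to a constant factor
  set η : ℝ × ℝ → ℝ × ℝ →L[ℝ] ℝ × ℝ := fun x => nullMap (θ x) 1
  have hη : ∀ x ∈ B, HasFDerivAt η ((fderiv ℝ θ x).smulRight (nullMap 1 0)) x := by
    intro x hx
    have h1 := ((dθ x hx).hasFDerivAt.smul_const (nullMap 1 0)).add_const (nullMap 0 1)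
    refine h1.congr_of_eventuallyEq (Filter.Eventually.of_forall fun y => ?_)
    refine ContinuousLinearMap.ext fun w => ?_
    change nullMap (θ y) 1 w = (θ y • nullMap 1 0 + nullMap 0 1) w
    rw [add_apply, smul_apply, nullMap_apply, nullMap_apply, nullMap_apply]
    ext <;> simp <;> ring
  obtain ⟨G, hG⟩ := Convex.exists_forall_hasFDerivAt_of_fderiv_symmetric (convex_ball p δ) hB
    (fun x hx => (hη x hx).differentiableAt.differentiableWithinAt) (fun x hx a b => by
      rw [(hη x hx).fderiv]
      simp only [ContinuousLinearMap.smulRight_apply, smul_apply, hw x hx, nullMap_apply]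
      ext <;> simp <;> ring)
  have hne : ∀ x ∈ B, θ x ≠ 0 := fun x hx => (pos x (hsub hx)).ne'
  have hGe : ∀ x (hx : x ∈ B),
      HasFDerivAt G (nullEquiv (θ x) 1 (hne x hx) one_ne_zero : ℝ × ℝ →L[ℝ] ℝ × ℝ) x :=
    fun x hx => hG x hx
  have sη : ContDiffOn ℝ ∞ η B := by
    have h1 : ContDiffOn ℝ ∞ (fun x => θ x • nullMap 1 0 + nullMap 0 1) B :=
      ((hθ.mono hsub).smul contDiffOn_const).add contDiffOn_const
    refine h1.congr fun y _ => ContinuousLinearMap.ext fun w => ?_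
    change nullMap (θ y) 1 w = (θ y • nullMap 1 0 + nullMap 0 1) w
    rw [add_apply, smul_apply, nullMap_apply, nullMap_apply, nullMap_apply]
    ext <;> simp <;> ring
  have sG : ContDiffOn ℝ ∞ G B := by
    rw [contDiffOn_infty_iff_fderiv_of_isOpen hB]
    exact ⟨fun x hx => (hG x hx).differentiableAt.differentiableWithinAt,
      sη.congr fun x hx => (hG x hx).fderiv⟩
  set ψ := (sG.contDiffAt (hB.mem_nhds hpB)).toOpenPartialHomeomorph G (hGe p hpB) (by simp)
  have hψ : (ψ : ℝ × ℝ → ℝ × ℝ) = G := rfl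
  set φ := ψ.restrOpen B hB
  have hφ : (φ : ℝ × ℝ → ℝ × ℝ) = G := rfl
  have hφB : φ.source ⊆ B := by
    rw [OpenPartialHomeomorph.restrOpen_source]; exact inter_subset_right
  have hφp : p ∈ φ.source := by
    rw [OpenPartialHomeomorph.restrOpen_source]
    exact ⟨(sG.contDiffAt (hB.mem_nhds hpB)).mem_toOpenPartialHomeomorph_source _ _, hpB⟩
  have hinv : ∀ y ∈ φ.target, φ.symm y ∈ B := fun y hy => hφB (φ.map_target hy)
  refine ⟨φ, mem_lorentzGroupoid.2 ⟨?_, ?_⟩, hφp, hφB.trans hsub, fun x hx => ?_⟩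
  · refine isParaholomorphicOn_of_nullMap (k := θ) (l := fun _ => 1) (sG.mono hφB)
      (fun x hx => ?_) (fun x hx => hG x (hφB hx))
    rw [mul_one]; exact pos x (hsub (hφB hx))
  · refine isParaholomorphicOn_of_nullMap (k := fun y => (θ (φ.symm y))⁻¹) (l := fun _ => 1⁻¹)
      (fun y hy => ?_) (fun y hy => ?_) (fun y hy => ?_)
    · exact (φ.contDiffAt_symm hy (hGe _ (hinv y hy))
        (sG.contDiffAt (hB.mem_nhds (hinv y hy)))).contDiffWithinAt
    · rw [inv_one, mul_one]; exact inv_pos.2 (pos _ (hsub (hinv y hy)))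
    · exact φ.hasFDerivAt_symm hy (hGe _ (hinv y hy))
  · simp only [dd, hφ, (hG x (hφB hx)).fderiv, η, nullMap_apply]
    constructor <;> norm_num

end Manifold

/-! ### Normalised coordinates -/

/-- On a surface with `X₋ = Y₋`, the function `e^{2λ}(X₊ + Y₊)(X₋ + Y₋)` depends on `u + v`
only. -/
theorem Data.GCR.dd_wm_eq_zero {L₀ : ℝ} {V : Set (ℝ × ℝ)} (hV : IsOpen V) {D : Data}
    (hD : D.IsSmoothOn V) {x : ℝ × ℝ} (hx : x ∈ V) (h : D.GCR L₀ x) :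
    dd wm (fun y => D.ee y * D.cA y * D.cB y) x = 0 := by
  have d0 := differentiableAt_of_contDiffOn hV hD.ee hx
  have d1 := differentiableAt_of_contDiffOn hV hD.cA hx
  have d2 := differentiableAt_of_contDiffOn hV hD.cB hx
  rw [dd_mul (d0.fun_mul d1) d2, dd_mul d0 d1,
    Data.dd_ee (differentiableAt_of_contDiffOn hV hD.lam hx), h.codazzi_A, h.codazzi_B]
  ring

section Manifold

variable {L₀ : ℝ} {o : ℤˣ} {M : Type*} [TopologicalSpace M] [ChartedSpace (ℝ × ℝ) M]
  {F : M → Fin 5 → ℝ}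

/-- Around each point, some coordinate admits a normal frame, on a ball. -/
theorem IsZMCImmersion.exists_chart (hF : IsZMCImmersion L₀ F) (o : ℤˣ)
    {e : OpenPartialHomeomorph M (ℝ × ℝ)} (he : e ∈ lorentzGroupoid.maximalAtlas M) {p : M}
    (hp : p ∈ e.source) :
    ∃ V : Set (ℝ × ℝ), ∃ hV : IsOpen V, IsPreconnected V ∧ e p ∈ V ∧ V ⊆ e.target ∧
      (e ≫ₕ OpenPartialHomeomorph.ofSet V hV).target = V ∧
      e ≫ₕ OpenPartialHomeomorph.ofSet V hV ∈ lorentzGroupoid.maximalAtlas M ∧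
      ∃ N₁ N₂ : ℝ × ℝ → Fin 5 → ℝ, IsNormalFrame L₀ o V (F ∘ e.symm) N₁ N₂ := by
  obtain ⟨V', hV', hpV', hsub, N₁, N₂, hN⟩ :=
    (hF e he).exists_normalFrame e.open_target o (e.map_source hp)
  obtain ⟨δ, hδ, hball⟩ := Metric.isOpen_iff.1 hV' _ hpV'
  refine ⟨_, Metric.isOpen_ball, (convex_ball _ _).isPreconnected, Metric.mem_ball_self hδ,
    hball.trans hsub, ?_, trans_mem_maximalAtlas he (ofSet_mem_lorentzGroupoid _), N₁, N₂,
    hN.mono hball⟩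
  rw [OpenPartialHomeomorph.trans_target]
  exact inter_eq_left.2 fun y hy => hsub (hball hy)

/-- A surface with `X₊² ≠ Y₊²` and `X₋ = Y₋ ≠ 0` is given by the explicit formulas in suitable
coordinates. -/
theorem IsNullType.isLocallyExplicit [HasGroupoid M lorentzGroupoid] (hF : IsZMCImmersion L₀ F)
    (h : IsNullType L₀ o F) : IsLocallyExplicit L₀ o F := by
  intro p
  -- the hypothesis applies to charts whose whole target carries the normal frame
  have key : ∀ (e : OpenPartialHomeomorph M (ℝ × ℝ)) (V : Set (ℝ × ℝ)) (hV : IsOpen V),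
      e ∈ lorentzGroupoid.maximalAtlas M → V ⊆ e.target →
      (e ≫ₕ OpenPartialHomeomorph.ofSet V hV).target = V →
      e ≫ₕ OpenPartialHomeomorph.ofSet V hV ∈ lorentzGroupoid.maximalAtlas M →
      ∀ N₁ N₂ : ℝ × ℝ → Fin 5 → ℝ, IsNormalFrame L₀ o V (F ∘ e.symm) N₁ N₂ →
      (dataOf L₀ (F ∘ e.symm) N₁ N₂).IsSmoothOn V ∧
      (dataOf L₀ (F ∘ e.symm) N₁ N₂).IsNullTypeOn V ∧
      ∀ x ∈ V, (dataOf L₀ (F ∘ e.symm) N₁ N₂).GCR L₀ x := by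
    intro e V hV he hsub ht he' N₁ N₂ hN
    have hZ := (hF e he).mono hsub
    have hnull : (dataOf L₀ (F ∘ e.symm) N₁ N₂).IsNullTypeOn V := by
      have h1 := h _ he' N₁ N₂
      rw [ht] at h1
      exact h1 hN
    have hD := hZ.isSmoothOn hV hN
    exact ⟨hD, hnull, fun x hx => ((hZ.isNullFrame hV hN).isFlatAt hV hD hx).gcr hV hD hx
      (Data.isNullTypeOn_iff.1 hnull x hx).2.2.1⟩
  -- a first coordinate with a normal frame
  set e₀ := chartAt (ℝ × ℝ) p
  have he₀ : e₀ ∈ lorentzGroupoid.maximalAtlas M := lorentzGroupoid.chart_mem_maximalAtlas p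
  obtain ⟨V₀, hV₀, -, hp₀, hsub₀, ht₀, he₀', N₁, N₂, hN⟩ :=
    hF.exists_chart o he₀ (mem_chart_source _ p)
  obtain ⟨hD, hnull, hg⟩ := key e₀ V₀ hV₀ he₀ hsub₀ ht₀ he₀' N₁ N₂ hN
  set D := dataOf L₀ (F ∘ e₀.symm) N₁ N₂
  -- the coordinate change that normalises `q`
  set q : ℝ × ℝ → ℝ := fun y => D.ee y * D.cA y * D.cB y
  have hq0 : ∀ x ∈ V₀, q x ≠ 0 := fun x hx => by
    obtain ⟨nA, -, -, nB⟩ := Data.isNullTypeOn_iff.1 hnull x hx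
    exact mul_ne_zero (mul_ne_zero (D.ee_pos x).ne' nA) nB
  have sq : ContDiffOn ℝ ∞ q V₀ := (hD.ee.mul hD.cA).mul hD.cB
  set θ : ℝ × ℝ → ℝ := fun y => Real.exp ((1 / 4) * Real.log (q y))
  have sθ : ContDiffOn ℝ ∞ θ V₀ := (contDiffOn_const.mul (sq.log hq0)).exp
  have hθ4 : ∀ x ∈ V₀, θ x ^ 4 = |q x| := by
    intro x hx
    rw [← Real.exp_log_eq_abs (hq0 x hx), ← Real.exp_nat_mul]
    congr 1; push_cast; ring
  have dθ : ∀ x ∈ V₀, dd wm θ x = 0 := by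
    intro x hx
    have dq := differentiableAt_of_contDiffOn hV₀ sq hx
    have dl := dq.log (hq0 x hx)
    rw [dd_exp (dl.const_mul _), dd_const_mul _ dl, dd_log dq (hq0 x hx),
      (hg x hx).dd_wm_eq_zero hV₀ hD hx]
    simp
  obtain ⟨φ, hφ, hpφ, hφV, hφd⟩ := exists_coordinate_change hV₀ sθ (fun x _ => Real.exp_pos _)
    dθ hp₀
  set e₁ := e₀ ≫ₕ φ
  have he₁ : e₁ ∈ lorentzGroupoid.maximalAtlas M := trans_mem_maximalAtlas he₀ hφ
  have hp₁ : p ∈ e₁.source := ⟨mem_chart_source _ p, hpφ⟩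
  obtain ⟨V₁, hV₁, hc₁, hpV₁, hsub₁, ht₁, he₁', M₁, M₂, hM⟩ := hF.exists_chart o he₁ hp₁
  obtain ⟨hD₁, hnull₁, hg₁⟩ := key e₁ V₁ hV₁ he₁ hsub₁ ht₁ he₁' M₁ M₂ hM
  refine ⟨_, he₁', ⟨hp₁, hpV₁⟩, M₁, M₂, ?_⟩
  rw [ht₁]
  refine ⟨hM, Data.GCR.isExplicitOn hV₁ hc₁ hD₁ hg₁ hnull₁ fun y hy => ?_⟩
  -- in the new coordinate, `q` has absolute value `1`
  set V₂ := φ.source ∩ φ ⁻¹' V₁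
  have hV₂ : IsOpen V₂ := φ.isOpen_inter_preimage hV₁
  have hyt : y ∈ φ.target := (hsub₁ hy).1
  have hx : φ.symm y ∈ V₂ := ⟨φ.map_target hyt, by
    change φ (φ.symm y) ∈ V₁
    rw [φ.right_inv hyt]; exact hy⟩
  have hφ' := (mem_lorentzGroupoid.1 hφ).1
  obtain ⟨hk, hl⟩ := hφd _ hx.1
  have hV₂V : V₂ ⊆ V₀ := inter_subset_left.trans hφV
  obtain ⟨r, s, hrs, hkl, hE, hA, hB, -, -⟩ := IsZMCOn.change hV₂ hV₁ (g := φ)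
    (f := F ∘ e₀.symm) (f₁ := F ∘ e₁.symm)
    ⟨hφ'.1.mono inter_subset_left, fun x hx => hφ'.2 x hx.1⟩ (fun x hx => hx.2)
    (fun x hx => by
      change F (e₀.symm x) = F (e₀.symm (φ.symm (φ x)))
      rw [φ.left_inv hx.1])
    ((hF e₀ he₀).mono (hV₂V.trans hsub₀)) (hN.mono hV₂V) ((hF e₁ he₁).mono hsub₁) hM hx
    hk.symm hl.symm
  rw [φ.right_inv hyt] at hE hA hB
  set D₁ := dataOf L₀ (F ∘ e₁.symm) M₁ M₂
  set t := θ (φ.symm y)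
  have ht : 0 < t := Real.exp_pos _
  have h4 := hθ4 _ (hV₂V hx)
  have hq : q (φ.symm y) = t ^ 4 * (D₁.ee y * D₁.cA y * D₁.cB y) := by
    have hts : r * s = t := by rw [hrs, mul_one]
    have h5 : t * (D.cA (φ.symm y) * D.cB (φ.symm y)) = t ^ 4 * (D₁.cA y * D₁.cB y) := by
      rw [← hts]
      rw [← hts] at hA hB
      linear_combination s * D.cB (φ.symm y) * hA + (r * s) ^ 2 * D₁.cA y * hB
    simp only [q]
    rw [hE]
    linear_combination D₁.ee y * h5
  rw [hq, abs_mul, abs_of_pos (by positivity : (0 : ℝ) < t ^ 4)] at h4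
  have h6 : t ^ 4 * (|D₁.ee y * D₁.cA y * D₁.cB y| - 1) = 0 := by linarith
  have h7 : |D₁.ee y * D₁.cA y * D₁.cB y| = 1 :=
    sub_eq_zero.1 ((mul_eq_zero.1 h6).resolve_left (by positivity))
  exact h7

end Manifold

end NeutralSurface

end

theorem theorem6p1 (L₀ : ℝ) :
    (∀ (o : ℤˣ) (M : Type*) [TopologicalSpace M] [ChartedSpace (ℝ × ℝ) M]
        [HasGroupoid M NeutralSurface.lorentzGroupoid] (F : M → Fin 5 → ℝ),
        NeutralSurface.IsZMCImmersion L₀ F →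
        (NeutralSurface.IsNullType L₀ o F ↔ NeutralSurface.IsLocallyExplicit L₀ o F)) ∧
    (∀ (U : Set (ℝ × ℝ)) (D : NeutralSurface.Data), IsOpen U →
        NeutralSurface.IsExplicitOn L₀ U D →
        (∀ (o : ℤˣ), ∀ p ∈ U, ∃ V : Set (ℝ × ℝ), IsOpen V ∧ p ∈ V ∧ V ⊆ U ∧
          ∃ f N₁ N₂ : ℝ × ℝ → Fin 5 → ℝ, NeutralSurface.Realizes L₀ o V D f N₁ N₂ ∧
            (NeutralSurface.dataOf L₀ f N₁ N₂).IsNullTypeOn V) ∧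
        (∀ (o o' : ℤˣ) (V : Set (ℝ × ℝ)), IsOpen V → IsPreconnected V → V ⊆ U →
          ∀ f N₁ N₂ f' N₁' N₂' : ℝ × ℝ → Fin 5 → ℝ,
            NeutralSurface.Realizes L₀ o V D f N₁ N₂ →
            NeutralSurface.Realizes L₀ o' V D f' N₁' N₂' →
            ∃ Φ : (Fin 5 → ℝ) → (Fin 5 → ℝ), NeutralSurface.IsIsometry L₀ Φ ∧
              ∀ x ∈ V, f' x = Φ (f x))) :=
  ⟨fun _ _ _ _ _ _ hF => ⟨fun h => h.isLocallyExplicit hF, fun h => h.isNullType hF⟩,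
    fun _ _ hU hD => ⟨fun o _ hp => hD.exists_realizes hU o hp,
      fun _ _ _ hV hVc _ _ _ _ _ _ _ h h' => h.exists_isometry hV hVc h'⟩⟩
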